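/- Let $n\ge 2$, let $\Omega\subset\mathbb{R}^n$ be an arbitrary open set, and let $L=\sum_\alpha B_\alpha\partial^\alpha$ (a finite sum, with constant matrices $B_\alpha\in\mathbb{C}^{l\times m}$) be a differential operator with constant coefficients acting from $C^\infty(\Omega,\mathbb{C}^m)$ to $C^\infty(\Omega,\mathbb{C}^l)$. Put $H=L_2(\Omega,\mathbb{C}^m)$ and assume that the form $\int_\Omega|Lu(x)|^2\,dx$ with domain $\{u\in C^\infty(\Omega,\mathbb{C}^m)\cap H:\ Lu\in L_2(\Omega,\mathbb{C}^l)\}$ is closable in $H$. Let $\mathbf{a}$ be its closure, $H^1=\mathcal{D}(\mathbf{a})$ with the norm $(\mathbf{a}[u]+\|u\|^2)^{1/2}$, and let $H^1_0$ be the closure of $C_0^\infty(\Omega,\mathbb{C}^m)$ in $H^1$. Let $A_{\mathrm N}$ and $A_{\mathrm D}$ be the self-adjoint operators in $H$ generated by $\mathbf{a}$ and by its restriction to $H^1_0$, respectively (the Neumann and Dirichlet realizations of $L^*L$). For $\mathrm{B}\in\{\mathrm{N},\mathrm{D}\}$ let $\lambda_{\mathrm B,\infty}=\inf\sigma_{\mathrm{ess}}(A_{\mathrm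 B})\in(-\infty,+\infty]$ (with $\inf\varnothing=+\infty$), and let $\lambda_{\mathrm B,1}\le\lambda_{\mathrm B,2}\le\dots$ be the eigenvalues of $A_{\mathrm B}$ in $(-\infty,\lambda_{\mathrm B,\infty})$, counted with multiplicities. Then for every Dirichlet eigenvalue $\lambda_{\mathrm D,k}$ lying in $(0,\lambda_{\mathrm N,\infty})$ the eigenvalue $\lambda_{\mathrm N,k+1}$ exists and $$\lambda_{\mathrm N,k+1}\le\lambda_{\mathrm D,k}.$$ If, moreover, at least one eigenfunction of $A_{\mathrm D}$ corresponding to $\lambda_{\mathrm D,k}$ does not satisfy the Neumann boundary condition, that is, does not belong to $\mathcal{D}(A_{\mathrm N})$, then $\lambda_{\mathrm N,k+1}<\lambda_{\mathrm D,k}$. -/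

import Mathlib

open MeasureTheory Filter TopologicalSpace
open scoped Topology ContDiff

noncomputable section

namespace Payne

/-! ### Operators in a Hilbert space: spectrum, eigenvalues, operators generated by forms -/

section Abstract

variable {H K : Type*} [NormedAddCommGroup H] [InnerProductSpace ℂ H]
  [NormedAddCommGroup K] [InnerProductSpace ℂ K]

/-- The set of real `r` for which `A - r` has no bounded everywhere defined two-sided inverse.
For a self-adjoint operator `A` this is the whole spectrum. -/
def realSpectrum (A : H →ₗ.[ℂ] H) : Set ℝ :=
  {r | ¬ ∃ R : H →L[ℂ] H,
    (∀ f : H, ∃ h : R f ∈ A.domain, A ⟨R f, h⟩ - (r : ℂ) • R f = f) ∧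
    (∀ u : A.domain, R (A u - (r : ℂ) • (u : H)) = u)}

/-- `ker (A - r)`: all `u` in the domain of `A` with `A u = r u`. -/
def eigenspace (A : H →ₗ.[ℂ] H) (r : ℝ) : Submodule ℂ H :=
  A.graph.comap (LinearMap.prod LinearMap.id ((r : ℂ) • LinearMap.id))

/-- Isolated points of the spectrum which are eigenvalues of finite multiplicity. -/
def discreteSpectrum (A : H →ₗ.[ℂ] H) : Set ℝ :=
  {r | r ∈ realSpectrum A ∧ (∃ ε > 0, ∀ s ∈ realSpectrum A, |s - r| < ε → s = r) ∧
    eigenspace A r ≠ ⊥ ∧ FiniteDimensional ℂ (eigenspace A r)}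

/-- The essential spectrum of a self-adjoint operator. -/
def essSpectrum (A : H →ₗ.[ℂ] H) : Set ℝ :=
  realSpectrum A \ discreteSpectrum A

/-- `λ_∞ = inf σ_ess(A)`, equal to `+∞` if the essential spectrum is empty. -/
def essBottom (A : H →ₗ.[ℂ] H) : EReal :=
  ⨅ r ∈ essSpectrum A, (r : EReal)

/-- The number of eigenvalues of the self-adjoint operator `A` lying in `S`, counted with their
multiplicities, that is, the dimension of the linear span of the corresponding eigenvectors. -/
def eigenvalueCount (A : H →ₗ.[ℂ] H) (S : Set ℝ) : ℕ∞ :=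
  Cardinal.toENat (Module.rank ℂ ↥(⨆ r ∈ S, eigenspace A r))

/-- `r = λ_k`, where `λ_1 ≤ λ_2 ≤ …` are the eigenvalues of `A` below `inf σ_ess(A)` counted with
their multiplicities: fewer than `k` of them are `< r`, and at least `k` of them are `≤ r`.
(There is no such `r` for `k = 0`.) -/
def IsNthEigenvalue (A : H →ₗ.[ℂ] H) (k : ℕ) (r : ℝ) : Prop :=
  (r : EReal) < essBottom A ∧
    eigenvalueCount A (Set.Iio r) < k ∧ (k : ℕ∞) ≤ eigenvalueCount A (Set.Iic r)

theorem IsNthEigenvalue.unique {A : H →ₗ.[ℂ] H} {k : ℕ} {r s : ℝ}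
    (hr : IsNthEigenvalue A k r) (hs : IsNthEigenvalue A k s) : r = s := by
  have key : ∀ {r s : ℝ}, IsNthEigenvalue A k r → IsNthEigenvalue A k s → ¬ r < s := by
    intro r s hr hs h
    have hle : (⨆ t ∈ Set.Iic r, eigenspace A t) ≤ ⨆ t ∈ Set.Iio s, eigenspace A t :=
      biSup_mono fun t ht => lt_of_le_of_lt ht h
    have hc : eigenvalueCount A (Set.Iic r) ≤ eigenvalueCount A (Set.Iio s) :=
      OrderHomClass.mono Cardinal.toENat (Submodule.rank_mono hle)
    exact absurd (lt_of_le_of_lt (hr.2.2.trans hc) hs.2.1) (lt_irrefl _)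
  exact le_antisymm (not_lt.1 (key hs hr)) (not_lt.1 (key hr hs))

/-- The quadratic form `a[u] = ‖T u‖²` with domain `D(T)` is closable in `H`: if `u j → 0` in `H`
and `a[u i - u j] → 0`, then `a[u j] → 0`. -/
def FormClosable (T : H →ₗ.[ℂ] K) : Prop :=
  ∀ u : ℕ → T.domain, Tendsto (fun j => (u j : H)) atTop (𝓝 0) →
    (∀ ε > 0, ∃ N : ℕ, ∀ i ≥ N, ∀ j ≥ N, ‖T (u i - u j)‖ ^ 2 < ε) →
    Tendsto (fun j => ‖T (u j)‖ ^ 2) atTop (𝓝 0)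

/-- The graph of the operator generated by the form `a[u, v] = (T u, T v)`, `u, v ∈ D(T)`:
the pairs `(u, f)` with `u ∈ D(T)` and `a[u, v] = (f, v)` for all `v ∈ D(T)`.
(Mathlib's inner product is conjugate linear in the first argument.) -/
def formGraph (T : H →ₗ.[ℂ] K) : Submodule ℂ (H × H) where
  carrier := {p | ∃ hu : p.1 ∈ T.domain, ∀ v : T.domain,
    inner ℂ (v : H) p.2 = inner ℂ (T v) (T ⟨p.1, hu⟩)}
  zero_mem' := by
    refine ⟨T.domain.zero_mem, fun v => ?_⟩
    have h : T ⟨(0 : H × H).1, T.domain.zero_mem⟩ = 0 := T.map_zero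
    rw [h]; simp
  add_mem' := by
    rintro ⟨u, f⟩ ⟨u', f'⟩ ⟨hu, h⟩ ⟨hu', h'⟩
    refine ⟨T.domain.add_mem hu hu', fun v => ?_⟩
    have e : T ⟨((u, f) + (u', f')).1, T.domain.add_mem hu hu'⟩ = T ⟨u, hu⟩ + T ⟨u', hu'⟩ :=
      T.map_add ⟨u, hu⟩ ⟨u', hu'⟩
    rw [e, inner_add_right, ← h v, ← h' v, ← inner_add_right]
    rfl
  smul_mem' := by
    rintro c ⟨u, f⟩ ⟨hu, h⟩
    refine ⟨T.domain.smul_mem c hu, fun v => ?_⟩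
    have e : T ⟨(c • (u, f)).1, T.domain.smul_mem c hu⟩ = c • T ⟨u, hu⟩ :=
      T.map_smul c ⟨u, hu⟩
    rw [e, inner_smul_right, ← h v, ← inner_smul_right]
    rfl

/-- The operator generated by the form `a[u, v] = (T u, T v)` on `D(T)`. -/
def formOperator (T : H →ₗ.[ℂ] K) : H →ₗ.[ℂ] H :=
  (formGraph T).toLinearPMap

end Abstract

/-! ### Differential operators with constant coefficients -/

/-- `L₂(Ω, ℂ^d)`. -/
abbrev L2 {n : ℕ} (Ω : Opens (EuclideanSpace ℝ (Fin n))) (d : ℕ) : Type :=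
  Lp (EuclideanSpace ℂ (Fin d)) 2 (volume.restrict (Ω : Set (EuclideanSpace ℝ (Fin n))))

section Diff

variable {n : ℕ} {F : Type*} [NormedAddCommGroup F] [NormedSpace ℝ F]

/-- `∂f/∂x_i`. -/
def pderiv (i : Fin n) (f : EuclideanSpace ℝ (Fin n) → F) : EuclideanSpace ℝ (Fin n) → F :=
  fun x => fderiv ℝ f x (EuclideanSpace.single i 1)

/-- `∂^α f = ∂_1^{α_1} ⋯ ∂_n^{α_n} f`. -/
def multiDeriv (α : Fin n →₀ ℕ) (f : EuclideanSpace ℝ (Fin n) → F) :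
    EuclideanSpace ℝ (Fin n) → F :=
  (List.finRange n).foldr (fun i g => (pderiv i)^[α i] g) f

/-- The coefficients of a differential operator `L = ∑_α B_α ∂^α` (finite sum) with constant
complex `l × m` matrices `B_α`. -/
abbrev Coeffs (n m l : ℕ) : Type := (Fin n →₀ ℕ) →₀ Matrix (Fin l) (Fin m) ℂ

/-- `L f = ∑_α B_α ∂^α f`. -/
def applyOp {m l : ℕ} (B : Coeffs n m l)
    (f : EuclideanSpace ℝ (Fin n) → EuclideanSpace ℂ (Fin m)) :
    EuclideanSpace ℝ (Fin n) → EuclideanSpace ℂ (Fin l) :=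
  fun x => ∑ α ∈ B.support, (B α).toEuclideanLin (multiDeriv α f x)

end Diff

section Linearity

variable {n : ℕ} {F : Type*} [NormedAddCommGroup F] [NormedSpace ℝ F]
  {Ω : Opens (EuclideanSpace ℝ (Fin n))}

/-- `D` maps `C^∞(Ω)` to itself, is `ℂ`-linear there, and is local. -/
def GoodOn [NormedSpace ℂ F] (Ω : Opens (EuclideanSpace ℝ (Fin n)))
    (D : (EuclideanSpace ℝ (Fin n) → F) → (EuclideanSpace ℝ (Fin n) → F)) : Prop :=
  (∀ f, ContDiffOn ℝ ∞ f Ω → ContDiffOn ℝ ∞ (D f) Ω) ∧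
  (∀ f g, ContDiffOn ℝ ∞ f Ω → ContDiffOn ℝ ∞ g Ω → Set.EqOn (D (f + g)) (D f + D g) Ω) ∧
  (∀ (c : ℂ) (f), ContDiffOn ℝ ∞ f Ω → Set.EqOn (D (c • f)) (c • D f) Ω) ∧
  (∀ f g, Set.EqOn f g Ω → Set.EqOn (D f) (D g) Ω)

theorem GoodOn.id [NormedSpace ℂ F] : GoodOn (F := F) Ω (fun f => f) :=
  ⟨fun _ h => h, fun _ _ _ _ _ _ => rfl, fun _ _ _ _ _ => rfl, fun _ _ h => h⟩

theorem GoodOn.comp [NormedSpace ℂ F]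
    {D D' : (EuclideanSpace ℝ (Fin n) → F) → (EuclideanSpace ℝ (Fin n) → F)}
    (h : GoodOn Ω D) (h' : GoodOn Ω D') : GoodOn Ω (fun f => D (D' f)) := by
  refine ⟨fun f hf => h.1 _ (h'.1 f hf), fun f g hf hg => ?_, fun c f hf => ?_,
    fun f g e => h.2.2.2 _ _ (h'.2.2.2 f g e)⟩
  · exact (h.2.2.2 _ _ (h'.2.1 f g hf hg)).trans (h.2.1 _ _ (h'.1 f hf) (h'.1 g hg))
  · exact (h.2.2.2 _ _ (h'.2.2.1 c f hf)).trans (h.2.2.1 c _ (h'.1 f hf))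

theorem goodOn_pderiv [NormedSpace ℂ F] (i : Fin n) : GoodOn (F := F) Ω (pderiv i) := by
  have hd : ∀ f : EuclideanSpace ℝ (Fin n) → F, ContDiffOn ℝ ∞ f Ω → ∀ x ∈ Ω,
      DifferentiableAt ℝ f x := fun f hf x hx =>
    (hf.contDiffAt (Ω.isOpen.mem_nhds hx)).differentiableAt (by simp)
  refine ⟨fun f hf => ?_, fun f g hf hg x hx => ?_, fun c f hf x hx => ?_, fun f g e x hx => ?_⟩
  · exact (hf.fderiv_of_isOpen Ω.isOpen (by simp)).clm_apply contDiffOn_const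
  · simp [pderiv, fderiv_add (hd f hf x hx) (hd g hg x hx)]
  · simp [pderiv, fderiv_const_smul (hd f hf x hx)]
  · have : f =ᶠ[𝓝 x] g := Filter.eventuallyEq_of_mem (Ω.isOpen.mem_nhds hx) e
    simp [pderiv, this.fderiv_eq]

theorem goodOn_multiDeriv [NormedSpace ℂ F] (α : Fin n →₀ ℕ) :
    GoodOn (F := F) Ω (multiDeriv α) := by
  have it : ∀ (i : Fin n) (k : ℕ), GoodOn (F := F) Ω (pderiv i)^[k] := by
    intro i k
    induction k with
    | zero => exact GoodOn.id
    | succ k ih =>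
      have h := GoodOn.comp ih (goodOn_pderiv (F := F) (Ω := Ω) i)
      exact h
  unfold multiDeriv
  induction List.finRange n with
  | nil => exact GoodOn.id
  | cons i t ih => exact GoodOn.comp (it i (α i)) ih

variable {m l : ℕ} (B : Coeffs n m l)

theorem applyOp_add {f g : EuclideanSpace ℝ (Fin n) → EuclideanSpace ℂ (Fin m)}
    (hf : ContDiffOn ℝ ∞ f Ω) (hg : ContDiffOn ℝ ∞ g Ω) :
    Set.EqOn (applyOp B (f + g)) (applyOp B f + applyOp B g) Ω := by
  intro x hx
  simp only [applyOp, Pi.add_apply, ← Finset.sum_add_distrib]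
  refine Finset.sum_congr rfl fun α _ => ?_
  rw [(goodOn_multiDeriv α).2.1 f g hf hg hx, Pi.add_apply, map_add]

theorem applyOp_smul (c : ℂ) {f : EuclideanSpace ℝ (Fin n) → EuclideanSpace ℂ (Fin m)}
    (hf : ContDiffOn ℝ ∞ f Ω) :
    Set.EqOn (applyOp B (c • f)) (c • applyOp B f) Ω := by
  intro x hx
  simp only [applyOp, Pi.smul_apply, Finset.smul_sum]
  refine Finset.sum_congr rfl fun α _ => ?_
  rw [(goodOn_multiDeriv α).2.2.1 c f hf hx, Pi.smul_apply, map_smul]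

theorem applyOp_congr {f g : EuclideanSpace ℝ (Fin n) → EuclideanSpace ℂ (Fin m)}
    (h : Set.EqOn f g Ω) : Set.EqOn (applyOp B f) (applyOp B g) Ω := by
  intro x hx
  simp only [applyOp]
  refine Finset.sum_congr rfl fun α _ => ?_
  rw [(goodOn_multiDeriv α).2.2.2 f g h hx]

end Linearity

section Operators

variable {n m l : ℕ} (B : Coeffs n m l) (Ω : Opens (EuclideanSpace ℝ (Fin n)))

/-- The pairs `(f, L f)` with `f ∈ C^∞(Ω, ℂ^m) ∩ L₂(Ω, ℂ^m)` and `L f ∈ L₂(Ω, ℂ^l)`. -/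
def smoothGraph : Submodule ℂ (L2 Ω m × L2 Ω l) where
  carrier := {p | ∃ f : EuclideanSpace ℝ (Fin n) → EuclideanSpace ℂ (Fin m),
    ContDiffOn ℝ ∞ f Ω ∧
    p.1 =ᵐ[volume.restrict (Ω : Set (EuclideanSpace ℝ (Fin n)))] f ∧
    p.2 =ᵐ[volume.restrict (Ω : Set (EuclideanSpace ℝ (Fin n)))] applyOp B f}
  zero_mem' := by
    refine ⟨(0 : ℂ) • 0, contDiffOn_const.congr fun x _ => by simp; rfl, ?_, ?_⟩
    · filter_upwards [Lp.coeFn_zero (EuclideanSpace ℂ (Fin m)) 2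
        (volume.restrict (Ω : Set (EuclideanSpace ℝ (Fin n))))] with x hx
      simpa using hx
    · filter_upwards [Lp.coeFn_zero (EuclideanSpace ℂ (Fin l)) 2
        (volume.restrict (Ω : Set (EuclideanSpace ℝ (Fin n)))),
        ae_restrict_mem Ω.isOpen.measurableSet] with x hx hxΩ
      rw [applyOp_smul B 0 (f := 0) (contDiffOn_const (c := 0)) hxΩ]
      simpa using hx
  add_mem' := by
    rintro ⟨u, w⟩ ⟨u', w'⟩ ⟨f, hf, hu, hw⟩ ⟨f', hf', hu', hw'⟩
    refine ⟨f + f', hf.add hf', ?_, ?_⟩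
    · filter_upwards [Lp.coeFn_add u u', hu, hu'] with x h1 h2 h3
      exact h1.trans (congrArg₂ (· + ·) h2 h3)
    · filter_upwards [Lp.coeFn_add w w', hw, hw', ae_restrict_mem Ω.isOpen.measurableSet]
        with x h1 h2 h3 hx
      rw [applyOp_add B hf hf' hx]
      exact h1.trans (congrArg₂ (· + ·) h2 h3)
  smul_mem' := by
    rintro c ⟨u, w⟩ ⟨f, hf, hu, hw⟩
    refine ⟨c • f, hf.const_smul c, ?_, ?_⟩
    · filter_upwards [Lp.coeFn_smul c u, hu] with x h1 h2
      exact h1.trans (congrArg (c • ·) h2)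
    · filter_upwards [Lp.coeFn_smul c w, hw, ae_restrict_mem Ω.isOpen.measurableSet]
        with x h1 h2 hx
      rw [applyOp_smul B c hf hx]
      exact h1.trans (congrArg (c • ·) h2)

/-- `L f` depends only on the class of `f` in `L₂`, so `smoothGraph` is the graph of an
operator. -/
theorem smoothGraph_single_valued (p : L2 Ω m × L2 Ω l) (hp : p ∈ smoothGraph B Ω)
    (h0 : p.1 = 0) : p.2 = 0 := by
  obtain ⟨f, hf, hu, hw⟩ := hp
  have hz : f =ᵐ[volume.restrict (Ω : Set (EuclideanSpace ℝ (Fin n)))]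
      fun _ => (0 : EuclideanSpace ℂ (Fin m)) := by
    rw [h0] at hu
    exact hu.symm.trans (Lp.coeFn_zero _ _ _)
  have he : Set.EqOn f (fun _ => 0) Ω :=
    Measure.eqOn_open_of_ae_eq hz Ω.isOpen hf.continuousOn continuousOn_const
  have he' : Set.EqOn f ((0 : ℂ) • f) Ω := fun x hx => by simp [he hx]
  refine (Lp.eq_zero_iff_ae_eq_zero).2 ?_
  filter_upwards [hw, ae_restrict_mem Ω.isOpen.measurableSet] with x h1 hx
  rw [h1, applyOp_congr B he' hx, applyOp_smul B 0 hf hx]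
  simp

/-- The operator `L` in `L₂` with domain `{f ∈ C^∞(Ω, ℂ^m) ∩ L₂(Ω, ℂ^m) : L f ∈ L₂(Ω, ℂ^l)}`;
the form `∫_Ω |L f|² dx` is `‖smoothOp B Ω f‖²`. -/
def smoothOp : L2 Ω m →ₗ.[ℂ] L2 Ω l :=
  (smoothGraph B Ω).toLinearPMap

/-- `C_0^∞(Ω, ℂ^m)` as a subspace of `L₂(Ω, ℂ^m)`. -/
def testFunctions (m : ℕ) : Submodule ℂ (L2 Ω m) where
  carrier := {u | ∃ f : EuclideanSpace ℝ (Fin n) → EuclideanSpace ℂ (Fin m),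
    ContDiff ℝ ∞ f ∧ HasCompactSupport f ∧ tsupport f ⊆ Ω ∧
    u =ᵐ[volume.restrict (Ω : Set (EuclideanSpace ℝ (Fin n)))] f}
  zero_mem' := ⟨0, contDiff_const, HasCompactSupport.zero, by simp [tsupport],
    Lp.coeFn_zero _ _ _⟩
  add_mem' := by
    rintro u u' ⟨f, hf, hc, hs, hu⟩ ⟨f', hf', hc', hs', hu'⟩
    refine ⟨f + f', hf.add hf', hc.add hc', ?_, ?_⟩
    · exact (tsupport_add f f').trans (Set.union_subset hs hs')
    · filter_upwards [Lp.coeFn_add u u', hu, hu'] with x h1 h2 h3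
      exact h1.trans (congrArg₂ (· + ·) h2 h3)
  smul_mem' := by
    rintro c u ⟨f, hf, hc, hs, hu⟩
    refine ⟨c • f, hf.const_smul c, hc.smul_left (f := fun _ => c), ?_, ?_⟩
    · exact (closure_mono (Function.support_const_smul_subset c f)).trans hs
    · filter_upwards [Lp.coeFn_smul c u, hu] with x h1 h2
      exact h1.trans (congrArg (c • ·) h2)

/-- `A_N`: the operator generated by the closure `a` of the form `∫_Ω |L f|² dx`. The domain
`H¹ = D(a)` is the domain of the closure of `smoothOp B Ω`, and `a[u] = ‖(closure) u‖²`. -/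
def neumannOp : L2 Ω m →ₗ.[ℂ] L2 Ω m :=
  formOperator (smoothOp B Ω).closure

/-- `A_D`: the operator generated by the restriction of `a` to the `H¹`-closure `H¹_0` of
`C_0^∞(Ω, ℂ^m)`, where `H¹` carries the norm `(a[u] + ‖u‖²)^{1/2}`. -/
def dirichletOp : L2 Ω m →ₗ.[ℂ] L2 Ω m :=
  formOperator ((smoothOp B Ω).domRestrict (testFunctions Ω m)).closure

end Operators

end Payne

end

/-! Let `b` be a Dirichlet eigenvalue below the Neumann essential spectrum. A plane wave
`v = exp (2πi⟨x, ξ⟩) c` with `L(ξ)* L(ξ) c = b c` satisfies `‖L v‖² = b ‖v‖²` and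
`(L v, L u) = b (v, u)` for all `u` in the Dirichlet form domain. Adding it to the span of the
Dirichlet eigenfunctions with eigenvalues `≤ b` therefore preserves the bound `‖L u‖² ≤ b ‖u‖²`, and
the min-max principle yields one more Neumann eigenvalue. By Plancherel, the set of frequencies at
which `L(ξ)* L(ξ)` has an eigenvalue `≤ b` is not negligible; since `n ≥ 2`, infinitely many of them
admit such a wave, so that one of the waves lies outside any given finite dimensional space.

The inequality is strict because a Dirichlet function that is a Neumann eigenfunction for `b` has a
continuous Fourier transform, which is carried by the zeros of the real analytic function
`det (L(ξ)* L(ξ) - b)` and hence vanishes.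

Plane waves are square integrable only if `Ω` has finite volume. In infinite volume, truncated plane
waves form a Weyl sequence, so `b` could not lie below the Neumann essential spectrum. -/

noncomputable section

namespace Payne

/-! ### Spectral subspaces and the numbering of eigenvalues -/

section Eigenspan

variable {H : Type*} [NormedAddCommGroup H] [InnerProductSpace ℂ H] {A : H →ₗ.[ℂ] H}

/-- The algebraic span of the eigenvectors of `A` with eigenvalues in `S`, whose dimension is
`eigenvalueCount A S`. Below the essential spectrum it is the spectral subspace of `A`. -/
def eigenspan (A : H →ₗ.[ℂ] H) (S : Set ℝ) : Submodule ℂ H :=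
  ⨆ r ∈ S, eigenspace A r

theorem eigenspace_le_eigenspan {S : Set ℝ} {r : ℝ} (hr : r ∈ S) :
    eigenspace A r ≤ eigenspan A S :=
  le_iSup₂_of_le r hr le_rfl

theorem eigenspan_le_of_forall_ne_bot {S S' : Set ℝ}
    (h : ∀ r ∈ S, eigenspace A r ≠ ⊥ → r ∈ S') : eigenspan A S ≤ eigenspan A S' := by
  refine iSup₂_le fun r hr => ?_
  rcases eq_or_ne (eigenspace A r) ⊥ with hbot | hbot
  · simp only [hbot, bot_le]
  · exact eigenspace_le_eigenspan (h r hr hbot)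

theorem eigenvalueCount_congr {S S' : Set ℝ} (h : ∀ r, eigenspace A r ≠ ⊥ → (r ∈ S ↔ r ∈ S')) :
    eigenvalueCount A S = eigenvalueCount A S' := by
  have hspan : eigenspan A S = eigenspan A S' :=
    le_antisymm (eigenspan_le_of_forall_ne_bot fun r hr hbot => (h r hbot).1 hr)
      (eigenspan_le_of_forall_ne_bot fun r hr hbot => (h r hbot).2 hr)
  exact congrArg (fun V : Submodule ℂ H => Cardinal.toENat (Module.rank ℂ V)) hspan

theorem eigenvalueCount_empty : eigenvalueCount A ∅ = 0 := by
  rw [eigenvalueCount, iSup_emptyset, rank_bot, map_zero]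

theorem eigenvalueCount_eq_finrank {S : Set ℝ} [FiniteDimensional ℂ (eigenspan A S)] :
    eigenvalueCount A S = Module.finrank ℂ (eigenspan A S) := by
  change Cardinal.toENat (Module.rank ℂ (eigenspan A S)) = _
  rw [← Module.finrank_eq_rank, map_natCast]

/-- The eigenvalue found is the largest one below `b`. -/
theorem exists_eigenvalueCount_Iic_eq_Iio {b : ℝ}
    (hfin : {r : ℝ | r < b ∧ eigenspace A r ≠ ⊥}.Finite) (h0 : eigenvalueCount A (Set.Iio b) ≠ 0) :
    ∃ r < b, eigenspace A r ≠ ⊥ ∧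
      eigenvalueCount A (Set.Iic r) = eigenvalueCount A (Set.Iio b) := by
  have hne : {r : ℝ | r < b ∧ eigenspace A r ≠ ⊥}.Nonempty := by
    by_contra! hempty
    refine h0 ((eigenvalueCount_congr fun r hr => ?_).trans eigenvalueCount_empty)
    exact ⟨fun hrb => hempty.subset (show r ∈ {r : ℝ | r < b ∧ _} from ⟨hrb, hr⟩), False.elim⟩
  obtain ⟨r, hr, hmax⟩ := Set.exists_max_image _ id hfin hne
  exact ⟨r, hr.1, hr.2, eigenvalueCount_congr fun s hs =>
    ⟨fun hsr => lt_of_le_of_lt hsr hr.1, fun hsb => hmax s ⟨hsb, hs⟩⟩⟩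

theorem exists_isNthEigenvalue_lt {b : ℝ} (hb : (b : EReal) < essBottom A)
    (hfin : {r : ℝ | r < b ∧ eigenspace A r ≠ ⊥}.Finite) {k : ℕ} (hk0 : k ≠ 0)
    (hk : (k : ℕ∞) ≤ eigenvalueCount A (Set.Iio b)) :
    ∃ r < b, IsNthEigenvalue A k r := by
  have below : ∀ x ≤ b, (k : ℕ∞) ≤ eigenvalueCount A (Set.Iio x) →
      ∃ r < x, eigenspace A r ≠ ⊥ ∧ (k : ℕ∞) ≤ eigenvalueCount A (Set.Iic r) := by
    intro x hxb hx
    have h0 : eigenvalueCount A (Set.Iio x) ≠ 0 := fun h => by simp [h, hk0] at hx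
    obtain ⟨r, hrx, hr, hcount⟩ := exists_eigenvalueCount_Iic_eq_Iio
      (hfin.subset fun r hr => ⟨hr.1.trans_le hxb, hr.2⟩) h0
    exact ⟨r, hrx, hr, hcount ▸ hx⟩
  obtain ⟨r, ⟨hrb, -, hr⟩, hmin⟩ := Set.exists_min_image
    {r : ℝ | r < b ∧ eigenspace A r ≠ ⊥ ∧ (k : ℕ∞) ≤ eigenvalueCount A (Set.Iic r)} id
    (hfin.subset fun r hr => ⟨hr.1, hr.2.1⟩) (below b le_rfl hk)
  refine ⟨r, hrb, lt_trans (by exact_mod_cast hrb) hb, ?_, hr⟩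
  by_contra! hlt
  obtain ⟨s, hsr, hs⟩ := below r hrb.le hlt
  exact absurd (hmin s ⟨hsr.trans hrb, hs⟩) (not_le.2 hsr)

theorem mem_realSpectrum_of_eigenspace_ne_bot {r : ℝ} (h : eigenspace A r ≠ ⊥) :
    r ∈ realSpectrum A := by
  rintro ⟨R, -, hR⟩
  obtain ⟨u, hu, h0⟩ := (Submodule.ne_bot_iff _).1 h
  obtain ⟨y, rfl, hy⟩ := (LinearPMap.mem_graph_iff A).1 (show (u, (r : ℂ) • u) ∈ A.graph from hu)
  refine h0 ?_
  rw [← hR y, hy, sub_self, map_zero]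

theorem mem_discreteSpectrum_of_lt_essBottom {r : ℝ} (hb : (r : EReal) < essBottom A)
    (hr : r ∈ realSpectrum A) : r ∈ discreteSpectrum A := by
  by_contra h
  exact absurd (iInf₂_le r ⟨hr, h⟩) (not_le.2 hb)

theorem finiteDimensional_eigenspan {b : ℝ} (hb : (b : EReal) < essBottom A)
    (hfin : {r : ℝ | r ≤ b ∧ eigenspace A r ≠ ⊥}.Finite) :
    FiniteDimensional ℂ (eigenspan A (Set.Iic b)) := by
  have : Finite {r : ℝ | r ≤ b ∧ eigenspace A r ≠ ⊥} := hfin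
  have (r : {r : ℝ | r ≤ b ∧ eigenspace A r ≠ ⊥}) : FiniteDimensional ℂ (eigenspace A r) :=
    (mem_discreteSpectrum_of_lt_essBottom
      (lt_of_le_of_lt (by exact_mod_cast r.2.1) hb)
      (mem_realSpectrum_of_eigenspace_ne_bot r.2.2)).2.2.2
  have : FiniteDimensional ℂ (eigenspan A {r : ℝ | r ≤ b ∧ eigenspace A r ≠ ⊥}) := by
    rw [eigenspan, iSup_subtype']
    exact Submodule.finiteDimensional_iSup _
  have hle : eigenspan A (Set.Iic b) ≤ eigenspan A {r : ℝ | r ≤ b ∧ eigenspace A r ≠ ⊥} :=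
    eigenspan_le_of_forall_ne_bot fun r hr hbot => ⟨hr, hbot⟩
  exact Submodule.finiteDimensional_of_le hle

end Eigenspan

/-! ### The operator generated by a form -/

section FormOperator

variable {H K : Type*} [NormedAddCommGroup H] [InnerProductSpace ℂ H]
  [NormedAddCommGroup K] [InnerProductSpace ℂ K] {T : H →ₗ.[ℂ] K}

theorem inner_self_eq_ofReal (u : H) : inner ℂ u u = ((‖u‖ ^ 2 : ℝ) : ℂ) := by
  rw [inner_self_eq_norm_sq_to_K, Complex.ofReal_pow]
  rfl

theorem mem_formGraph_iff {u f : H} :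
    (u, f) ∈ formGraph T ↔ ∃ w, (u, w) ∈ T.graph ∧
      ∀ v z, (v, z) ∈ T.graph → inner ℂ v f = inner ℂ z w := by
  constructor
  · rintro ⟨hu, h⟩
    refine ⟨T ⟨u, hu⟩, LinearPMap.mem_graph T ⟨u, hu⟩, fun v z hvz => ?_⟩
    obtain ⟨y, rfl, rfl⟩ := (LinearPMap.mem_graph_iff T).1 hvz
    exact h y
  · rintro ⟨w, huw, h⟩
    obtain ⟨y, rfl, rfl⟩ := (LinearPMap.mem_graph_iff T).1 huw
    exact ⟨y.2, fun v => h v (T v) (LinearPMap.mem_graph T v)⟩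

theorem graph_formOperator (hT : Dense (T.domain : Set H)) :
    (formOperator T).graph = formGraph T := by
  refine Submodule.toLinearPMap_graph_eq _ ?_
  rintro ⟨u, f⟩ hx (rfl : u = 0)
  obtain ⟨w, hw, h⟩ := mem_formGraph_iff.1 hx
  obtain rfl : w = 0 := T.graph_fst_eq_zero_snd hw rfl
  refine hT.eq_zero_of_inner_left ℂ fun v hv => ?_
  rw [← inner_conj_symm, h v (T ⟨v, hv⟩) (LinearPMap.mem_graph T ⟨v, hv⟩), inner_zero_right,
    map_zero]

theorem mem_eigenspace_formOperator (hT : Dense (T.domain : Set H)) {r : ℝ} {u : H} :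
    u ∈ eigenspace (formOperator T) r ↔ (u, (r : ℂ) • u) ∈ formGraph T := by
  rw [← graph_formOperator hT]
  rfl

theorem formGraph_symm {u f v g : H} (hu : (u, f) ∈ formGraph T) (hv : (v, g) ∈ formGraph T) :
    inner ℂ v f = inner ℂ g u := by
  obtain ⟨w, hw, h⟩ := mem_formGraph_iff.1 hu
  obtain ⟨z, hz, h'⟩ := mem_formGraph_iff.1 hv
  rw [h v z hz, ← inner_conj_symm, ← h' u w hw, inner_conj_symm]

theorem inner_eq_zero_of_mem_eigenspace (hT : Dense (T.domain : Set H)) {r s : ℝ} (hrs : r ≠ s)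
    {u v : H} (hu : u ∈ eigenspace (formOperator T) r) (hv : v ∈ eigenspace (formOperator T) s) :
    inner ℂ u v = 0 := by
  have h := formGraph_symm ((mem_eigenspace_formOperator hT).1 hv)
    ((mem_eigenspace_formOperator hT).1 hu)
  rw [inner_smul_left, inner_smul_right, Complex.conj_ofReal, ← sub_eq_zero, ← sub_mul] at h
  exact (mul_eq_zero.1 h).resolve_left (by exact_mod_cast sub_ne_zero.2 hrs.symm)

theorem orthogonalFamily_eigenspace (hT : Dense (T.domain : Set H)) :
    OrthogonalFamily ℂ (fun r : ℝ => eigenspace (formOperator T) r)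
      fun r => (eigenspace (formOperator T) r).subtypeₗᵢ :=
  fun _ _ hrs u v => inner_eq_zero_of_mem_eigenspace hT hrs u.2 v.2

theorem eigenspace_le_orthogonal_eigenspan (hT : Dense (T.domain : Set H)) {S : Set ℝ} {r : ℝ}
    (hr : r ∉ S) : eigenspace (formOperator T) r ≤ (eigenspan (formOperator T) S)ᗮ :=
  (Submodule.isOrtho_iSup_right.2 fun _ => Submodule.isOrtho_iSup_right.2 fun hs =>
    Submodule.isOrtho_iff_inner_eq.2 fun _ hu _ hv =>
      inner_eq_zero_of_mem_eigenspace hT (ne_of_mem_of_not_mem hs hr).symm hu hv).le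

theorem nonneg_of_eigenspace_ne_bot (hT : Dense (T.domain : Set H)) {r : ℝ}
    (hr : eigenspace (formOperator T) r ≠ ⊥) : 0 ≤ r := by
  obtain ⟨u, hu, h0⟩ := (Submodule.ne_bot_iff _).1 hr
  obtain ⟨w, hw, h⟩ := mem_formGraph_iff.1 ((mem_eigenspace_formOperator hT).1 hu)
  have hruw : r * ‖u‖ ^ 2 = ‖w‖ ^ 2 := by
    have := h u w hw
    rw [inner_smul_right, inner_self_eq_ofReal, inner_self_eq_ofReal] at this
    exact_mod_cast this
  have hu0 : 0 < ‖u‖ ^ 2 := by positivity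
  exact nonneg_of_mul_nonneg_left (hruw ▸ sq_nonneg ‖w‖) hu0

theorem exists_mem_formGraph_of_mem_eigenspan (hT : Dense (T.domain : Set H)) {S : Set ℝ} {b : ℝ}
    (hb : ∀ r ∈ S, r ≤ b) {u : H} (hu : u ∈ eigenspan (formOperator T) S) :
    ∃ f ∈ eigenspan (formOperator T) S, (u, f) ∈ formGraph T ∧
      (inner ℂ u f).re ≤ b * ‖u‖ ^ 2 := by
  rw [eigenspan, iSup_subtype'] at hu
  obtain ⟨c, hc, rfl⟩ := (Submodule.mem_iSup_iff_exists_finsupp _ u).1 hu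
  have horth : OrthogonalFamily ℂ (fun r : S => eigenspace (formOperator T) r)
      fun r => (eigenspace (formOperator T) r).subtypeₗᵢ :=
    (orthogonalFamily_eigenspace hT).comp Subtype.val_injective
  have hf : ∀ r : S, (c r, ((r : ℝ) : ℂ) • c r) ∈ formGraph T := fun r =>
    (mem_eigenspace_formOperator hT).1 (hc r)
  refine ⟨∑ r ∈ c.support, ((r : ℝ) : ℂ) • c r, ?_, ?_, ?_⟩
  · exact Submodule.sum_mem _ fun r _ =>
      Submodule.smul_mem _ _ (eigenspace_le_eigenspan r.2 (hc r))
  · have := Submodule.sum_mem (formGraph T) fun r (_ : r ∈ c.support) => hf r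
    rwa [← prod_mk_sum] at this
  · have hinner : inner ℂ (∑ r ∈ c.support, c r) (∑ r ∈ c.support, ((r : ℝ) : ℂ) • c r)
        = ∑ r ∈ c.support, inner ℂ (c r) (((r : ℝ) : ℂ) • c r) :=
      horth.inner_sum (fun r => ⟨c r, hc r⟩)
        (fun r => ((r : ℝ) : ℂ) • (⟨c r, hc r⟩ : eigenspace (formOperator T) r)) c.support
    have hnorm : ‖∑ r ∈ c.support, c r‖ ^ 2 = ∑ r ∈ c.support, ‖c r‖ ^ 2 :=
      horth.norm_sum (fun r => ⟨c r, hc r⟩) c.support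
    rw [Finsupp.sum, hinner, hnorm, Complex.re_sum, Finset.mul_sum]
    refine Finset.sum_le_sum fun r _ => ?_
    rw [inner_smul_right, inner_self_eq_ofReal, Complex.re_ofReal_mul, Complex.ofReal_re]
    exact mul_le_mul_of_nonneg_right (hb r r.2) (sq_nonneg _)

/-- Pythagoras for the form: `u = (u - p) + p` is also orthogonal with respect to the form. -/
theorem exists_norm_sq_eq_add_of_mem_formGraph {u p f : H} {w : K} (huw : (u, w) ∈ T.graph)
    (hp : (p, f) ∈ formGraph T) (horth : inner ℂ (u - p) f = 0) :
    ∃ y, (u - p, w - y) ∈ T.graph ∧ ‖w‖ ^ 2 = ‖w - y‖ ^ 2 + ‖y‖ ^ 2 ∧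
      ‖y‖ ^ 2 = (inner ℂ p f).re := by
  obtain ⟨y, hy, h⟩ := mem_formGraph_iff.1 hp
  have hd : (u - p, w - y) ∈ T.graph := T.graph.sub_mem huw hy
  refine ⟨y, hd, ?_, ?_⟩
  · have := norm_add_sq_eq_norm_sq_add_norm_sq_of_inner_eq_zero (𝕜 := ℂ) (w - y) y
      (by rw [← h _ _ hd, horth])
    rwa [sub_add_cancel, ← sq, ← sq, ← sq] at this
  · rw [h _ _ hy, inner_self_eq_ofReal, Complex.ofReal_re]

end FormOperator

/-! ### Bounded self-adjoint operators whose spectrum is discrete above a level -/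

section IsolatedSpectrum

theorem continuousOn_indicator_singleton {s : Set ℝ} {ρ : ℝ} (hρ : ¬ AccPt ρ (𝓟 s)) :
    ContinuousOn (Set.indicator {ρ} (1 : ℝ → ℝ)) s := by
  intro x _
  rcases eq_or_ne x ρ with rfl | hx
  · exact continuousWithinAt_of_not_accPt hρ
  · refine (continuousAt_const (y := (0 : ℝ))).congr ?_ |>.continuousWithinAt
    filter_upwards [isOpen_ne.mem_nhds hx] with y hy
    exact (Set.indicator_of_notMem (show y ∉ ({ρ} : Set ℝ) from hy) (1 : ℝ → ℝ)).symm

variable {H : Type*} [NormedAddCommGroup H] [InnerProductSpace ℂ H] [CompleteSpace H]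
  {R : H →L[ℂ] H} {δ : ℝ}

theorem finite_spectrum_inter_Ici
    (hiso : ∀ ρ ∈ spectrum ℝ R, δ ≤ ρ → ¬ AccPt ρ (𝓟 (spectrum ℝ R))) :
    (spectrum ℝ R ∩ Set.Ici δ).Finite := by
  by_contra hinf
  have hcompact : IsCompact (spectrum ℝ R ∩ Set.Ici δ) :=
    (ContinuousFunctionalCalculus.isCompact_spectrum R).inter_right isClosed_Ici
  obtain ⟨ρ, hρ, hacc⟩ := Set.Infinite.exists_accPt_of_subset_isCompact hinf hcompact subset_rfl
  exact hiso ρ hρ.1 hρ.2 (hacc.mono (principal_mono.2 Set.inter_subset_left))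

/-- The operator `1_{ρ}(R)` is the orthogonal projection onto `ker (R - ρ)`. -/
theorem cfc_indicator_singleton_apply_eq_zero (hR : IsSelfAdjoint R) {ρ : ℝ}
    (hρ : ¬ AccPt ρ (𝓟 (spectrum ℝ R))) {u : H}
    (hu : ∀ v, R v = (ρ : ℂ) • v → inner ℂ v u = 0) :
    cfc (Set.indicator {ρ} (1 : ℝ → ℝ)) R u = 0 := by
  set χ := Set.indicator {ρ} (1 : ℝ → ℝ)
  have hχ : ContinuousOn χ (spectrum ℝ R) := continuousOn_indicator_singleton hρ
  have hidem : cfc χ R * cfc χ R = cfc χ R := by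
    rw [← cfc_mul χ χ R hχ hχ]
    refine cfc_congr fun x _ => ?_
    by_cases hx : x = ρ <;> simp [χ, hx]
  have heigen : R * cfc χ R = ρ • cfc χ R := by
    nth_rewrite 1 [← cfc_id' ℝ R]
    rw [← cfc_mul (fun x => x) χ R continuousOn_id hχ, ← cfc_const_mul ρ χ R hχ]
    refine cfc_congr fun x _ => ?_
    by_cases hx : x = ρ <;> simp [χ, hx]
  have hsymm := ContinuousLinearMap.isSelfAdjoint_iff_isSymmetric.1 (cfc_predicate χ R)
  have hker : R (cfc χ R u) = (ρ : ℂ) • cfc χ R u :=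
    (DFunLike.congr_fun heigen u).trans (Complex.coe_smul ρ _).symm
  refine inner_self_eq_zero (𝕜 := ℂ).1 ?_
  calc inner ℂ (cfc χ R u) (cfc χ R u) = inner ℂ (cfc χ R (cfc χ R u)) u := (hsymm _ _).symm
    _ = inner ℂ (cfc χ R u) u := by rw [← mul_apply_eq_comp, hidem]
    _ = 0 := hu _ hker

theorem cfc_posPart_sub_apply_eq_zero (hR : IsSelfAdjoint R)
    (hiso : ∀ ρ ∈ spectrum ℝ R, δ ≤ ρ → ¬ AccPt ρ (𝓟 (spectrum ℝ R))) {u : H}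
    (hu : ∀ ρ, δ ≤ ρ → ∀ v, R v = (ρ : ℂ) • v → inner ℂ v u = 0) :
    cfc (fun x : ℝ => max (x - δ) 0) R u = 0 := by
  classical
  have hfin := finite_spectrum_inter_Ici hiso
  have hχ : ∀ ρ ∈ hfin.toFinset, ContinuousOn
      (fun x => (ρ - δ) * Set.indicator {ρ} (1 : ℝ → ℝ) x) (spectrum ℝ R) := by
    intro ρ hρ
    rw [Set.Finite.mem_toFinset] at hρ
    exact continuousOn_const.mul (continuousOn_indicator_singleton (hiso ρ hρ.1 hρ.2))
  have hsum : cfc (fun x : ℝ => max (x - δ) 0) R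
      = ∑ ρ ∈ hfin.toFinset, cfc (fun x => (ρ - δ) * Set.indicator {ρ} (1 : ℝ → ℝ) x) R := by
    rw [← cfc_sum _ R _ hχ]
    refine cfc_congr fun x hx => ?_
    simp only [Finset.sum_apply, Set.indicator_apply, Set.mem_singleton_iff, Pi.one_apply, mul_ite,
      mul_one, mul_zero, Finset.sum_ite_eq, Set.Finite.mem_toFinset, Set.mem_inter_iff, hx,
      Set.mem_Ici, true_and]
    split_ifs with h
    · exact max_eq_left (sub_nonneg.2 h)
    · exact max_eq_right (sub_nonpos.2 (not_le.1 h).le)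
  rw [hsum, _root_.sum_apply]
  refine Finset.sum_eq_zero fun ρ hρ => ?_
  rw [Set.Finite.mem_toFinset] at hρ
  have hρiso := hiso ρ hρ.1 hρ.2
  rw [cfc_const_mul _ _ R (continuousOn_indicator_singleton hρiso), _root_.smul_apply,
    cfc_indicator_singleton_apply_eq_zero hR hρiso (hu ρ hρ.2), smul_zero]

/-- `R ≤ δ + (R - δ)₊`, and `(R - δ)₊` annihilates `u`. -/
theorem re_inner_apply_le_of_orthogonal_eigenvectors (hR : IsSelfAdjoint R)
    (hiso : ∀ ρ ∈ spectrum ℝ R, δ ≤ ρ → ¬ AccPt ρ (𝓟 (spectrum ℝ R))) {u : H}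
    (hu : ∀ ρ, δ ≤ ρ → ∀ v, R v = (ρ : ℂ) • v → inner ℂ v u = 0) :
    (inner ℂ (R u) u).re ≤ δ * ‖u‖ ^ 2 := by
  have hle : R ≤ cfc (fun x : ℝ => δ + max (x - δ) 0) R := by
    conv_lhs => rw [← cfc_id' ℝ R]
    refine cfc_mono fun x _ => ?_
    linarith [le_max_left (x - δ) 0]
  rw [cfc_const_add _ _ R] at hle
  have hpos := ((ContinuousLinearMap.le_def _ _).1 hle).2 u
  rw [ContinuousLinearMap.reApplyInnerSelf_apply, _root_.sub_apply, _root_.add_apply,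
    cfc_posPart_sub_apply_eq_zero hR hiso hu, add_zero, inner_sub_left, map_sub, sub_nonneg,
    Algebra.algebraMap_eq_smul_one, _root_.smul_apply, one_apply_eq_self, ← Complex.coe_smul,
    inner_smul_left, inner_self_eq_ofReal, Complex.conj_ofReal] at hpos
  exact hpos.trans_eq (by rw [RCLike.re_eq_complex_re, Complex.re_ofReal_mul, Complex.ofReal_re])

end IsolatedSpectrum

/-! ### The resolvent of the operator generated by a closed form -/

section Resolvent

variable {H K : Type*} [NormedAddCommGroup H] [InnerProductSpace ℂ H]
  [NormedAddCommGroup K] [InnerProductSpace ℂ K] {T : H →ₗ.[ℂ] K} {R : H →L[ℂ] H}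

/-- `R = (A + 1)⁻¹`, where `A` is the operator generated by the form `(T u, T v)`. Only
`(A + 1) R = 1` is required: since `A` is symmetric and nonnegative, `R` is then self-adjoint and
a left inverse as well. -/
def IsResolvent (T : H →ₗ.[ℂ] K) (R : H →L[ℂ] H) : Prop :=
  ∀ f, (R f, f - R f) ∈ formGraph T

/-- With `J` the embedding of the graph of `T` into `H`, the resolvent is `J J*`. -/
theorem exists_isResolvent [CompleteSpace H] [CompleteSpace K] (hT : T.IsClosed) :
    ∃ R : H →L[ℂ] H, IsResolvent T R := by
  let Γ : Submodule ℂ (WithLp 2 (H × K)) :=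
    T.graph.comap (WithLp.linearEquiv 2 ℂ (H × K)).toLinearMap
  have hΓ : IsClosed (Γ : Set (WithLp 2 (H × K))) :=
    IsClosed.preimage (WithLp.prod_continuous_ofLp 2 H K) hT
  have : CompleteSpace Γ := hΓ.completeSpace_coe
  let J : Γ →L[ℂ] H := (WithLp.fstL 2 ℂ H K).comp Γ.subtypeL
  refine ⟨J ∘L J.adjoint, fun f => mem_formGraph_iff.2
    ⟨(J.adjoint f : WithLp 2 (H × K)).snd, (J.adjoint f).2, fun v z hvz => ?_⟩⟩
  have h := ContinuousLinearMap.adjoint_inner_right J ⟨WithLp.toLp 2 (v, z), hvz⟩ f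
  rw [Submodule.coe_inner, WithLp.prod_inner_apply] at h
  rw [inner_sub_right, sub_eq_iff_eq_add']
  exact h.symm

namespace IsResolvent

theorem isSelfAdjoint [CompleteSpace H] (hR : IsResolvent T R) : IsSelfAdjoint R := by
  refine ContinuousLinearMap.isSelfAdjoint_iff_isSymmetric.2 fun f g => ?_
  have h := formGraph_symm (hR g) (hR f)
  rw [inner_sub_left, inner_sub_right, sub_left_inj] at h
  exact h

theorem apply_add_of_mem_formGraph (hR : IsResolvent T R) {u h : H} (hu : (u, h) ∈ formGraph T) :
    R (h + u) = u := by
  set d := u - R (h + u)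
  have hd : (d, -d) ∈ formGraph T := by
    convert (formGraph T).sub_mem hu (hR (h + u)) using 1
    exact Prod.ext rfl (by simp only [d, Prod.snd_sub]; abel)
  obtain ⟨w, hw, h⟩ := mem_formGraph_iff.1 hd
  have hsum : -‖d‖ ^ 2 = ‖w‖ ^ 2 := by
    have := h d w hw
    rw [inner_neg_right, inner_self_eq_ofReal, inner_self_eq_ofReal] at this
    exact_mod_cast this
  have hd0 : ‖d‖ ^ 2 = 0 := by nlinarith [sq_nonneg ‖w‖, sq_nonneg ‖d‖]
  exact (sub_eq_zero.1 (norm_eq_zero.1 (pow_eq_zero_iff two_ne_zero |>.1 hd0))).symm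

theorem mem_eigenspace_of_apply_eq (hR : IsResolvent T R) (hT : Dense (T.domain : Set H))
    {ρ : ℝ} (hρ : ρ ≠ 0) {v : H} (hv : R v = (ρ : ℂ) • v) :
    v ∈ eigenspace (formOperator T) (ρ⁻¹ - 1) := by
  have hρ' : (ρ : ℂ) ≠ 0 := by exact_mod_cast hρ
  rw [mem_eigenspace_formOperator hT]
  convert (formGraph T).smul_mem ((ρ : ℂ)⁻¹) (hR v) using 1
  rw [hv, Prod.smul_mk, inv_smul_smul₀ hρ', smul_sub, inv_smul_smul₀ hρ', Complex.ofReal_sub,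
    Complex.ofReal_inv, Complex.ofReal_one, sub_smul, one_smul]

theorem apply_eq_of_mem_eigenspace (hR : IsResolvent T R) (hT : Dense (T.domain : Set H)) {r : ℝ}
    (hr : r + 1 ≠ 0) {v : H} (hv : v ∈ eigenspace (formOperator T) r) :
    R v = (((r + 1)⁻¹ : ℝ) : ℂ) • v := by
  have h := hR.apply_add_of_mem_formGraph ((mem_eigenspace_formOperator hT).1 hv)
  have hr' : ((r + 1 : ℝ) : ℂ) ≠ 0 := by exact_mod_cast hr
  rw [Complex.ofReal_inv, eq_inv_smul_iff₀ hr', ← map_smul, Complex.ofReal_add, add_smul,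
    Complex.ofReal_one, one_smul, h]

theorem inv_add_one_mem_spectrum (hR : IsResolvent T R) (hT : Dense (T.domain : Set H)) {r : ℝ}
    (hr : eigenspace (formOperator T) r ≠ ⊥) : (r + 1)⁻¹ ∈ spectrum ℝ R := by
  intro hunit
  obtain ⟨u, hu, h0⟩ := (Submodule.ne_bot_iff _).1 hr
  have hr0 := nonneg_of_eigenspace_ne_bot hT hr
  obtain ⟨N, hN⟩ := hunit.exists_left_inv
  refine h0 ?_
  calc u = (N * (algebraMap ℝ (H →L[ℂ] H) (r + 1)⁻¹ - R)) u := by rw [hN, one_apply_eq_self]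
    _ = 0 := by
      rw [mul_apply_eq_comp, _root_.sub_apply, hR.apply_eq_of_mem_eigenspace hT (by positivity) hu,
        Algebra.algebraMap_eq_smul_one, _root_.smul_apply, one_apply_eq_self, ← Complex.coe_smul,
        sub_self, map_zero]

/-- If `S = (A - r)⁻¹` with `r = ρ⁻¹ - 1`, then `R (g + ρ⁻¹ S g) = S g`, which solves
`(ρ - R) f = g`. -/
theorem inv_sub_one_mem_realSpectrum [CompleteSpace H] (hR : IsResolvent T R)
    (hT : Dense (T.domain : Set H)) {ρ : ℝ} (hρ : ρ ≠ 0) (h : ρ ∈ spectrum ℝ R) :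
    ρ⁻¹ - 1 ∈ realSpectrum (formOperator T) := by
  by_contra hr
  have hbot : eigenspace (formOperator T) (ρ⁻¹ - 1) = ⊥ :=
    not_not.1 (mt mem_realSpectrum_of_eigenspace_ne_bot hr)
  obtain ⟨S, hS, -⟩ := not_not.1 hr
  have hρ' : (ρ : ℂ) ≠ 0 := by exact_mod_cast hρ
  have hRS : ∀ g, R (g + (ρ : ℂ)⁻¹ • S g) = S g := by
    intro g
    obtain ⟨hmem, hg⟩ := hS g
    have hgraph := LinearPMap.mem_graph (formOperator T) ⟨S g, hmem⟩
    rw [graph_formOperator hT, sub_eq_iff_eq_add.1 hg] at hgraph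
    convert hR.apply_add_of_mem_formGraph hgraph using 2
    push_cast
    module
  have halg : ∀ f : H, (algebraMap ℝ (H →L[ℂ] H) ρ - R) f = (ρ : ℂ) • f - R f := fun f => by
    rw [_root_.sub_apply, Algebra.algebraMap_eq_smul_one, _root_.smul_apply, one_apply_eq_self,
      Complex.coe_smul]
  refine h (ContinuousLinearMap.isUnit_iff_bijective.2
    ⟨(injective_iff_map_eq_zero _).2 fun v hv => ?_,
      fun g => ⟨(ρ : ℂ)⁻¹ • (g + (ρ : ℂ)⁻¹ • S g), ?_⟩⟩)
  · rw [halg, sub_eq_zero] at hv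
    exact (Submodule.eq_bot_iff _).1 hbot v (hR.mem_eigenspace_of_apply_eq hT hρ hv.symm)
  · rw [halg, smul_inv_smul₀ hρ', map_smul, hRS, add_sub_cancel_right]

theorem not_accPt_spectrum [CompleteSpace H] (hR : IsResolvent T R)
    (hT : Dense (T.domain : Set H)) {ρ : ℝ} (hρ : 0 < ρ)
    (hdisc : ρ⁻¹ - 1 ∈ discreteSpectrum (formOperator T)) : ¬ AccPt ρ (𝓟 (spectrum ℝ R)) := by
  obtain ⟨-, ⟨ε, hε, hiso⟩, -⟩ := hdisc
  have hcont : ContinuousAt (fun σ : ℝ => σ⁻¹ - 1) ρ :=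
    (continuousAt_inv₀ hρ.ne').sub continuousAt_const
  rw [accPt_iff_frequently, not_frequently]
  filter_upwards [hcont (Metric.ball_mem_nhds _ hε), lt_mem_nhds hρ] with σ hclose hσ ⟨hne, hmem⟩
  have := hiso _ (hR.inv_sub_one_mem_realSpectrum hT hσ.ne' hmem) hclose
  exact hne (inv_injective (sub_left_injective this))

/-- Cauchy–Schwarz in the graph space gives
`‖u‖⁴ = (u, R u)²_{H¹} ≤ (‖u‖² + ‖w‖²) (R u, u)`. -/
theorem norm_sq_le_of_re_inner_le (hR : IsResolvent T R) {δ : ℝ} {u : H} {w : K}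
    (huw : (u, w) ∈ T.graph) (h : (inner ℂ (R u) u).re ≤ δ * ‖u‖ ^ 2) :
    ‖u‖ ^ 2 ≤ δ * (‖u‖ ^ 2 + ‖w‖ ^ 2) := by
  obtain ⟨y, hy, hRu⟩ := mem_formGraph_iff.1 (hR u)
  have hform : ∀ v z, (v, z) ∈ T.graph → inner ℂ v u = inner ℂ v (R u) + inner ℂ z y :=
    fun v z hvz => by rw [← hRu v z hvz, inner_sub_right, add_sub_cancel]
  have hRu_norm : ‖R u‖ ^ 2 + ‖y‖ ^ 2 = (inner ℂ (R u) u).re := by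
    rw [hform _ _ hy, inner_self_eq_ofReal, inner_self_eq_ofReal, ← Complex.ofReal_add,
      Complex.ofReal_re]
  have hu_norm : ‖u‖ ^ 2 ≤ ‖u‖ * ‖R u‖ + ‖w‖ * ‖y‖ := by
    have := congrArg Complex.re (hform _ _ huw)
    rw [inner_self_eq_ofReal, Complex.ofReal_re, Complex.add_re] at this
    rw [this]
    exact add_le_add (re_inner_le_norm (𝕜 := ℂ) u (R u)) (re_inner_le_norm (𝕜 := ℂ) w y)
  rcases eq_or_ne u 0 with rfl | hu
  · simp only [T.graph_fst_eq_zero_snd huw rfl, norm_zero, zero_pow two_ne_zero, add_zero,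
      mul_zero, le_refl]
  have hu0 : 0 < ‖u‖ ^ 2 := by positivity
  refine le_of_mul_le_mul_left ?_ hu0
  calc ‖u‖ ^ 2 * ‖u‖ ^ 2 ≤ (‖u‖ * ‖R u‖ + ‖w‖ * ‖y‖) * (‖u‖ * ‖R u‖ + ‖w‖ * ‖y‖) := by gcongr
    _ ≤ (‖u‖ ^ 2 + ‖w‖ ^ 2) * (‖R u‖ ^ 2 + ‖y‖ ^ 2) := by
      nlinarith [sq_nonneg (‖u‖ * ‖y‖ - ‖w‖ * ‖R u‖)]
    _ ≤ (‖u‖ ^ 2 + ‖w‖ ^ 2) * (δ * ‖u‖ ^ 2) := by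
      gcongr
      exact hRu_norm.trans_le h
    _ = ‖u‖ ^ 2 * (δ * (‖u‖ ^ 2 + ‖w‖ ^ 2)) := by ring

end IsResolvent

end Resolvent

/-! ### Form estimates below the essential spectrum -/

section BelowEssentialSpectrum

variable {H K : Type*} [NormedAddCommGroup H] [InnerProductSpace ℂ H] [CompleteSpace H]
  [NormedAddCommGroup K] [InnerProductSpace ℂ K] {T : H →ₗ.[ℂ] K} {b : ℝ}

theorem inv_sub_one_le (hb0 : 0 ≤ b) {ρ : ℝ} (hρ : (b + 1)⁻¹ ≤ ρ) : ρ⁻¹ - 1 ≤ b := by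
  have := inv_anti₀ (by positivity) hρ
  rw [inv_inv] at this
  linarith

theorem IsResolvent.not_accPt_spectrum_of_inv_le {R : H →L[ℂ] H} (hR : IsResolvent T R)
    (hT : Dense (T.domain : Set H)) (hb0 : 0 ≤ b) (hb : (b : EReal) < essBottom (formOperator T)) :
    ∀ ρ ∈ spectrum ℝ R, (b + 1)⁻¹ ≤ ρ → ¬ AccPt ρ (𝓟 (spectrum ℝ R)) := by
  intro ρ hρ hbρ
  have hρ0 : 0 < ρ := lt_of_lt_of_le (by positivity) hbρ
  have hle : ((ρ⁻¹ - 1 : ℝ) : EReal) ≤ b := by exact_mod_cast inv_sub_one_le hb0 hbρ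
  exact hR.not_accPt_spectrum hT hρ0 (mem_discreteSpectrum_of_lt_essBottom (hle.trans_lt hb)
    (hR.inv_sub_one_mem_realSpectrum hT hρ0.ne' hρ))

variable [CompleteSpace K]

theorem finite_eigenvalues_le (hTc : T.IsClosed) (hT : Dense (T.domain : Set H)) (hb0 : 0 ≤ b)
    (hb : (b : EReal) < essBottom (formOperator T)) :
    {r : ℝ | r ≤ b ∧ eigenspace (formOperator T) r ≠ ⊥}.Finite := by
  obtain ⟨R, hR⟩ := exists_isResolvent hTc
  refine Set.Finite.of_finite_image (f := fun r => (r + 1)⁻¹)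
    ((finite_spectrum_inter_Ici (hR.not_accPt_spectrum_of_inv_le hT hb0 hb)).subset ?_)
    fun r _ s _ hrs => add_right_cancel (inv_injective hrs)
  rintro _ ⟨r, ⟨hrb, hr⟩, rfl⟩
  have hr0 := nonneg_of_eigenspace_ne_bot hT hr
  have hr1 : 0 < r + 1 := by positivity
  exact ⟨hR.inv_add_one_mem_spectrum hT hr, inv_anti₀ hr1 (add_le_add_left hrb 1)⟩

theorem finiteDimensional_eigenspan_Iic (hTc : T.IsClosed) (hT : Dense (T.domain : Set H))
    (hb0 : 0 ≤ b) (hb : (b : EReal) < essBottom (formOperator T)) :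
    FiniteDimensional ℂ (eigenspan (formOperator T) (Set.Iic b)) :=
  finiteDimensional_eigenspan hb (finite_eigenvalues_le hTc hT hb0 hb)

theorem mul_norm_sq_le_of_mem_orthogonal_eigenspan (hTc : T.IsClosed)
    (hT : Dense (T.domain : Set H)) (hb0 : 0 ≤ b) (hb : (b : EReal) < essBottom (formOperator T))
    {u : H} {w : K} (huw : (u, w) ∈ T.graph)
    (hu : u ∈ (eigenspan (formOperator T) (Set.Iic b))ᗮ) : b * ‖u‖ ^ 2 ≤ ‖w‖ ^ 2 := by
  obtain ⟨R, hR⟩ := exists_isResolvent hTc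
  have horth : ∀ ρ, (b + 1)⁻¹ ≤ ρ → ∀ v, R v = (ρ : ℂ) • v → inner ℂ v u = 0 := by
    intro ρ hρ v hv
    have hρ0 : 0 < ρ := lt_of_lt_of_le (by positivity) hρ
    have hv' : v ∈ eigenspan (formOperator T) (Set.Iic b) :=
      eigenspace_le_eigenspan (Set.mem_Iic.2 (inv_sub_one_le hb0 hρ))
        (hR.mem_eigenspace_of_apply_eq hT hρ0.ne' hv)
    exact Submodule.inner_right_of_mem_orthogonal hv' hu
  have hres := hR.norm_sq_le_of_re_inner_le huw (re_inner_apply_le_of_orthogonal_eigenvectors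
    hR.isSelfAdjoint (hR.not_accPt_spectrum_of_inv_le hT hb0 hb) horth)
  rw [inv_mul_eq_div, le_div_iff₀ (by positivity)] at hres
  linarith

/-- There is a gap above `b` without eigenvalues, so the previous estimate holds with a larger
constant. -/
theorem exists_gap (hTc : T.IsClosed) (hT : Dense (T.domain : Set H)) (hb0 : 0 ≤ b)
    (hb : (b : EReal) < essBottom (formOperator T)) :
    ∃ b' > b, ∀ u w, (u, w) ∈ T.graph → u ∈ (eigenspan (formOperator T) (Set.Iic b))ᗮ →
      b' * ‖u‖ ^ 2 ≤ ‖w‖ ^ 2 := by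
  obtain ⟨c, hbc, hc⟩ := EReal.lt_iff_exists_real_btwn.1 hb
  have hbc' : b < c := by exact_mod_cast hbc
  have hfin := finite_eigenvalues_le hTc hT (hb0.trans hbc'.le) hc
  have hgap : ∀ᶠ b' in 𝓝[>] b, ∀ r ∈ {r : ℝ | r ≤ c ∧ eigenspace (formOperator T) r ≠ ⊥},
      b < r → b' < r := by
    rw [Filter.eventually_all_finite hfin]
    intro r _
    by_cases hbr : b < r
    · filter_upwards [mem_nhdsWithin_of_mem_nhds (Iio_mem_nhds hbr)] with b' hb' _ using hb'
    · exact Eventually.of_forall fun _ h => absurd h hbr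
  obtain ⟨b', hnone, hbb', hb'c⟩ := (hgap.and (Ioo_mem_nhdsGT hbc')).exists
  have hle : eigenspan (formOperator T) (Set.Iic b') ≤ eigenspan (formOperator T) (Set.Iic b) :=
    eigenspan_le_of_forall_ne_bot fun r hr hbot =>
      not_lt.1 fun hbr => (hnone r ⟨le_trans hr hb'c.le, hbot⟩ hbr).not_ge hr
  exact ⟨b', hbb', fun u w huw hu => mul_norm_sq_le_of_mem_orthogonal_eigenspan hTc hT
    (hb0.trans hbb'.le) (lt_trans (by exact_mod_cast hb'c) hc) huw (Submodule.orthogonal_le hle hu)⟩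

omit [CompleteSpace H] in
theorem tendsto_norm_starProjection {V : Submodule ℂ H} [FiniteDimensional ℂ V] {u : ℕ → H}
    (hweak : ∀ g, Tendsto (fun j => inner ℂ g (u j)) atTop (𝓝 0)) :
    Tendsto (fun j => ‖V.starProjection (u j)‖) atTop (𝓝 0) := by
  let e := stdOrthonormalBasis ℂ V
  have hrepr : ∀ j, V.orthogonalProjectionOnto (u j) = ∑ i, inner ℂ (e i : H) (u j) • e i := by
    intro j
    rw [← e.sum_repr' (V.orthogonalProjectionOnto (u j))]
    simp only [Submodule.inner_orthogonalProjectionOnto_eq_of_mem_left]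
  have hlim : Tendsto (fun j => ∑ i, inner ℂ (e i : H) (u j) • e i) atTop
      (𝓝 (∑ i, (0 : ℂ) • e i)) :=
    tendsto_finsetSum _ fun i _ => (hweak (e i)).smul_const _
  simpa only [← hrepr, zero_smul, Finset.sum_const_zero, norm_zero, Submodule.starProjection_apply,
    Submodule.coe_norm] using hlim.norm

/-- `b' (1 - ‖P u‖²) = b' ‖u - P u‖² ≤ ‖T u‖²`, where `P` is the projection onto the finite
dimensional `eigenspan`, and `P u_j → 0`. -/
theorem not_weaklyNull_of_lt_essBottom (hTc : T.IsClosed) (hT : Dense (T.domain : Set H))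
    (hb0 : 0 ≤ b) (hb : (b : EReal) < essBottom (formOperator T)) {u : ℕ → H} {w : ℕ → K}
    (huw : ∀ j, (u j, w j) ∈ T.graph) (hnorm : ∀ j, ‖u j‖ = 1)
    (hle : ∀ ε > 0, ∃ᶠ j in atTop, ‖w j‖ ^ 2 ≤ b + ε) :
    ¬ ∀ g, Tendsto (fun j => inner ℂ g (u j)) atTop (𝓝 0) := by
  intro hweak
  obtain ⟨b', hb', hgap⟩ := exists_gap hTc hT hb0 hb
  have := finiteDimensional_eigenspan_Iic hTc hT hb0 hb
  set V := eigenspan (formOperator T) (Set.Iic b)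
  have hbound : ∀ j, b' * (1 - ‖V.starProjection (u j)‖ ^ 2) ≤ ‖w j‖ ^ 2 := by
    intro j
    have hperp : u j - V.starProjection (u j) ∈ Vᗮ :=
      Submodule.sub_starProjection_mem_orthogonal (u j)
    obtain ⟨f, hf, hpf, -⟩ := exists_mem_formGraph_of_mem_eigenspan hT (S := Set.Iic b) (b := b)
      (fun r hr => hr) (V.starProjection_apply_mem (u j))
    obtain ⟨y, hy, hwy, -⟩ := exists_norm_sq_eq_add_of_mem_formGraph (huw j) hpf
      (Submodule.inner_left_of_mem_orthogonal hf hperp)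
    have hpyth := Submodule.norm_sq_eq_add_norm_sq_starProjection (u j) V
    rw [hnorm j, one_pow, Submodule.starProjection_orthogonal_val, ← sub_eq_iff_eq_add'] at hpyth
    rw [hpyth, hwy]
    exact (hgap _ _ hy hperp).trans (le_add_of_nonneg_right (sq_nonneg ‖y‖))
  have hlim : Tendsto (fun j => b' * (1 - ‖V.starProjection (u j)‖ ^ 2)) atTop
      (𝓝 b') := by
    have := ((tendsto_norm_starProjection (V := V) hweak).pow 2).const_sub 1
      |>.const_mul b'
    simpa only [ne_eq, two_ne_zero, not_false_eq_true, zero_pow, sub_zero, mul_one] using this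
  obtain ⟨j, hsmall, hlarge⟩ := ((hle ((b' - b) / 2) (by linarith)).and_eventually
    (hlim.eventually (lt_mem_nhds (show (b + b') / 2 < b' by linarith)))).exists
  linarith [hbound j]

/-- A vector orthogonal to the eigenspaces below `b` differs from its projection `κ` onto the
eigenspace at `b` by a vector to which the gap estimate applies. -/
theorem mem_eigenspace_of_form_le (hTc : T.IsClosed) (hT : Dense (T.domain : Set H)) (hb0 : 0 ≤ b)
    (hb : (b : EReal) < essBottom (formOperator T)) {x : H} {y : K} (hxy : (x, y) ∈ T.graph)
    (hyx : ‖y‖ ^ 2 ≤ b * ‖x‖ ^ 2) (hx : x ∈ (eigenspan (formOperator T) (Set.Iio b))ᗮ) :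
    x ∈ eigenspace (formOperator T) b := by
  obtain ⟨b', hb', hgap⟩ := exists_gap hTc hT hb0 hb
  have := finiteDimensional_eigenspan_Iic hTc hT hb0 hb
  have hEle : eigenspace (formOperator T) b ≤ eigenspan (formOperator T) (Set.Iic b) :=
    eigenspace_le_eigenspan Set.self_mem_Iic
  have : FiniteDimensional ℂ (eigenspace (formOperator T) b) :=
    Submodule.finiteDimensional_of_le hEle
  set κ := (eigenspace (formOperator T) b).starProjection x
  have hκ : κ ∈ eigenspace (formOperator T) b := Submodule.starProjection_apply_mem _ x
  have hperp : x - κ ∈ (eigenspace (formOperator T) b)ᗮ :=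
    Submodule.sub_starProjection_mem_orthogonal x
  have hperp' : x - κ ∈ (eigenspan (formOperator T) (Set.Iic b))ᗮ := by
    rw [eigenspan, ← Set.Iio_insert, iSup_insert, ← Submodule.inf_orthogonal]
    exact ⟨hperp, Submodule.sub_mem _ hx
      (eigenspace_le_orthogonal_eigenspan hT Set.self_notMem_Iio hκ)⟩
  have hortho : inner ℂ (x - κ) κ = 0 := Submodule.inner_left_of_mem_orthogonal hκ hperp
  obtain ⟨z, hz, hyz, hzκ⟩ := exists_norm_sq_eq_add_of_mem_formGraph hxy
    ((mem_eigenspace_formOperator hT).1 hκ) (by rw [inner_smul_right, hortho, mul_zero])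
  rw [inner_smul_right, inner_self_eq_ofReal, ← Complex.ofReal_mul, Complex.ofReal_re] at hzκ
  have hpyth := norm_add_sq_eq_norm_sq_add_norm_sq_of_inner_eq_zero (𝕜 := ℂ) (x - κ) κ hortho
  rw [sub_add_cancel] at hpyth
  have hzero : ‖x - κ‖ ^ 2 ≤ 0 := by
    have := hgap _ _ hz hperp'
    nlinarith
  have : x - κ = 0 := norm_eq_zero.1 (pow_eq_zero_iff two_ne_zero |>.1
    (le_antisymm hzero (sq_nonneg _)))
  exact sub_eq_zero.1 this ▸ hκ

theorem finrank_le_of_form_le (hTc : T.IsClosed) (hT : Dense (T.domain : Set H)) (hb0 : 0 ≤ b)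
    (hb : (b : EReal) < essBottom (formOperator T)) {W : Submodule ℂ H}
    (hW : ∀ x ∈ W, ∃ y, (x, y) ∈ T.graph ∧ ‖y‖ ^ 2 ≤ b * ‖x‖ ^ 2)
    (hker : Disjoint W (eigenspace (formOperator T) b)) :
    (Module.finrank ℂ W : ℕ∞) ≤ eigenvalueCount (formOperator T) (Set.Iio b) := by
  have := finiteDimensional_eigenspan_Iic hTc hT hb0 hb
  set V := eigenspan (formOperator T) (Set.Iio b)
  have hle : V ≤ eigenspan (formOperator T) (Set.Iic b) :=
    eigenspan_le_of_forall_ne_bot fun r hr _ => Set.Iio_subset_Iic_self hr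
  have : FiniteDimensional ℂ V := Submodule.finiteDimensional_of_le hle
  rw [eigenvalueCount_eq_finrank, Nat.cast_le]
  let P : W →ₗ[ℂ] V := V.orthogonalProjectionOnto.toLinearMap ∘ₗ W.subtype
  refine LinearMap.finrank_le_finrank_of_injective (f := P) ?_
  rw [injective_iff_map_eq_zero]
  rintro ⟨x, hx⟩ hPx
  obtain ⟨y, hxy, hyx⟩ := hW x hx
  exact Subtype.ext (Submodule.disjoint_def.1 hker x hx (mem_eigenspace_of_form_le hTc hT hb0 hb
    hxy hyx (Submodule.orthogonalProjectionOnto_eq_zero_iff.1 hPx)))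

end BelowEssentialSpectrum

open scoped FourierTransform

/-! ### Symbols, plane waves and test functions -/

section Symbol

variable {n m l : ℕ} {F : Type*} [NormedAddCommGroup F] [NormedSpace ℂ F]

/-- The eigenvalue of `∂_i` on the plane wave `exp (2πi⟨x, ξ⟩)`. -/
def freq (ξ : EuclideanSpace ℝ (Fin n)) (i : Fin n) : ℂ := 2 * Real.pi * Complex.I * (ξ i : ℂ)

/-- The symbol `L(ξ) = ∑_α B_α (2πiξ)^α` of `L = ∑_α B_α ∂^α`. The factors `2π` match Mathlib's
normalization of the Fourier transform. -/
def symbol (B : Coeffs n m l) (ξ : EuclideanSpace ℝ (Fin n)) :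
    EuclideanSpace ℂ (Fin m) →L[ℂ] EuclideanSpace ℂ (Fin l) :=
  ∑ α ∈ B.support, (∏ i, freq ξ i ^ α i) • (B α).toEuclideanLin.toContinuousLinearMap

theorem symbol_apply (B : Coeffs n m l) (ξ : EuclideanSpace ℝ (Fin n))
    (c : EuclideanSpace ℂ (Fin m)) :
    symbol B ξ c = ∑ α ∈ B.support, (B α).toEuclideanLin ((∏ i, freq ξ i ^ α i) • c) := by
  simp [symbol, sum_apply]

theorem continuous_symbol (B : Coeffs n m l) : Continuous (symbol B) := by
  unfold symbol freq
  fun_prop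

/-- If `P D z` (read: `D` acts as the scalar `z`) is preserved by composing `D` with `∂_i` and
multiplying `z` by `q i`, then `∂^α` acts as `q^α`. -/
theorem multiDeriv_induction {q : Fin n → ℂ}
    {P : ((EuclideanSpace ℝ (Fin n) → F) → (EuclideanSpace ℝ (Fin n) → F)) → ℂ → Prop}
    (h0 : P id 1) (hs : ∀ i D z, P D z → P (fun f => D (pderiv i f)) (z * q i))
    (α : Fin n →₀ ℕ) : P (multiDeriv α) (∏ i, q i ^ α i) := by
  have hiter : ∀ i k D z, P D z → P (fun f => D ((pderiv i)^[k] f)) (z * q i ^ k) := by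
    intro i k
    induction k with
    | zero => intro D z h; simpa using h
    | succ k ih =>
      intro D z h
      simpa only [Function.iterate_succ_apply', pow_succ', mul_assoc] using ih _ _ (hs i D z h)
  have hlist : ∀ (t : List (Fin n)) D z, P D z →
      P (fun f => D (t.foldr (fun i g => (pderiv i)^[α i] g) f))
        (z * (t.map fun i => q i ^ α i).prod) := by
    intro t
    induction t with
    | nil => intro D z h; simpa using h
    | cons i t ih => intro D z h; simpa [mul_assoc] using ih _ _ (hiter i (α i) D z h)
  have hall := hlist (List.finRange n) _ _ h0
  rw [one_mul, ← Fin.prod_univ_def] at hall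
  exact hall

theorem innerSL_single (ξ : EuclideanSpace ℝ (Fin n)) (i : Fin n) :
    innerSL ℝ ξ (EuclideanSpace.single i 1) = ξ i := by
  simp [innerSL_apply_apply ℝ, EuclideanSpace.inner_single_right]

/-- The plane wave `exp (2πi⟨x, ξ⟩) c` with frequency `ξ` and amplitude `c`. -/
def planeWave (ξ : EuclideanSpace ℝ (Fin n)) (c : F) : EuclideanSpace ℝ (Fin n) → F :=
  fun x => Complex.exp (2 * Real.pi * Complex.I * (inner ℝ x ξ : ℝ)) • c

theorem norm_planeWave (ξ : EuclideanSpace ℝ (Fin n)) (c : F) (x : EuclideanSpace ℝ (Fin n)) :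
    ‖planeWave ξ c x‖ = ‖c‖ := by
  rw [planeWave, norm_smul, show 2 * (Real.pi : ℂ) * Complex.I * (inner ℝ x ξ : ℝ)
    = ((2 * Real.pi * inner ℝ x ξ : ℝ) : ℂ) * Complex.I by push_cast; ring,
    Complex.norm_exp_ofReal_mul_I, one_mul]

theorem hasFDerivAt_planeWave (ξ : EuclideanSpace ℝ (Fin n)) (c : F)
    (x : EuclideanSpace ℝ (Fin n)) :
    HasFDerivAt (planeWave ξ c) ((Complex.exp (2 * Real.pi * Complex.I * (inner ℝ x ξ : ℝ)) •
      ((2 * Real.pi * Complex.I : ℂ) •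
        Complex.ofRealCLM.comp ((innerSL ℝ).flip ξ))).smulRight c) x :=
  (((Complex.ofRealCLM.comp ((innerSL ℝ).flip ξ)).hasFDerivAt.const_mul _).cexp).smul_const c

theorem contDiff_planeWave (ξ : EuclideanSpace ℝ (Fin n)) (c : F) :
    ContDiff ℝ ∞ (planeWave ξ c) :=
  (contDiff_const.mul (Complex.ofRealCLM.comp ((innerSL ℝ).flip ξ)).contDiff).cexp.smul
    contDiff_const

theorem pderiv_planeWave (ξ : EuclideanSpace ℝ (Fin n)) (c : F) (i : Fin n) :
    pderiv i (planeWave ξ c) = planeWave ξ (freq ξ i • c) := by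
  funext x
  have hi : inner ℝ (EuclideanSpace.single i 1) ξ = ξ i :=
    (real_inner_comm _ _).trans (innerSL_single ξ i)
  rw [pderiv, (hasFDerivAt_planeWave ξ c x).fderiv]
  simp only [planeWave, freq, ContinuousLinearMap.smulRight_apply, _root_.smul_apply, smul_eq_mul,
    smul_smul, mul_assoc (Complex.exp _)]
  exact congrArg (fun t : ℝ => (Complex.exp (2 * Real.pi * Complex.I * (inner ℝ x ξ : ℝ)) *
    (2 * Real.pi * Complex.I * (t : ℂ))) • c) hi

theorem multiDeriv_planeWave (α : Fin n →₀ ℕ) (ξ : EuclideanSpace ℝ (Fin n)) (c : F) :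
    multiDeriv α (planeWave ξ c) = planeWave ξ ((∏ i, freq ξ i ^ α i) • c) := by
  refine multiDeriv_induction (q := freq ξ)
    (P := fun D z => ∀ c : F, D (planeWave ξ c) = planeWave ξ (z • c))
    (fun c => by simp) (fun i D z h c => ?_) α c
  simp only [pderiv_planeWave, h, smul_smul]

theorem applyOp_planeWave (B : Coeffs n m l) (ξ : EuclideanSpace ℝ (Fin n))
    (c : EuclideanSpace ℂ (Fin m)) :
    applyOp B (planeWave ξ c) = planeWave ξ (symbol B ξ c) := by
  funext x
  rw [applyOp, symbol_apply]
  simp only [multiDeriv_planeWave, planeWave, map_smul, Finset.smul_sum]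

theorem tsupport_pderiv_subset (f : EuclideanSpace ℝ (Fin n) → F) (i : Fin n) :
    tsupport (pderiv i f) ⊆ tsupport f := by
  refine closure_minimal (fun x hx => ?_) (isClosed_tsupport f)
  refine support_fderiv_subset ℝ (f := f) fun h => hx ?_
  simp [pderiv, h]

theorem tsupport_multiDeriv_subset (α : Fin n →₀ ℕ) (f : EuclideanSpace ℝ (Fin n) → F) :
    tsupport (multiDeriv α f) ⊆ tsupport f :=
  multiDeriv_induction (q := 1) (P := fun D _ => ∀ f : EuclideanSpace ℝ (Fin n) → F,
    tsupport (D f) ⊆ tsupport f) (fun _ => subset_rfl)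
    (fun i _ _ h f => (h (pderiv i f)).trans (tsupport_pderiv_subset f i)) α f

theorem tsupport_applyOp_subset (B : Coeffs n m l)
    (f : EuclideanSpace ℝ (Fin n) → EuclideanSpace ℂ (Fin m)) :
    tsupport (applyOp B f) ⊆ tsupport f := by
  refine closure_minimal (fun x hx => by_contra fun hxf => hx ?_) (isClosed_tsupport f)
  refine Finset.sum_eq_zero fun α _ => ?_
  rw [image_eq_zero_of_notMem_tsupport fun h => hxf (tsupport_multiDeriv_subset α f h), map_zero]

/-- Smooth functions with compact support. -/
structure IsTest (f : EuclideanSpace ℝ (Fin n) → F) : Prop where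
  contDiff : ContDiff ℝ ∞ f
  hasCompactSupport : HasCompactSupport f

namespace IsTest

variable {f : EuclideanSpace ℝ (Fin n) → F}

theorem integrable (hf : IsTest f) : Integrable f :=
  hf.contDiff.continuous.integrable_of_hasCompactSupport hf.hasCompactSupport

theorem memLp (hf : IsTest f) : MemLp f 2 :=
  hf.contDiff.continuous.memLp_of_hasCompactSupport hf.hasCompactSupport

theorem pderiv (hf : IsTest f) (i : Fin n) : IsTest (pderiv i f) where
  contDiff := (hf.contDiff.fderiv_right (m := ∞) (by simp)).clm_apply contDiff_const
  hasCompactSupport := hf.hasCompactSupport.mono'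
    ((subset_tsupport _).trans (tsupport_pderiv_subset f i))

theorem multiDeriv (hf : IsTest f) (α : Fin n →₀ ℕ) : IsTest (multiDeriv α f) :=
  multiDeriv_induction (q := 1) (P := fun D _ => ∀ f : EuclideanSpace ℝ (Fin n) → F,
    IsTest f → IsTest (D f)) (fun _ hf => hf) (fun i _ _ h _ hf => h _ (hf.pderiv i)) α f hf

theorem applyOp {f : EuclideanSpace ℝ (Fin n) → EuclideanSpace ℂ (Fin m)} (hf : IsTest f)
    (B : Coeffs n m l) : IsTest (applyOp B f) where
  contDiff := ContDiff.sum fun α _ =>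
    ((B α).toEuclideanLin.toContinuousLinearMap.restrictScalars ℝ).contDiff.comp
      (hf.multiDeriv α).contDiff
  hasCompactSupport := hf.hasCompactSupport.mono'
    ((subset_tsupport _).trans (tsupport_applyOp_subset B f))

end IsTest

theorem fourier_pderiv [CompleteSpace F] {f : EuclideanSpace ℝ (Fin n) → F} (hf : IsTest f)
    (i : Fin n) (ξ : EuclideanSpace ℝ (Fin n)) : 𝓕 (pderiv i f) ξ = freq ξ i • 𝓕 f ξ := by
  have hint : Integrable (fderiv ℝ f) :=
    (hf.contDiff.continuous_fderiv (by simp)).integrable_of_hasCompactSupport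
      (hf.hasCompactSupport.fderiv ℝ)
  have heval : 𝓕 (pderiv i f) ξ = 𝓕 (fderiv ℝ f) ξ (EuclideanSpace.single i 1) := by
    rw [Real.fourier_eq, Real.fourier_eq, ContinuousLinearMap.integral_apply]
    · rfl
    · exact (Real.fourierIntegral_convergent_iff ξ).2 hint
  rw [heval, Real.fourier_fderiv hf.integrable (hf.contDiff.differentiable (by simp)) hint]
  simp only [VectorFourier.fourierSMulRight_apply, _root_.neg_apply, neg_smul, smul_neg, freq,
    ← Complex.coe_smul, smul_smul]
  rw [← neg_smul, neg_mul, neg_neg]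
  exact congrArg (fun t : ℝ => (2 * Real.pi * Complex.I * (t : ℂ)) • 𝓕 f ξ) (innerSL_single ξ i)

theorem fourier_multiDeriv [CompleteSpace F] {f : EuclideanSpace ℝ (Fin n) → F} (hf : IsTest f)
    (α : Fin n →₀ ℕ) (ξ : EuclideanSpace ℝ (Fin n)) :
    𝓕 (multiDeriv α f) ξ = (∏ i, freq ξ i ^ α i) • 𝓕 f ξ := by
  refine multiDeriv_induction (q := freq ξ) (P := fun D z => ∀ f : EuclideanSpace ℝ (Fin n) → F,
    IsTest f → 𝓕 (D f) ξ = z • 𝓕 f ξ) (fun f _ => by simp) (fun i D z h f hf => ?_) α f hf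
  rw [h _ (hf.pderiv i), fourier_pderiv hf, smul_smul]

theorem fourier_applyOp (B : Coeffs n m l)
    {f : EuclideanSpace ℝ (Fin n) → EuclideanSpace ℂ (Fin m)} (hf : IsTest f)
    (ξ : EuclideanSpace ℝ (Fin n)) : 𝓕 (applyOp B f) ξ = symbol B ξ (𝓕 f ξ) := by
  have hint : ∀ α, Integrable (fun x => Real.fourierChar (-inner ℝ x ξ) • multiDeriv α f x) :=
    fun α => (Real.fourierIntegral_convergent_iff ξ).2 (hf.multiDeriv α).integrable
  have hcomm : ∀ α x, Real.fourierChar (-inner ℝ x ξ) • (B α).toEuclideanLin (multiDeriv α f x)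
      = (B α).toEuclideanLin.toContinuousLinearMap
        (Real.fourierChar (-inner ℝ x ξ) • multiDeriv α f x) := by
    intro α x
    simp [Circle.smul_def]
  rw [symbol_apply, Real.fourier_eq]
  simp only [applyOp, Finset.smul_sum, hcomm]
  rw [integral_finsetSum _ fun α _ => ContinuousLinearMap.integrable_comp _ (hint α)]
  refine Finset.sum_congr rfl fun α _ => ?_
  rw [ContinuousLinearMap.integral_comp_comm _ (hint α), ← fourier_multiDeriv hf]
  rfl

end Symbol

/-! ### The closed operators behind the Neumann and Dirichlet forms -/

section Closability

variable {H K : Type*} [NormedAddCommGroup H] [InnerProductSpace ℂ H] [NormedAddCommGroup K]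
  [InnerProductSpace ℂ K] {T : H →ₗ.[ℂ] K}

theorem FormClosable.isClosable (hT : FormClosable T) : T.IsClosable := by
  refine ⟨T.graph.topologicalClosure.toLinearPMap, (Submodule.toLinearPMap_graph_eq _ ?_).symm⟩
  rintro ⟨x, z⟩ hx (rfl : x = 0)
  obtain ⟨p, hp, hlim⟩ := mem_closure_iff_seq_limit.1
    (show ((0 : H), z) ∈ closure (T.graph : Set (H × K)) from hx)
  choose u hu using fun j => (LinearPMap.mem_graph_iff T).1 (hp j)
  have hu0 : Tendsto (fun j => (u j : H)) atTop (𝓝 0) := by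
    simp only [(hu _).1]
    exact (continuous_fst.tendsto _).comp hlim
  have hTu : Tendsto (fun j => T (u j)) atTop (𝓝 z) := by
    simp only [(hu _).2]
    exact (continuous_snd.tendsto _).comp hlim
  have hTu0 : Tendsto (fun j => ‖T (u j)‖ ^ 2) atTop (𝓝 0) := hT u hu0 fun ε hε => by
    obtain ⟨N, hN⟩ := Metric.cauchySeq_iff.1 hTu.cauchySeq (Real.sqrt ε) (Real.sqrt_pos.2 hε)
    refine ⟨N, fun i hi j hj => ?_⟩
    rw [LinearPMap.map_sub, ← dist_eq_norm]
    exact (Real.lt_sqrt dist_nonneg).1 (hN i hi j hj)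
  have hz : ‖z‖ ^ 2 = 0 := tendsto_nhds_unique (hTu.norm.pow 2) hTu0
  exact norm_eq_zero.1 (pow_eq_zero_iff two_ne_zero |>.1 hz)

end Closability

section FormDomains

variable {n m l : ℕ} (B : Coeffs n m l) (Ω : Opens (EuclideanSpace ℝ (Fin n)))

/-- The closure of `L` on its maximal smooth domain. Its domain is `H¹`, and
`a[u] = ‖neumannClosure B Ω u‖²`. -/
abbrev neumannClosure : L2 Ω m →ₗ.[ℂ] L2 Ω l :=
  (smoothOp B Ω).closure

/-- The closure of `L` on `C_0^∞(Ω, ℂ^m)`. Its domain is `H¹_0`. -/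
abbrev dirichletClosure : L2 Ω m →ₗ.[ℂ] L2 Ω l :=
  ((smoothOp B Ω).domRestrict (testFunctions Ω m)).closure

theorem graph_smoothOp : (smoothOp B Ω).graph = smoothGraph B Ω :=
  Submodule.toLinearPMap_graph_eq _ (smoothGraph_single_valued B Ω)

variable {B Ω}

theorem toLp_mem_graph_smoothOp {f : EuclideanSpace ℝ (Fin n) → EuclideanSpace ℂ (Fin m)}
    (hc : ContDiff ℝ ∞ f) (hf : MemLp f 2 (volume.restrict (Ω : Set (EuclideanSpace ℝ (Fin n)))))
    (hLf : MemLp (applyOp B f) 2 (volume.restrict (Ω : Set (EuclideanSpace ℝ (Fin n))))) :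
    (hf.toLp f, hLf.toLp (applyOp B f)) ∈ (smoothOp B Ω).graph := by
  rw [graph_smoothOp]
  exact ⟨f, hc.contDiffOn, hf.coeFn_toLp, hLf.coeFn_toLp⟩

theorem mem_testFunctions_iff_exists_toLp {u : L2 Ω m} : u ∈ testFunctions Ω m ↔
    ∃ f : EuclideanSpace ℝ (Fin n) → EuclideanSpace ℂ (Fin m), ∃ hf : IsTest f,
      tsupport f ⊆ Ω ∧ u = (hf.memLp.restrict Ω).toLp f := by
  constructor
  · rintro ⟨f, hf, hfc, hfΩ, hu⟩
    have htest : IsTest f := ⟨hf, hfc⟩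
    exact ⟨f, htest, hfΩ, Lp.ext (hu.trans (htest.memLp.restrict _).coeFn_toLp.symm)⟩
  · rintro ⟨f, hf, hfΩ, rfl⟩
    exact ⟨f, hf.contDiff, hf.hasCompactSupport, hfΩ, (hf.memLp.restrict _).coeFn_toLp⟩

theorem graph_dirichletClosure_subset (hB : FormClosable (smoothOp B Ω))
    {C : Set (L2 Ω m × L2 Ω l)} (hC : IsClosed C)
    (h : ∀ f : EuclideanSpace ℝ (Fin n) → EuclideanSpace ℂ (Fin m), ∀ hf : IsTest f,
      tsupport f ⊆ Ω → ((hf.memLp.restrict Ω).toLp f,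
        ((hf.applyOp B).memLp.restrict Ω).toLp (applyOp B f)) ∈ C) :
    ((dirichletClosure B Ω).graph : Set _) ⊆ C := by
  have hle : (smoothOp B Ω).domRestrict (testFunctions Ω m) ≤ smoothOp B Ω :=
    LinearPMap.domRestrict_le
  rw [← (hB.isClosable.leIsClosable hle).graph_closure_eq_closure_graph]
  refine closure_minimal ?_ hC
  rintro ⟨u, w⟩ huw
  have hu : u ∈ testFunctions Ω m := (LinearPMap.mem_domain_of_mem_graph huw).1
  obtain ⟨f, hf, hfΩ, rfl⟩ := mem_testFunctions_iff_exists_toLp.1 hu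
  have hLf := toLp_mem_graph_smoothOp (B := B) hf.contDiff (hf.memLp.restrict Ω)
    ((hf.applyOp B).memLp.restrict Ω)
  have hw : w = ((hf.applyOp B).memLp.restrict Ω).toLp (applyOp B f) :=
    LinearPMap.mem_graph_snd_inj _ (LinearPMap.le_graph_of_le hle huw) hLf rfl
  exact hw ▸ h f hf hfΩ

theorem dense_testFunctions : Dense (testFunctions Ω m : Set (L2 Ω m)) := by
  rw [Submodule.dense_iff_topologicalClosure_eq_top, Submodule.topologicalClosure_eq_top_iff,
    Submodule.eq_bot_iff]
  intro u hu
  have hloc : LocallyIntegrable u (volume.restrict (Ω : Set (EuclideanSpace ℝ (Fin n)))) :=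
    (Lp.memLp u).locallyIntegrable (by norm_num)
  refine (Lp.eq_zero_iff_ae_eq_zero).2 ((ae_restrict_iff' Ω.isOpen.measurableSet).2
    (IsOpen.ae_eq_zero_of_integral_contDiff_smul_eq_zero Ω.isOpen
      (locallyIntegrableOn_of_locallyIntegrable_restrict hloc) fun g hg hgc hgΩ => ?_))
  rw [← setIntegral_eq_integral_of_forall_compl_eq_zero (s := (Ω : Set (EuclideanSpace ℝ (Fin n))))
    fun x hx => by rw [image_eq_zero_of_notMem_tsupport fun h => hx (hgΩ h), zero_smul]]
  -- Test `u ⊥ C_0^∞` against `g I`, where `I` is the integral to be shown to vanish.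
  set I := ∫ x in (Ω : Set (EuclideanSpace ℝ (Fin n))), g x • u x with hI
  have htest : IsTest fun x => g x • I := ⟨hg.smul contDiff_const, hgc.smul_right⟩
  have horth := (Submodule.mem_orthogonal _ _).1 hu _ (mem_testFunctions_iff_exists_toLp.2
    ⟨_, htest, (closure_mono (Function.support_smul_subset_left g _)).trans hgΩ, rfl⟩)
  refine inner_self_eq_zero (𝕜 := ℂ).1 ?_
  rw [L2.inner_def] at horth
  conv_lhs => rw [hI]
  rw [← integral_inner (hloc.integrable_smul_left_of_hasCompactSupport hg.continuous hgc), ← horth]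
  refine integral_congr_ae ?_
  filter_upwards [(htest.memLp.restrict Ω).coeFn_toLp] with x hx
  rw [hx, ← Complex.coe_smul, ← Complex.coe_smul, inner_smul_left, inner_smul_right,
    Complex.conj_ofReal]

variable (B Ω) in
theorem dense_domain_dirichletClosure : Dense ((dirichletClosure B Ω).domain : Set (L2 Ω m)) := by
  refine dense_testFunctions.mono fun u hu =>
    (LinearPMap.le_closure _).1 (Submodule.mem_inf.2 ⟨hu, ?_⟩)
  obtain ⟨f, hf, -, rfl⟩ := mem_testFunctions_iff_exists_toLp.1 hu
  exact LinearPMap.mem_domain_of_mem_graph (toLp_mem_graph_smoothOp (B := B) hf.contDiff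
    (hf.memLp.restrict Ω) ((hf.applyOp B).memLp.restrict Ω))

theorem dirichletClosure_le_neumannClosure (hB : FormClosable (smoothOp B Ω)) :
    dirichletClosure B Ω ≤ neumannClosure B Ω :=
  hB.isClosable.closure_mono LinearPMap.domRestrict_le

theorem dense_domain_neumannClosure (hB : FormClosable (smoothOp B Ω)) :
    Dense ((neumannClosure B Ω).domain : Set (L2 Ω m)) :=
  (dense_domain_dirichletClosure B Ω).mono (dirichletClosure_le_neumannClosure hB).1

end FormDomains

/-! ### The Fourier transform on the Dirichlet form domain -/

section L2Auxiliary

theorem Lp_integrable_norm_sq {X F : Type*} [MeasurableSpace X] {μ : Measure X}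
    [NormedAddCommGroup F] (u : Lp F 2 μ) : Integrable (fun x => ‖u x‖ ^ 2) μ :=
  (memLp_two_iff_integrable_sq_norm (Lp.aestronglyMeasurable u)).1 (Lp.memLp u)

theorem Lp_norm_sq_eq_integral {X F : Type*} [MeasurableSpace X] {μ : Measure X}
    [NormedAddCommGroup F] [InnerProductSpace ℂ F] (u : Lp F 2 μ) :
    ‖u‖ ^ 2 = ∫ x, ‖u x‖ ^ 2 ∂μ := by
  have hinner := inner_self_eq_ofReal u
  rw [L2.inner_def] at hinner
  simp_rw [inner_self_eq_ofReal] at hinner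
  rw [integral_complex_ofReal] at hinner
  exact (Complex.ofReal_injective hinner).symm

theorem isClosed_setOf_ae_eq_apply {X F G : Type*} [MeasurableSpace X] {μ : Measure X}
    [NormedAddCommGroup F] [NormedSpace ℂ F] [NormedAddCommGroup G] [NormedSpace ℂ G]
    (S : X → F →L[ℂ] G) :
    IsClosed {p : Lp F 2 μ × Lp G 2 μ | p.2 =ᵐ[μ] fun x => S x (p.1 x)} := by
  refine IsSeqClosed.isClosed fun p q hp hq => ?_
  obtain ⟨σ, hσ, hfst⟩ := (tendstoInMeasure_of_tendsto_Lp
    ((continuous_fst.tendsto q).comp hq)).exists_seq_tendsto_ae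
  obtain ⟨τ, hτ, hsnd⟩ := (tendstoInMeasure_of_tendsto_Lp
    (((continuous_snd.tendsto q).comp hq).comp hσ.tendsto_atTop)).exists_seq_tendsto_ae
  filter_upwards [hfst, hsnd, ae_all_iff.2 hp] with x hx1 hx2 hx
  refine tendsto_nhds_unique hx2 ?_
  have hS : Tendsto (fun j => S x ((p (σ (τ j))).1 x)) atTop (𝓝 (S x (q.1 x))) :=
    ((S x).continuous.tendsto _).comp (hx1.comp hτ.tendsto_atTop)
  exact hS.congr fun j => (hx _).symm

end L2Auxiliary

section ZeroExtension

variable {n d : ℕ} {Ω : Opens (EuclideanSpace ℝ (Fin n))}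

/-- `L₂(ℝⁿ, ℂ^d)`, where Plancherel's theorem is available. -/
abbrev WholeL2 (n d : ℕ) : Type :=
  Lp (EuclideanSpace ℂ (Fin d)) 2 (volume : Measure (EuclideanSpace ℝ (Fin n)))

theorem memLp_indicator (u : L2 Ω d) :
    MemLp ((Ω : Set (EuclideanSpace ℝ (Fin n))).indicator u) 2 volume :=
  (memLp_indicator_iff_restrict Ω.isOpen.measurableSet).2 (Lp.memLp u)

/-- The extension by zero `L₂(Ω, ℂ^d) → L₂(ℝⁿ, ℂ^d)`. -/
def zeroExt (u : L2 Ω d) : WholeL2 n d :=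
  (memLp_indicator u).toLp _

theorem norm_zeroExt (u : L2 Ω d) : ‖zeroExt u‖ = ‖u‖ := by
  rw [zeroExt, Lp.norm_toLp, eLpNorm_indicator_eq_eLpNorm_restrict Ω.isOpen.measurableSet,
    Lp.norm_def]

theorem indicator_toLp_ae_eq {f : EuclideanSpace ℝ (Fin n) → EuclideanSpace ℂ (Fin d)}
    (hf : MemLp f 2) (hfΩ : tsupport f ⊆ Ω) :
    (Ω : Set (EuclideanSpace ℝ (Fin n))).indicator ((hf.restrict Ω).toLp f) =ᵐ[volume] f := by
  have hself : (Ω : Set (EuclideanSpace ℝ (Fin n))).indicator f = f :=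
    Set.indicator_eq_self.2 ((subset_tsupport f).trans hfΩ)
  simpa only [hself] using
    (ae_eq_restrict_iff_indicator_ae_eq Ω.isOpen.measurableSet).1 (hf.restrict Ω).coeFn_toLp

theorem zeroExt_toLp {f : EuclideanSpace ℝ (Fin n) → EuclideanSpace ℂ (Fin d)}
    (hf : MemLp f 2) (hfΩ : tsupport f ⊆ Ω) : zeroExt ((hf.restrict Ω).toLp f) = hf.toLp f :=
  (MemLp.toLp_eq_toLp_iff _ _).2 (indicator_toLp_ae_eq hf hfΩ)

theorem zeroExt_sub (u v : L2 Ω d) : zeroExt (u - v) = zeroExt u - zeroExt v := by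
  rw [zeroExt, zeroExt, zeroExt, ← MemLp.toLp_sub, MemLp.toLp_eq_toLp_iff, ← Set.indicator_sub']
  exact (ae_eq_restrict_iff_indicator_ae_eq Ω.isOpen.measurableSet).1 (Lp.coeFn_sub u v)

theorem isometry_zeroExt : Isometry (zeroExt (Ω := Ω) (d := d)) :=
  Isometry.of_dist_eq fun u v => by
    rw [dist_eq_norm, dist_eq_norm, ← zeroExt_sub, norm_zeroExt]

end ZeroExtension

section Fourier

variable {n m l d : ℕ} {B : Coeffs n m l} {Ω : Opens (EuclideanSpace ℝ (Fin n))}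

theorem fourier_toLp_ae_eq {f : EuclideanSpace ℝ (Fin n) → EuclideanSpace ℂ (Fin d)}
    (hf : IsTest f) : (𝓕 (hf.memLp.toLp f) : WholeL2 n d) =ᵐ[volume] 𝓕 f := by
  let φ := hf.hasCompactSupport.toSchwartzMap hf.contDiff
  have hφ : hf.memLp.toLp f = φ.toLp 2 := by
    refine Lp.ext ?_
    filter_upwards [hf.memLp.coeFn_toLp, φ.coeFn_toLp 2] with x hfx hφx
    rw [hfx, hφx]
    rfl
  rw [hφ, SchwartzMap.toLp_fourier_eq]
  exact (𝓕 φ).coeFn_toLp 2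

theorem fourier_zeroExt_of_mem_graph_dirichletClosure (hB : FormClosable (smoothOp B Ω))
    {u : L2 Ω m} {w : L2 Ω l} (huw : (u, w) ∈ (dirichletClosure B Ω).graph) :
    (𝓕 (zeroExt w) : WholeL2 n l) =ᵐ[volume]
      fun ξ => symbol B ξ ((𝓕 (zeroExt u) : WholeL2 n m) ξ) := by
  have hcont : Continuous fun p : L2 Ω m × L2 Ω l =>
      ((𝓕 (zeroExt p.1) : WholeL2 n m), (𝓕 (zeroExt p.2) : WholeL2 n l)) :=
    ((Lp.fourierTransformₗᵢ _ _).continuous.comp (isometry_zeroExt.continuous.comp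
      continuous_fst)).prodMk ((Lp.fourierTransformₗᵢ _ _).continuous.comp
        (isometry_zeroExt.continuous.comp continuous_snd))
  refine graph_dirichletClosure_subset hB ((isClosed_setOf_ae_eq_apply (symbol B)).preimage hcont)
    (fun f hf hfΩ => ?_) huw
  simp only [Set.mem_preimage, Set.mem_ofPred_eq]
  rw [zeroExt_toLp hf.memLp hfΩ,
    zeroExt_toLp (hf.applyOp B).memLp ((tsupport_applyOp_subset B f).trans hfΩ)]
  filter_upwards [fourier_toLp_ae_eq hf, fourier_toLp_ae_eq (hf.applyOp B)] with ξ hu hw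
  rw [hu, hw, fourier_applyOp B hf]

/-- By Plancherel, the defect `|W|² - b |U|²` of the Fourier transforms is nonnegative with
nonpositive integral. -/
theorem eq_zero_of_dirichlet_form_le (hB : FormClosable (smoothOp B Ω)) {b : ℝ}
    (hb : ∀ᵐ ξ, ∀ c ≠ 0, b * ‖c‖ ^ 2 < ‖symbol B ξ c‖ ^ 2) {u : L2 Ω m} {w : L2 Ω l}
    (huw : (u, w) ∈ (dirichletClosure B Ω).graph) (hle : ‖w‖ ^ 2 ≤ b * ‖u‖ ^ 2) : u = 0 := by
  let U : WholeL2 n m := 𝓕 (zeroExt u)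
  let W : WholeL2 n l := 𝓕 (zeroExt w)
  have hU : ‖U‖ = ‖u‖ := (Lp.norm_fourier_eq _).trans (norm_zeroExt u)
  have hW : ‖W‖ = ‖w‖ := (Lp.norm_fourier_eq _).trans (norm_zeroExt w)
  have hsymb : W =ᵐ[volume] fun ξ => symbol B ξ (U ξ) :=
    fourier_zeroExt_of_mem_graph_dirichletClosure hB huw
  have hbU : Integrable fun ξ => b * ‖U ξ‖ ^ 2 := (Lp_integrable_norm_sq U).const_mul b
  have hnonneg : 0 ≤ᵐ[volume] fun ξ => ‖W ξ‖ ^ 2 - b * ‖U ξ‖ ^ 2 := by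
    filter_upwards [hb, hsymb] with ξ hbξ hWξ
    rw [hWξ]
    by_cases hUξ : U ξ = 0
    · simp [hUξ]
    · exact sub_nonneg.2 (hbξ _ hUξ).le
  have hzero : ∫ ξ, (‖W ξ‖ ^ 2 - b * ‖U ξ‖ ^ 2) = 0 := by
    refine le_antisymm ?_ (integral_nonneg_of_ae hnonneg)
    rw [integral_sub (Lp_integrable_norm_sq W) hbU, integral_const_mul, ← Lp_norm_sq_eq_integral,
      ← Lp_norm_sq_eq_integral, hU, hW]
    linarith
  have hae := (integral_eq_zero_iff_of_nonneg_ae hnonneg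
    ((Lp_integrable_norm_sq W).sub hbU)).1 hzero
  have hU0 : U = 0 := by
    refine (Lp.eq_zero_iff_ae_eq_zero).2 ?_
    filter_upwards [hae, hb, hsymb] with ξ hξ hbξ hWξ
    by_contra hUξ
    have hlt := hbξ _ hUξ
    rw [← hWξ] at hlt
    exact hlt.ne' (sub_eq_zero.1 hξ)
  rw [← norm_eq_zero, ← hU, hU0, norm_zero]

end Fourier

theorem ae_eq_zero_of_fourier_eq_zero {V F : Type*} [NormedAddCommGroup V] [InnerProductSpace ℝ V]
    [FiniteDimensional ℝ V] [MeasurableSpace V] [BorelSpace V] [NormedAddCommGroup F]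
    [NormedSpace ℂ F] [CompleteSpace F] {g : V → F} (hg : Integrable g) (h : ∀ ξ, 𝓕 g ξ = 0) :
    g =ᵐ[volume] 0 := by
  refine ae_eq_zero_of_integral_contDiff_smul_eq_zero hg.locallyIntegrable fun φ hφ hφc => ?_
  let ψ : SchwartzMap V ℂ :=
    (hφc.comp_left (g := Complex.ofReal) (by simp)).toSchwartzMap
      (Complex.ofRealCLM.contDiff.comp hφ)
  have hψ : ∀ ξ, VectorFourier.fourierIntegral Real.fourierChar volume (innerₗ V)
      ((𝓕⁻ ψ : SchwartzMap V ℂ) : V → ℂ) ξ = (φ ξ : ℂ) := by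
    intro ξ
    have hinv : 𝓕 (𝓕⁻ ψ) = ψ := FourierTransform.fourier_fourierInv_eq ψ
    exact DFunLike.congr_fun hinv ξ
  have hg0 : ∀ x,
      VectorFourier.fourierIntegral Real.fourierChar volume (innerₗ V).flip g x = 0 := by
    intro x
    rw [flip_innerₗ]
    exact h x
  have hflip := VectorFourier.integral_fourierIntegral_smul_eq_flip (μ := volume) (ν := volume)
    (L := innerₗ V) Real.continuous_fourierChar continuous_inner (𝓕⁻ ψ).integrable hg
  simpa only [hψ, hg0, smul_zero, integral_zero, Complex.coe_smul] using hflip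

section FiniteVolume

/-! ### Plane waves in a domain of finite volume -/

variable {n m l d : ℕ} {B : Coeffs n m l} {Ω : Opens (EuclideanSpace ℝ (Fin n))}

/-- The Fourier transform of an element of `L₂(Ω, ℂ^d)`, extended by zero, as a pointwise defined
integral; this is meaningful when `Ω` has finite volume, since then `L₂(Ω) ⊆ L₁(Ω)`. -/
def ft (u : L2 Ω d) (ξ : EuclideanSpace ℝ (Fin n)) : EuclideanSpace ℂ (Fin d) :=
  𝓕 ((Ω : Set (EuclideanSpace ℝ (Fin n))).indicator u) ξ

theorem ft_toLp {f : EuclideanSpace ℝ (Fin n) → EuclideanSpace ℂ (Fin d)} (hf : MemLp f 2)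
    (hfΩ : tsupport f ⊆ Ω) (ξ : EuclideanSpace ℝ (Fin n)) :
    ft ((hf.restrict Ω).toLp f) ξ = 𝓕 f ξ := by
  rw [ft, Real.fourier_eq, Real.fourier_eq]
  refine integral_congr_ae ?_
  filter_upwards [indicator_toLp_ae_eq hf hfΩ] with x hx
  rw [hx]

theorem ft_eq_setIntegral (u : L2 Ω d) (ξ : EuclideanSpace ℝ (Fin n)) :
    ft u ξ = ∫ x in (Ω : Set (EuclideanSpace ℝ (Fin n))),
      Real.fourierChar (-inner ℝ x ξ) • u x := by
  rw [ft, Real.fourier_eq, ← integral_indicator Ω.isOpen.measurableSet]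
  refine integral_congr_ae (Eventually.of_forall fun x => ?_)
  by_cases hx : x ∈ (Ω : Set (EuclideanSpace ℝ (Fin n))) <;> simp [hx]

theorem inner_planeWave {F : Type*} [NormedAddCommGroup F] [InnerProductSpace ℂ F]
    (ξ x : EuclideanSpace ℝ (Fin n)) (c v : F) :
    inner ℂ (planeWave ξ c x) v = inner ℂ c (Real.fourierChar (-inner ℝ x ξ) • v) := by
  rw [planeWave, inner_smul_left, Circle.smul_def, inner_smul_right, Real.fourierChar_apply,
    ← Complex.exp_conj]
  congr 2
  simp only [map_mul, Complex.conj_I, Complex.conj_ofReal, Complex.conj_ofNat]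
  push_cast
  ring

variable [IsFiniteMeasure (volume.restrict (Ω : Set (EuclideanSpace ℝ (Fin n))))]

theorem memLp_planeWave (ξ : EuclideanSpace ℝ (Fin n)) (c : EuclideanSpace ℂ (Fin d)) :
    MemLp (planeWave ξ c) 2 (volume.restrict (Ω : Set (EuclideanSpace ℝ (Fin n)))) :=
  MemLp.of_bound (contDiff_planeWave ξ c).continuous.aestronglyMeasurable ‖c‖
    (Eventually.of_forall fun x => (norm_planeWave ξ c x).le)

variable (Ω) in
/-- The restriction to `Ω` of the plane wave with frequency `ξ` and amplitude `c`, as an element of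
`L₂(Ω, ℂ^d)`. -/
def waveLp (ξ : EuclideanSpace ℝ (Fin n)) (c : EuclideanSpace ℂ (Fin d)) : L2 Ω d :=
  (memLp_planeWave ξ c).toLp _

theorem coeFn_waveLp (ξ : EuclideanSpace ℝ (Fin n)) (c : EuclideanSpace ℂ (Fin d)) :
    waveLp Ω ξ c =ᵐ[volume.restrict (Ω : Set (EuclideanSpace ℝ (Fin n)))] planeWave ξ c :=
  (memLp_planeWave ξ c).coeFn_toLp

theorem waveLp_mem_graph (ξ : EuclideanSpace ℝ (Fin n)) (c : EuclideanSpace ℂ (Fin m)) :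
    (waveLp Ω ξ c, waveLp Ω ξ (symbol B ξ c)) ∈ (neumannClosure B Ω).graph := by
  refine LinearPMap.le_graph_of_le (LinearPMap.le_closure _) ?_
  rw [graph_smoothOp]
  refine ⟨planeWave ξ c, (contDiff_planeWave ξ c).contDiffOn, coeFn_waveLp ξ c, ?_⟩
  rw [applyOp_planeWave]
  exact coeFn_waveLp ξ _

theorem norm_waveLp_sq (ξ : EuclideanSpace ℝ (Fin n)) (c : EuclideanSpace ℂ (Fin d)) :
    ‖waveLp Ω ξ c‖ ^ 2 = volume.real (Ω : Set (EuclideanSpace ℝ (Fin n))) * ‖c‖ ^ 2 := by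
  have hnorm : (fun x => ‖waveLp Ω ξ c x‖ ^ 2)
      =ᵐ[volume.restrict (Ω : Set (EuclideanSpace ℝ (Fin n)))] fun _ => ‖c‖ ^ 2 := by
    filter_upwards [coeFn_waveLp ξ c] with x hx
    rw [hx, norm_planeWave]
  rw [Lp_norm_sq_eq_integral, integral_congr_ae hnorm]
  simp

theorem integrable_L2 (u : L2 Ω d) :
    Integrable u (volume.restrict (Ω : Set (EuclideanSpace ℝ (Fin n)))) :=
  (Lp.memLp u).integrable one_le_two

theorem integrable_indicator_L2 (u : L2 Ω d) :
    Integrable ((Ω : Set (EuclideanSpace ℝ (Fin n))).indicator u) :=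
  (integrable_indicator_iff Ω.isOpen.measurableSet).2 (integrable_L2 u)

theorem continuous_ft (u : L2 Ω d) : Continuous (ft u) :=
  VectorFourier.fourierIntegral_continuous Real.continuous_fourierChar
    (L := innerₗ (EuclideanSpace ℝ (Fin n))) continuous_inner (integrable_indicator_L2 u)

theorem eq_zero_of_ft_eq_zero {u : L2 Ω d} (h : ∀ ξ, ft u ξ = 0) : u = 0 := by
  refine (Lp.eq_zero_iff_ae_eq_zero).2 ?_
  filter_upwards [ae_restrict_of_ae (ae_eq_zero_of_fourier_eq_zero (integrable_indicator_L2 u) h),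
    ae_restrict_mem Ω.isOpen.measurableSet] with x hx hxΩ
  rwa [Set.indicator_of_mem hxΩ] at hx

theorem inner_waveLp (ξ : EuclideanSpace ℝ (Fin n)) (c : EuclideanSpace ℂ (Fin d)) (u : L2 Ω d) :
    inner ℂ (waveLp Ω ξ c) u = inner ℂ c (ft u ξ) := by
  rw [ft_eq_setIntegral, L2.inner_def,
    ← integral_inner ((Real.fourierIntegral_convergent_iff ξ).2 (integrable_L2 u))]
  refine integral_congr_ae ?_
  filter_upwards [coeFn_waveLp ξ c] with x hx
  rw [hx, inner_planeWave]

theorem inner_waveLp_of_mem_graph_dirichletClosure (hB : FormClosable (smoothOp B Ω)) {u : L2 Ω m}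
    {w : L2 Ω l} (huw : (u, w) ∈ (dirichletClosure B Ω).graph) (ξ : EuclideanSpace ℝ (Fin n))
    (c : EuclideanSpace ℂ (Fin l)) :
    inner ℂ (waveLp Ω ξ c) w = inner ℂ c (symbol B ξ (ft u ξ)) := by
  rw [← ContinuousLinearMap.adjoint_inner_left, ← inner_waveLp]
  have hclosed : IsClosed {p : L2 Ω m × L2 Ω l | inner ℂ (waveLp Ω ξ c) p.2
      = inner ℂ (waveLp Ω ξ ((symbol B ξ).adjoint c)) p.1} :=
    isClosed_eq (by fun_prop) (by fun_prop)
  refine graph_dirichletClosure_subset hB hclosed (fun f hf hfΩ => ?_) huw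
  have hLfΩ : tsupport (applyOp B f) ⊆ Ω := (tsupport_applyOp_subset B f).trans hfΩ
  rw [Set.mem_ofPred_eq, inner_waveLp, inner_waveLp, ContinuousLinearMap.adjoint_inner_left,
    ft_toLp hf.memLp hfΩ, ft_toLp (hf.applyOp B).memLp hLfΩ, fourier_applyOp B hf]

/-- The inner products with a fixed `g` are controlled by the Fourier transform of `g`, so this is
the Riemann–Lebesgue lemma. -/
theorem tendsto_inner_waveLp {ξ : ℕ → EuclideanSpace ℝ (Fin n)}
    (hξ : Tendsto ξ atTop (cocompact _)) {c : ℕ → EuclideanSpace ℂ (Fin d)} {C : ℝ}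
    (hc : ∀ j, ‖c j‖ ≤ C) (g : L2 Ω d) :
    Tendsto (fun j => inner ℂ g (waveLp Ω (ξ j) (c j))) atTop (𝓝 0) := by
  have hft : Tendsto (fun j => ‖ft g (ξ j)‖) atTop (𝓝 0) :=
    tendsto_zero_iff_norm_tendsto_zero.1 ((tendsto_integral_exp_inner_smul_cocompact _).comp hξ)
  refine squeeze_zero_norm (fun j => ?_) (by simpa only [mul_zero] using hft.const_mul C)
  rw [← inner_conj_symm, RCLike.norm_conj, inner_waveLp]
  exact (norm_inner_le_norm _ _).trans (mul_le_mul_of_nonneg_right (hc j) (norm_nonneg _))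

end FiniteVolume

section LowSets

/-! ### Frequencies at which the symbol is small -/

variable {n m l : ℕ} {B : Coeffs n m l} {b : ℝ}

variable (B b) in
/-- The frequencies `ξ` at which `L(ξ)* L(ξ)` has an eigenvalue `≤ b`. -/
def lowSet : Set (EuclideanSpace ℝ (Fin n)) :=
  {ξ | ∃ c ≠ 0, ‖symbol B ξ c‖ ^ 2 ≤ b * ‖c‖ ^ 2}

variable (B b) in
/-- The frequencies `ξ` at which `L(ξ)* L(ξ)` has an eigenvalue `< b`. -/
def strictLowSet : Set (EuclideanSpace ℝ (Fin n)) :=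
  {ξ | ∃ c, ‖symbol B ξ c‖ ^ 2 < b * ‖c‖ ^ 2}

theorem strictLowSet_subset_lowSet : strictLowSet B b ⊆ lowSet B b := by
  rintro ξ ⟨c, hc⟩
  refine ⟨c, ?_, hc.le⟩
  rintro rfl
  simp at hc

theorem isOpen_strictLowSet : IsOpen (strictLowSet B b) := by
  simp only [strictLowSet, Set.ofPred_exists]
  exact isOpen_iUnion fun c =>
    isOpen_lt (((continuous_symbol B).clm_apply continuous_const).norm.pow 2) continuous_const

theorem mem_lowSet_iff_exists_norm_eq_one {ξ : EuclideanSpace ℝ (Fin n)} :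
    ξ ∈ lowSet B b ↔ ∃ c, ‖c‖ = 1 ∧ ‖symbol B ξ c‖ ^ 2 ≤ b := by
  constructor
  · rintro ⟨c, hc, hle⟩
    have hcpos : 0 < ‖c‖ := norm_pos_iff.2 hc
    refine ⟨((‖c‖⁻¹ : ℝ) : ℂ) • c, ?_, ?_⟩
    · rw [norm_smul, Complex.norm_real, norm_inv, norm_norm, inv_mul_cancel₀ hcpos.ne']
    · rw [map_smul, norm_smul, Complex.norm_real, norm_inv, norm_norm, mul_pow, inv_pow,
        inv_mul_le_iff₀ (by positivity)]
      linarith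
  · rintro ⟨c, hc, hle⟩
    exact ⟨c, norm_ne_zero_iff.1 (hc ▸ one_ne_zero), by rwa [hc, one_pow, mul_one]⟩

theorem isClosed_lowSet : IsClosed (lowSet B b) := by
  let C : Set (EuclideanSpace ℝ (Fin n) × Metric.sphere (0 : EuclideanSpace ℂ (Fin m)) 1) :=
    {p | ‖symbol B p.1 (p.2 : EuclideanSpace ℂ (Fin m))‖ ^ 2 ≤ b}
  have hC : IsClosed C :=
    isClosed_le ((((continuous_symbol B).comp continuous_fst).clm_apply
      (continuous_subtype_val.comp continuous_snd)).norm.pow 2) continuous_const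
  have himage : lowSet B b = Prod.fst '' C := by
    ext ξ
    rw [mem_lowSet_iff_exists_norm_eq_one]
    constructor
    · rintro ⟨c, hc, hle⟩
      exact ⟨(ξ, ⟨c, mem_sphere_zero_iff_norm.2 hc⟩), hle, rfl⟩
    · rintro ⟨⟨ξ', c⟩, hle, rfl⟩
      exact ⟨c, norm_eq_of_mem_sphere c, hle⟩
  rw [himage]
  exact isClosedMap_fst_of_compactSpace C hC

/-- Here `c` minimizes `‖S x‖²` on a sphere. -/
theorem adjoint_apply_eq_smul_of_norm_sq_le {E G : Type*} [NormedAddCommGroup E]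
    [InnerProductSpace ℂ E] [CompleteSpace E] [NormedAddCommGroup G] [InnerProductSpace ℂ G]
    [CompleteSpace G] {S : E →L[ℂ] G} {b : ℝ} (hge : ∀ x, b * ‖x‖ ^ 2 ≤ ‖S x‖ ^ 2) {c : E}
    (hle : ‖S c‖ ^ 2 ≤ b * ‖c‖ ^ 2) : S.adjoint (S c) = (b : ℂ) • c := by
  rcases eq_or_ne c 0 with rfl | hc
  · simp
  have hre : ∀ x, (S.adjoint ∘L S).reApplyInnerSelf x = ‖S x‖ ^ 2 := fun x => by
    rw [ContinuousLinearMap.reApplyInnerSelf_apply, ContinuousLinearMap.comp_apply,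
      ContinuousLinearMap.adjoint_inner_left, inner_self_eq_norm_sq]
  have hmin : IsMinOn (S.adjoint ∘L S).reApplyInnerSelf (Metric.sphere 0 ‖c‖) c := fun x hx => by
    rw [mem_sphere_zero_iff_norm] at hx
    rw [Set.mem_ofPred_eq, hre, hre]
    exact hle.trans (hx ▸ hge x)
  have hquot : (S.adjoint ∘L S).rayleighQuotient c = b := by
    rw [ContinuousLinearMap.rayleighQuotient, hre, le_antisymm hle (hge c),
      mul_div_cancel_right₀ _ (pow_ne_zero 2 (norm_ne_zero_iff.2 hc))]
  have h := IsSelfAdjoint.eq_smul_self_of_isLocalExtrOn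
    (ContinuousLinearMap.isPositive_adjoint_comp_self S).isSelfAdjoint (Or.inl hmin.localize)
  rwa [hquot] at h

theorem exists_adjoint_symbol_eq_smul {ξ : EuclideanSpace ℝ (Fin n)}
    (hξ : ξ ∈ lowSet B b \ strictLowSet B b) :
    ∃ c ≠ 0, (symbol B ξ).adjoint (symbol B ξ c) = (b : ℂ) • c := by
  obtain ⟨⟨c, hc, hle⟩, hnot⟩ := hξ
  exact ⟨c, hc, adjoint_apply_eq_smul_of_norm_sq_le (fun x => not_lt.1 fun h => hnot ⟨x, h⟩) hle⟩

theorem norm_sq_eq_of_adjoint_apply_eq_smul {E G : Type*} [NormedAddCommGroup E]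
    [InnerProductSpace ℂ E] [CompleteSpace E] [NormedAddCommGroup G] [InnerProductSpace ℂ G]
    [CompleteSpace G] {S : E →L[ℂ] G} {b : ℝ} {c : E} (hc : S.adjoint (S c) = (b : ℂ) • c) :
    ‖S c‖ ^ 2 = b * ‖c‖ ^ 2 := by
  apply Complex.ofReal_injective
  rw [Complex.ofReal_mul, ← inner_self_eq_ofReal, ← inner_self_eq_ofReal,
    ← ContinuousLinearMap.adjoint_inner_right, hc, inner_smul_right]

/-- The complement of a countable set is connected in dimension at least two, so it would lie in
`U` if it did not meet the boundary of `U`. -/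
theorem infinite_frontier {V : Type*} [NormedAddCommGroup V] [NormedSpace ℝ V]
    (hV : 1 < Module.rank ℝ V) {U : Set V} (hU : IsOpen U) (hne : U.Nonempty)
    (hbd : Bornology.IsBounded U) : (frontier U).Infinite := by
  intro hfin
  have hsub : (frontier U)ᶜ ⊆ U := by
    refine (hfin.countable.isConnected_compl_of_one_lt_rank hV).isPreconnected
      |>.subset_left_of_subset_union hU isClosed_closure.isOpen_compl
        (Set.disjoint_compl_right_iff_subset.2 subset_closure) (fun x hx => ?_) ?_
    · by_contra hxU
      rw [Set.mem_union, not_or, Set.notMem_compl_iff] at hxU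
      exact hx (hU.frontier_eq ▸ ⟨hxU.2, hxU.1⟩)
    · obtain ⟨x, hx⟩ := hne
      exact ⟨x, fun h => (hU.frontier_eq ▸ h).2 hx, hx⟩
  have hbounded : Bornology.IsBounded (Set.univ : Set V) := by
    rw [← Set.union_compl_self (frontier U)]
    exact hfin.isBounded.union (hbd.subset hsub)
  have : Nontrivial V := rank_pos_iff_nontrivial.1 (zero_lt_one.trans hV)
  exact NormedSpace.unbounded_univ ℝ _ hbounded

theorem infinite_lowSet_diff_of_volume_ne_zero (hn : 2 ≤ n)
    (hbd : Bornology.IsBounded (lowSet B b)) (h0 : volume (lowSet B b) ≠ 0) :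
    (lowSet B b \ strictLowSet B b).Infinite := by
  have hrank : 1 < Module.rank ℝ (EuclideanSpace ℝ (Fin n)) := by
    rw [← Module.finrank_eq_rank, finrank_euclideanSpace_fin]
    exact_mod_cast hn
  rcases (strictLowSet B b).eq_empty_or_nonempty with hempty | hne
  · rw [hempty, Set.sdiff_empty]
    intro hfin
    have : Nontrivial (EuclideanSpace ℝ (Fin n)) :=
      rank_pos_iff_nontrivial.1 (zero_lt_one.trans hrank)
    exact h0 (hfin.measure_zero _)
  · refine (infinite_frontier hrank isOpen_strictLowSet hne
      (hbd.subset strictLowSet_subset_lowSet)).mono ?_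
    rw [isOpen_strictLowSet.frontier_eq]
    exact Set.sdiff_subset_sdiff_left
      (closure_minimal strictLowSet_subset_lowSet isClosed_lowSet)

theorem analyticAt_symbol (ξ : EuclideanSpace ℝ (Fin n)) : AnalyticAt ℝ (symbol B) ξ := by
  have hfreq : ∀ i, AnalyticAt ℝ (fun η : EuclideanSpace ℝ (Fin n) => freq η i) ξ := fun i =>
    analyticAt_const.mul ((Complex.ofRealCLM.comp (EuclideanSpace.proj i)).analyticAt ξ)
  unfold symbol
  fun_prop

/-- The determinant of `L(ξ)* L(ξ) - b`. -/
def symbolDet (B : Coeffs n m l) (b : ℝ) (ξ : EuclideanSpace ℝ (Fin n)) : ℂ :=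
  LinearMap.det ((symbol B ξ).adjoint ∘L symbol B ξ - (b : ℂ) • .id ℂ _ :
    EuclideanSpace ℂ (Fin m) →L[ℂ] EuclideanSpace ℂ (Fin m)).toLinearMap

theorem symbolDet_eq_zero_iff {ξ : EuclideanSpace ℝ (Fin n)} :
    symbolDet B b ξ = 0 ↔ ∃ c ≠ 0, (symbol B ξ).adjoint (symbol B ξ c) = (b : ℂ) • c := by
  rw [symbolDet, LinearMap.det_eq_zero_iff_ker_ne_bot, Submodule.ne_bot_iff]
  refine exists_congr fun c => ?_
  rw [and_comm, LinearMap.mem_ker]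
  exact and_congr_right fun _ => sub_eq_zero

theorem analyticAt_symbolDet (ξ : EuclideanSpace ℝ (Fin n)) :
    AnalyticAt ℝ (symbolDet B b) ξ := by
  let e := EuclideanSpace.basisFun (Fin m) ℂ
  have hcol : ∀ j k, AnalyticAt ℝ (fun η => symbol B η (e j) k) ξ := fun j k =>
    (((EuclideanSpace.proj k).comp (ContinuousLinearMap.apply ℂ _ (e j))).restrictScalars ℝ
      |>.analyticAt _).comp (analyticAt_symbol ξ)
  have hconj : ∀ j k, AnalyticAt ℝ (fun η => starRingEnd ℂ (symbol B η (e j) k)) ξ := fun j k =>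
    (Complex.conjCLE.toContinuousLinearMap.analyticAt _).comp (hcol j k)
  have hentry : ∀ η i j, LinearMap.toMatrixOrthonormal e
      ((symbol B η).adjoint ∘L symbol B η - (b : ℂ) • .id ℂ _ :
        EuclideanSpace ℂ (Fin m) →L[ℂ] EuclideanSpace ℂ (Fin m)).toLinearMap i j
      = ∑ k, symbol B η (e j) k * starRingEnd ℂ (symbol B η (e i) k) - b * inner ℂ (e i) (e j) := by
    intro η i j
    rw [LinearMap.toMatrixOrthonormal_apply_apply]
    change inner ℂ (e i) ((symbol B η).adjoint (symbol B η (e j)) - (b : ℂ) • e j) = _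
    rw [inner_sub_right, ContinuousLinearMap.adjoint_inner_right, inner_smul_right,
      PiLp.inner_apply]
    rfl
  have hdet : symbolDet B b = fun η => Matrix.det (Matrix.of fun i j =>
      ∑ k, symbol B η (e j) k * starRingEnd ℂ (symbol B η (e i) k) - b * inner ℂ (e i) (e j)) := by
    funext η
    rw [symbolDet, ← LinearMap.det_toMatrix e.toBasis]
    exact congrArg Matrix.det (Matrix.ext (hentry η))
  simp only [hdet, Matrix.det_apply', Matrix.of_apply]
  fun_prop

/-- Otherwise the real analytic function `symbolDet B b` vanishes on an open set, hence everywhere,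
and every frequency belongs to `lowSet B b`. -/
theorem eq_zero_of_adjoint_symbol_eq_smul (hn : n ≠ 0) (hbd : Bornology.IsBounded (lowSet B b))
    {v : EuclideanSpace ℝ (Fin n) → EuclideanSpace ℂ (Fin m)} (hv : Continuous v)
    (h : ∀ ξ, (symbol B ξ).adjoint (symbol B ξ (v ξ)) = (b : ℂ) • v ξ) : v = 0 := by
  funext ξ
  by_contra hne
  have hlocal : symbolDet B b =ᶠ[𝓝 ξ] 0 := by
    filter_upwards [hv.continuousAt.eventually_ne hne] with η hη
    exact symbolDet_eq_zero_iff.2 ⟨_, hη, h η⟩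
  have hglobal := AnalyticOnNhd.eqOn_zero_of_preconnected_of_eventuallyEq_zero
    (fun η _ => analyticAt_symbolDet η) isPreconnected_univ (Set.mem_univ ξ) hlocal
  have huniv : lowSet B b = Set.univ := Set.eq_univ_of_forall fun η => by
    obtain ⟨c, hc, hcb⟩ := symbolDet_eq_zero_iff.1 (hglobal (Set.mem_univ η))
    exact ⟨c, hc, (norm_sq_eq_of_adjoint_apply_eq_smul hcb).le⟩
  have : Nontrivial (EuclideanSpace ℝ (Fin n)) := Module.nontrivial_of_finrank_pos (R := ℝ)
    (by rw [finrank_euclideanSpace_fin]; exact Nat.pos_of_ne_zero hn)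
  exact NormedSpace.unbounded_univ ℝ _ (huniv ▸ hbd)

end LowSets

section WaveIndependence

/-! ### Linear independence of plane waves -/

variable {n d : ℕ} {F : Type*} [NormedAddCommGroup F] [NormedSpace ℂ F]

/-- The plane wave `x ↦ exp (2πi⟨x, ξ⟩)` as a character of the additive group `ℝⁿ`. -/
def waveChar (ξ : EuclideanSpace ℝ (Fin n)) : Multiplicative (EuclideanSpace ℝ (Fin n)) →* ℂ where
  toFun x := planeWave ξ (1 : ℂ) x.toAdd
  map_one' := by simp [planeWave]
  map_mul' x y := by
    simp only [planeWave, toAdd_mul, inner_add_left, smul_eq_mul, mul_one, Complex.ofReal_add,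
      mul_add, Complex.exp_add]

theorem waveChar_eq_fourierChar (ξ x : EuclideanSpace ℝ (Fin n)) :
    waveChar ξ (Multiplicative.ofAdd x) = Real.fourierChar (inner ℝ x ξ) := by
  rw [Real.fourierChar_apply]
  change planeWave ξ (1 : ℂ) x = _
  rw [planeWave, smul_eq_mul, mul_one]
  push_cast
  ring_nf

theorem fourierChar_ne_one : Real.fourierChar ≠ 1 := by
  intro h
  have hhalf := Real.fourierChar_apply (1 / 2)
  rw [h, show ((2 * Real.pi * (1 / 2) : ℝ) : ℂ) * Complex.I = Real.pi * Complex.I by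
    push_cast; ring, Complex.exp_pi_mul_I] at hhalf
  norm_num at hhalf

theorem waveChar_injective : Function.Injective (waveChar (n := n)) := by
  intro ξ η h
  refine BoundedContinuousFunction.ext_of_char_eq Real.continuous_fourierChar
    fourierChar_ne_one (L := innerₗ (EuclideanSpace ℝ (Fin n))) continuous_inner
    (fun v hv hv0 => hv ?_) fun x => ?_
  · exact inner_self_eq_zero.1 (LinearMap.congr_fun hv0 v)
  · have := DFunLike.congr_fun h (Multiplicative.ofAdd x)
    rw [waveChar_eq_fourierChar, waveChar_eq_fourierChar, real_inner_comm, real_inner_comm η]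
      at this
    exact this

theorem analyticOnNhd_planeWave (ξ : EuclideanSpace ℝ (Fin n)) (c : F) :
    AnalyticOnNhd ℝ (planeWave ξ c) Set.univ := by
  intro x _
  have hphase : AnalyticAt ℝ (fun x : EuclideanSpace ℝ (Fin n) =>
      2 * (Real.pi : ℂ) * Complex.I * ((inner ℝ x ξ : ℝ) : ℂ)) x :=
    analyticAt_const.mul ((Complex.ofRealCLM.comp ((innerSL ℝ).flip ξ)).analyticAt x)
  exact ((analyticAt_cexp.restrictScalars (𝕜 := ℝ)).comp hphase).smul analyticAt_const

theorem linearIndependent_planeWave {S : Set (EuclideanSpace ℝ (Fin n))} {c : S → F}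
    (hc : ∀ ξ, c ξ ≠ 0) : LinearIndependent ℂ fun ξ : S =>
      planeWave (ξ : EuclideanSpace ℝ (Fin n)) (c ξ) := by
  refine linearIndependent_iff'.2 fun s g hg ξ₀ hξ₀ => ?_
  obtain ⟨φ, hφ⟩ : ∃ φ : Module.Dual ℂ F, φ (c ξ₀) ≠ 0 := by
    simpa using mt (Module.forall_dual_apply_eq_zero_iff ℂ (c ξ₀)).1 (hc ξ₀)
  have hchar : ∑ ξ ∈ s, (g ξ * φ (c ξ)) •
      (waveChar (ξ : EuclideanSpace ℝ (Fin n)) : Multiplicative _ → ℂ) = 0 := by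
    funext x
    have hx := congrArg φ (congrFun hg x.toAdd)
    simp only [Finset.sum_apply, Pi.smul_apply, map_sum, map_smul, planeWave, Pi.zero_apply,
      map_zero, smul_eq_mul] at hx
    simp only [Finset.sum_apply, Pi.smul_apply, Pi.zero_apply, smul_eq_mul, ← hx]
    refine Finset.sum_congr rfl fun ξ _ => ?_
    simp only [waveChar, planeWave, MonoidHom.coe_mk, OneHom.coe_mk, smul_eq_mul]
    ring
  have hli := (linearIndependent_monoidHom (Multiplicative (EuclideanSpace ℝ (Fin n))) ℂ).comp
    (fun ξ : S => waveChar (ξ : EuclideanSpace ℝ (Fin n)))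
    (waveChar_injective.comp Subtype.val_injective)
  exact (mul_eq_zero.1 (linearIndependent_iff'.1 hli s _ hchar ξ₀ hξ₀)).resolve_right hφ

theorem eq_zero_of_ae_restrict_eq_zero {f : EuclideanSpace ℝ (Fin n) → F}
    {U : Set (EuclideanSpace ℝ (Fin n))} (hU : IsOpen U) (hne : U.Nonempty)
    (hf : AnalyticOnNhd ℝ f Set.univ) (hae : f =ᵐ[volume.restrict U] 0) : f = 0 := by
  obtain ⟨x₀, hx₀⟩ := hne
  have hUzero : Set.EqOn f 0 U := Measure.eqOn_open_of_ae_eq hae hU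
    (hf.continuousOn.mono (Set.subset_univ _)) continuousOn_const
  exact funext fun x => hf.eqOn_zero_of_preconnected_of_eventuallyEq_zero isPreconnected_univ
    (Set.mem_univ x₀) (hUzero.eventuallyEq_of_mem (hU.mem_nhds hx₀)) (Set.mem_univ x)

variable {Ω : Opens (EuclideanSpace ℝ (Fin n))}
  [IsFiniteMeasure (volume.restrict (Ω : Set (EuclideanSpace ℝ (Fin n))))]

theorem sum_smul_waveLp_ae_eq {ι : Type*} (s : Finset ι) (g : ι → ℂ)
    (ξ : ι → EuclideanSpace ℝ (Fin n)) (c : ι → EuclideanSpace ℂ (Fin d)) :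
    (∑ i ∈ s, g i • waveLp Ω (ξ i) (c i) : L2 Ω d)
      =ᵐ[volume.restrict (Ω : Set (EuclideanSpace ℝ (Fin n)))]
        ∑ i ∈ s, g i • planeWave (ξ i) (c i) := by
  refine (Lp.coeFn_finsetSum s _).trans ?_
  have hterm : ∀ᵐ x ∂volume.restrict (Ω : Set (EuclideanSpace ℝ (Fin n))), ∀ i ∈ s,
      (g i • waveLp Ω (ξ i) (c i)) x = g i • planeWave (ξ i) (c i) x := by
    rw [Filter.eventually_all_finset]
    intro i _
    filter_upwards [Lp.coeFn_smul (g i) (waveLp Ω (ξ i) (c i)), coeFn_waveLp (ξ i) (c i)]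
      with x hsmul hwave
    rw [hsmul, Pi.smul_apply, hwave]
  filter_upwards [hterm] with x hx
  rw [Finset.sum_apply, Finset.sum_apply]
  exact Finset.sum_congr rfl hx

theorem linearIndependent_waveLp (hΩ : (Ω : Set (EuclideanSpace ℝ (Fin n))).Nonempty)
    {S : Set (EuclideanSpace ℝ (Fin n))} {c : S → EuclideanSpace ℂ (Fin d)} (hc : ∀ ξ, c ξ ≠ 0) :
    LinearIndependent ℂ fun ξ : S => waveLp Ω (ξ : EuclideanSpace ℝ (Fin n)) (c ξ) := by
  rw [linearIndependent_iff']
  intro s g hg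
  have hli := linearIndependent_planeWave hc
  refine linearIndependent_iff'.1 hli s g ?_
  refine eq_zero_of_ae_restrict_eq_zero Ω.isOpen hΩ (Finset.analyticOnNhd_sum s fun ξ _ =>
    (analyticOnNhd_planeWave _ _).const_smul) ?_
  have hsum := sum_smul_waveLp_ae_eq (Ω := Ω) s g (fun ξ => (ξ : EuclideanSpace ℝ (Fin n))) c
  rw [hg] at hsum
  exact hsum.symm.trans (Lp.coeFn_zero _ _ _)

theorem exists_waveLp_notMem (hΩ : (Ω : Set (EuclideanSpace ℝ (Fin n))).Nonempty)
    {S : Set (EuclideanSpace ℝ (Fin n))} (hS : S.Infinite) {c : S → EuclideanSpace ℂ (Fin d)}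
    (hc : ∀ ξ, c ξ ≠ 0) (X : Submodule ℂ (L2 Ω d)) [FiniteDimensional ℂ X] :
    ∃ ξ : S, waveLp Ω (ξ : EuclideanSpace ℝ (Fin n)) (c ξ) ∉ X := by
  by_contra! hmem
  have hli : LinearIndependent ℂ
      fun ξ : S => (⟨waveLp Ω (ξ : EuclideanSpace ℝ (Fin n)) (c ξ), hmem ξ⟩ : X) :=
    LinearIndependent.of_comp X.subtype (linearIndependent_waveLp hΩ hc)
  have : Finite S := hli.finite
  exact hS (Set.toFinite S)

end WaveIndependence

section FiniteVolumeBounds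

variable {n m l : ℕ} {B : Coeffs n m l} {Ω : Opens (EuclideanSpace ℝ (Fin n))}
  [IsFiniteMeasure (volume.restrict (Ω : Set (EuclideanSpace ℝ (Fin n))))]

theorem exists_volume_mul_norm_sq_eq_one (hΩ : (Ω : Set (EuclideanSpace ℝ (Fin n))).Nonempty) :
    ∃ a : ℂ, volume.real (Ω : Set (EuclideanSpace ℝ (Fin n))) * ‖a‖ ^ 2 = 1 := by
  have hfinite : volume (Ω : Set (EuclideanSpace ℝ (Fin n))) ≠ ⊤ := by
    rw [← Measure.restrict_apply_univ]
    exact measure_ne_top _ _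
  have hpos : 0 < volume.real (Ω : Set (EuclideanSpace ℝ (Fin n))) :=
    ENNReal.toReal_pos (Ω.isOpen.measure_pos volume hΩ).ne' hfinite
  refine ⟨((√(volume.real (Ω : Set (EuclideanSpace ℝ (Fin n)))))⁻¹ : ℝ), ?_⟩
  rw [Complex.norm_real, norm_inv, inv_pow, Real.norm_eq_abs, sq_abs, Real.sq_sqrt hpos.le,
    mul_inv_cancel₀ hpos.ne']

/-- Normalized plane waves with frequencies in `lowSet B b` tending to infinity would be a weakly
null sequence on which the form is at most `b`. -/
theorem isBounded_lowSet (hB : FormClosable (smoothOp B Ω))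
    (hΩ : (Ω : Set (EuclideanSpace ℝ (Fin n))).Nonempty) {b : ℝ} (hb0 : 0 ≤ b)
    (hb : (b : EReal) < essBottom (neumannOp B Ω)) : Bornology.IsBounded (lowSet B b) := by
  by_contra hunbounded
  have hfar : ∀ j : ℕ, ∃ ξ ∈ lowSet B b, (j : ℝ) < ‖ξ‖ := by
    intro j
    by_contra! h
    exact hunbounded (isBounded_iff_forall_norm_le.2 ⟨j, h⟩)
  choose ξ hξ hξj using hfar
  choose c hc hcb using fun j => mem_lowSet_iff_exists_norm_eq_one.1 (hξ j)
  have hξtop : Tendsto ξ atTop (cocompact _) := by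
    rw [← Metric.cobounded_eq_cocompact, ← comap_norm_atTop, tendsto_comap_iff]
    exact tendsto_atTop_mono (fun j => (hξj j).le) tendsto_natCast_atTop_atTop
  obtain ⟨a, ha⟩ := exists_volume_mul_norm_sq_eq_one hΩ
  refine not_weaklyNull_of_lt_essBottom (T := neumannClosure B Ω)
    hB.isClosable.closure_isClosed (dense_domain_neumannClosure hB) hb0 hb
    (u := fun j => waveLp Ω (ξ j) (a • c j))
    (w := fun j => waveLp Ω (ξ j) (symbol B (ξ j) (a • c j)))
    (fun j => waveLp_mem_graph _ _) (fun j => ?_) (fun ε hε => Frequently.of_forall fun j => ?_)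
    (tendsto_inner_waveLp hξtop (C := ‖a‖) fun j => by rw [norm_smul, hc, mul_one])
  · refine (pow_eq_one_iff_of_nonneg (norm_nonneg _) two_ne_zero).1 ?_
    rw [norm_waveLp_sq, norm_smul, hc, mul_one, ha]
  · rw [norm_waveLp_sq, map_smul, norm_smul, mul_pow, ← mul_assoc, ha, one_mul]
    linarith [hcb j]

/-- Testing the Neumann equation `A_N u = b u` against plane waves gives
`(L(ξ)* L(ξ) - b) û(ξ) = 0` for all `ξ`. -/
theorem eq_zero_of_dirichlet_of_neumann (hB : FormClosable (smoothOp B Ω)) (hn : n ≠ 0) {b : ℝ}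
    (hbd : Bornology.IsBounded (lowSet B b)) {u : L2 Ω m} {w : L2 Ω l}
    (huw : (u, w) ∈ (dirichletClosure B Ω).graph)
    (hu : u ∈ eigenspace (neumannOp B Ω) b) : u = 0 := by
  obtain ⟨w', hw', hform⟩ := mem_formGraph_iff.1
    ((mem_eigenspace_formOperator (dense_domain_neumannClosure hB)).1 hu)
  obtain rfl : w' = w := LinearPMap.mem_graph_snd_inj _ hw'
    (LinearPMap.le_graph_of_le (dirichletClosure_le_neumannClosure hB) huw) rfl
  have hft : ∀ ξ, (symbol B ξ).adjoint (symbol B ξ (ft u ξ)) = (b : ℂ) • ft u ξ := by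
    refine fun ξ => ext_inner_left ℂ fun c => ?_
    have hwave := hform _ _ (waveLp_mem_graph (B := B) (Ω := Ω) ξ c)
    rw [inner_smul_right, inner_waveLp, inner_waveLp_of_mem_graph_dirichletClosure hB huw] at hwave
    rw [ContinuousLinearMap.adjoint_inner_right, inner_smul_right, hwave]
  exact eq_zero_of_ft_eq_zero
    (congrFun (eq_zero_of_adjoint_symbol_eq_smul hn hbd (continuous_ft u) hft))

end FiniteVolumeBounds

/-! ### Slowly truncated plane waves -/

section CutWave

variable {n m l : ℕ} {F : Type*} [NormedAddCommGroup F] [NormedSpace ℂ F]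

/-- The truncated plane wave `φ(s x) exp (2πi⟨x, ξ⟩) c`. -/
def cutWave (φ : EuclideanSpace ℝ (Fin n) → ℂ) (s : ℝ) (ξ : EuclideanSpace ℝ (Fin n)) (c : F) :
    EuclideanSpace ℝ (Fin n) → F :=
  fun x => φ (s • x) • planeWave ξ c x

variable {φ : EuclideanSpace ℝ (Fin n) → ℂ} {ξ : EuclideanSpace ℝ (Fin n)}

theorem contDiff_cutWave (hφ : ContDiff ℝ ∞ φ) (s : ℝ) (ξ : EuclideanSpace ℝ (Fin n)) (c : F) :
    ContDiff ℝ ∞ (cutWave φ s ξ c) :=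
  (hφ.comp (contDiff_id.const_smul s)).smul (contDiff_planeWave ξ c)

theorem isTest_cutWave (hφ : IsTest φ) {s : ℝ} (hs : s ≠ 0) (ξ : EuclideanSpace ℝ (Fin n))
    (c : F) : IsTest (cutWave φ s ξ c) where
  contDiff := contDiff_cutWave hφ.contDiff s ξ c
  hasCompactSupport := (hφ.hasCompactSupport.comp_smul hs).smul_right

theorem norm_cutWave (φ : EuclideanSpace ℝ (Fin n) → ℂ) (s : ℝ) (ξ : EuclideanSpace ℝ (Fin n))
    (c : F) (x : EuclideanSpace ℝ (Fin n)) : ‖cutWave φ s ξ c x‖ = ‖φ (s • x)‖ * ‖c‖ := by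
  rw [cutWave, norm_smul, norm_planeWave]

theorem symbol_cutWave (B : Coeffs n m l) (φ : EuclideanSpace ℝ (Fin n) → ℂ) (s : ℝ)
    (ξ : EuclideanSpace ℝ (Fin n)) (c : EuclideanSpace ℂ (Fin m)) (x : EuclideanSpace ℝ (Fin n)) :
    symbol B ξ (cutWave φ s ξ c x) = cutWave φ s ξ (symbol B ξ c) x := by
  simp only [cutWave, planeWave, map_smul]

theorem pderiv_cutWave (hφ : ContDiff ℝ ∞ φ) (s : ℝ) (ξ : EuclideanSpace ℝ (Fin n)) (c : F)
    (i : Fin n) : pderiv i (cutWave φ s ξ c)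
      = freq ξ i • cutWave φ s ξ c + (s : ℂ) • cutWave (pderiv i φ) s ξ c := by
  funext x
  have hφs : HasFDerivAt (fun x => φ (s • x)) ((fderiv ℝ φ (s • x)).comp
      (s • ContinuousLinearMap.id ℝ (EuclideanSpace ℝ (Fin n)))) x :=
    (hφ.differentiable (by simp) (s • x)).hasFDerivAt.comp x ((hasFDerivAt_id x).const_smul s)
  have hwave : fderiv ℝ (planeWave ξ c) x (EuclideanSpace.single i 1)
      = freq ξ i • planeWave ξ c x := by
    rw [← pderiv, pderiv_planeWave, planeWave, planeWave, smul_comm]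
  have hcut : fderiv ℝ (cutWave φ s ξ c) x = _ :=
    (hφs.smul ((contDiff_planeWave ξ c).differentiable (by simp) x).hasFDerivAt).fderiv
  rw [pderiv, hcut]
  simp only [_root_.add_apply, _root_.smul_apply, ContinuousLinearMap.smulRight_apply, hwave,
    ContinuousLinearMap.comp_apply, ContinuousLinearMap.id_apply, map_smul, Pi.add_apply,
    Pi.smul_apply, cutWave, pderiv]
  rw [smul_comm (φ (s • x)), ← Complex.coe_smul, smul_eq_mul, mul_smul]

theorem IsTest.exists_norm_le {f : EuclideanSpace ℝ (Fin n) → F} (hf : IsTest f) :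
    ∃ C, ∀ x, ‖f x‖ ≤ C :=
  hf.contDiff.continuous.bounded_above_of_compact_support hf.hasCompactSupport

/-- `D` acts on the plane wave `exp (2πi⟨x, ξ⟩) c`, truncated at scale `1 / s`, like multiplication
by `z`, up to an error which is `O(s)` uniformly in `x`. -/
def ActsOnCutWave (ξ : EuclideanSpace ℝ (Fin n)) (c : F)
    (D : (EuclideanSpace ℝ (Fin n) → F) → (EuclideanSpace ℝ (Fin n) → F)) (z : ℂ) : Prop :=
  ∀ φ : EuclideanSpace ℝ (Fin n) → ℂ, IsTest φ → ∃ C, 0 ≤ C ∧ ∀ s : ℝ, 0 ≤ s → s ≤ 1 → ∀ x,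
    ‖D (cutWave φ s ξ c) x - z • cutWave φ s ξ c x‖ ≤ C * s

theorem GoodOn.map_smul_add_smul {Ω : Opens (EuclideanSpace ℝ (Fin n))}
    {D : (EuclideanSpace ℝ (Fin n) → F) → (EuclideanSpace ℝ (Fin n) → F)} (hD : GoodOn Ω D)
    {f g : EuclideanSpace ℝ (Fin n) → F} (a b : ℂ) (hf : ContDiffOn ℝ ∞ f Ω)
    (hg : ContDiffOn ℝ ∞ g Ω) {x : EuclideanSpace ℝ (Fin n)} (hx : x ∈ Ω) :
    D (a • f + b • g) x = a • D f x + b • D g x :=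
  (hD.2.1 _ _ (hf.const_smul a) (hg.const_smul b) hx).trans
    (congrArg₂ (· + ·) (hD.2.2.1 a f hf hx) (hD.2.2.1 b g hg hx))

theorem ActsOnCutWave.comp_pderiv {c : F} {z : ℂ}
    {D : (EuclideanSpace ℝ (Fin n) → F) → (EuclideanSpace ℝ (Fin n) → F)}
    (h : ActsOnCutWave ξ c D z) (hD : GoodOn ⊤ D) (i : Fin n) :
    ActsOnCutWave ξ c (fun f => D (pderiv i f)) (z * freq ξ i) := by
  intro φ hφ
  obtain ⟨C, hC0, hC⟩ := h φ hφ
  obtain ⟨C', hC0', hC'⟩ := h _ (hφ.pderiv i)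
  obtain ⟨M, hM⟩ := (hφ.pderiv i).exists_norm_le
  have hM0 : 0 ≤ M := (norm_nonneg _).trans (hM 0)
  refine ⟨‖freq ξ i‖ * C + (C' + ‖z‖ * (M * ‖c‖)), by positivity, fun s hs0 hs1 x => ?_⟩
  have hexpand : D (pderiv i (cutWave φ s ξ c)) x
      = freq ξ i • D (cutWave φ s ξ c) x + (s : ℂ) • D (cutWave (pderiv i φ) s ξ c) x := by
    rw [pderiv_cutWave hφ.contDiff]
    exact hD.map_smul_add_smul _ _ (contDiff_cutWave hφ.contDiff s ξ c).contDiffOn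
      (contDiff_cutWave (hφ.pderiv i).contDiff s ξ c).contDiffOn (Set.mem_univ x)
  have hsplit : D (pderiv i (cutWave φ s ξ c)) x - (z * freq ξ i) • cutWave φ s ξ c x
      = freq ξ i • (D (cutWave φ s ξ c) x - z • cutWave φ s ξ c x)
        + (s : ℂ) • ((D (cutWave (pderiv i φ) s ξ c) x - z • cutWave (pderiv i φ) s ξ c x)
          + z • cutWave (pderiv i φ) s ξ c x) := by
    rw [hexpand]
    module
  have hderiv : ‖z • cutWave (pderiv i φ) s ξ c x‖ ≤ ‖z‖ * (M * ‖c‖) := by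
    rw [norm_smul, norm_cutWave]
    gcongr
    exact hM _
  have hC's : C' * s ≤ C' := mul_le_of_le_one_right hC0' hs1
  calc _ ≤ ‖freq ξ i‖ * (C * s) + s * (C' * s + ‖z‖ * (M * ‖c‖)) := by
        rw [hsplit]
        refine (norm_add_le _ _).trans ?_
        rw [norm_smul, norm_smul, Complex.norm_real, Real.norm_of_nonneg hs0]
        gcongr
        · exact hC s hs0 hs1 x
        · exact (norm_add_le _ _).trans (add_le_add (hC' s hs0 hs1 x) hderiv)
    _ ≤ ‖freq ξ i‖ * (C * s) + s * (C' + ‖z‖ * (M * ‖c‖)) := by gcongr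
    _ = _ := by ring

theorem actsOnCutWave_multiDeriv (ξ : EuclideanSpace ℝ (Fin n)) (c : F) (α : Fin n →₀ ℕ) :
    ActsOnCutWave ξ c (multiDeriv α) (∏ i, freq ξ i ^ α i) :=
  (multiDeriv_induction (P := fun D z => GoodOn ⊤ D ∧ ActsOnCutWave ξ c D z)
    ⟨GoodOn.id, fun _ _ => ⟨0, le_rfl, by simp⟩⟩
    (fun i _ _ h => ⟨h.1.comp (goodOn_pderiv i), h.2.comp_pderiv h.1 i⟩) α).2

theorem norm_applyOp_cutWave_sub_le (B : Coeffs n m l) (hφ : IsTest φ)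
    (ξ : EuclideanSpace ℝ (Fin n)) (c : EuclideanSpace ℂ (Fin m)) :
    ∃ C, ∀ s : ℝ, 0 ≤ s → s ≤ 1 → ∀ x,
      ‖applyOp B (cutWave φ s ξ c) x - cutWave φ s ξ (symbol B ξ c) x‖ ≤ C * s := by
  choose C _ hC using fun α => actsOnCutWave_multiDeriv ξ c α φ hφ
  refine ⟨∑ α ∈ B.support, ‖(B α).toEuclideanLin.toContinuousLinearMap‖ * C α,
    fun s hs0 hs1 x => ?_⟩
  rw [applyOp, ← symbol_cutWave, symbol_apply, ← Finset.sum_sub_distrib, Finset.sum_mul]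
  refine norm_sum_le_of_le _ fun α _ => ?_
  rw [← map_sub, mul_assoc]
  exact ((B α).toEuclideanLin.toContinuousLinearMap.le_opNorm _).trans
    (mul_le_mul_of_nonneg_left (hC α s hs0 hs1 x) (norm_nonneg _))

theorem norm_sq_applyOp_cutWave_le {B : Coeffs n m l} (hφ : IsTest φ) {b : ℝ}
    {c : EuclideanSpace ℂ (Fin m)} (hc : ‖symbol B ξ c‖ ^ 2 ≤ b * ‖c‖ ^ 2) :
    ∃ C, 0 ≤ C ∧ ∀ s : ℝ, 0 ≤ s → s ≤ 1 → ∀ x, ‖applyOp B (cutWave φ s ξ c) x‖ ^ 2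
      ≤ (1 + s) * b * ‖cutWave φ s ξ c x‖ ^ 2 + C * s := by
  obtain ⟨C, hC⟩ := norm_applyOp_cutWave_sub_le B hφ ξ c
  refine ⟨2 * C ^ 2, by positivity, fun s hs0 hs1 x => ?_⟩
  set p := ‖cutWave φ s ξ (symbol B ξ c) x‖ with hp
  have hsymbol : p ^ 2 ≤ b * ‖cutWave φ s ξ c x‖ ^ 2 := by
    rw [hp, norm_cutWave, norm_cutWave, mul_pow, mul_pow, mul_left_comm]
    gcongr
  have hnorm : ‖applyOp B (cutWave φ s ξ c) x‖ ≤ p + C * s := by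
    linarith [norm_sub_norm_le (applyOp B (cutWave φ s ξ c) x)
      (cutWave φ s ξ (symbol B ξ c) x), hC s hs0 hs1 x]
  have hcross : 0 ≤ s * (p - C) ^ 2 := by positivity
  have hrest : 0 ≤ C ^ 2 * s * (1 - s) := mul_nonneg (by positivity) (by linarith)
  calc ‖applyOp B (cutWave φ s ξ c) x‖ ^ 2 ≤ (p + C * s) ^ 2 := by gcongr
    _ ≤ (1 + s) * p ^ 2 + 2 * C ^ 2 * s := by linarith
    _ ≤ (1 + s) * (b * ‖cutWave φ s ξ c x‖ ^ 2) + 2 * C ^ 2 * s := by gcongr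
    _ = _ := by ring

end CutWave

section BallVolume

variable {n : ℕ} (Ω : Opens (EuclideanSpace ℝ (Fin n)))

/-- The volume of the part of `Ω` in the ball of radius `r` about the origin. -/
def ballVolume (r : ℝ) : ℝ :=
  (volume.restrict (Ω : Set (EuclideanSpace ℝ (Fin n)))).real (Metric.closedBall 0 r)

theorem restrict_closedBall_ne_top (r : ℝ) :
    volume.restrict (Ω : Set (EuclideanSpace ℝ (Fin n))) (Metric.closedBall 0 r) ≠ ⊤ :=
  ((Measure.restrict_apply_le _ _).trans_lt measure_closedBall_lt_top).ne

theorem integrable_indicator_closedBall (r : ℝ) :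
    Integrable ((Metric.closedBall 0 r).indicator (1 : EuclideanSpace ℝ (Fin n) → ℝ))
      (volume.restrict (Ω : Set (EuclideanSpace ℝ (Fin n)))) :=
  (integrable_indicator_iff measurableSet_closedBall).2
    (integrableOn_const (restrict_closedBall_ne_top Ω r))

theorem ballVolume_two_pow_le (j : ℕ) :
    ballVolume Ω (2 ^ j) ≤
      volume.real (Metric.closedBall (0 : EuclideanSpace ℝ (Fin n)) 1) * (2 ^ n) ^ j := by
  calc ballVolume Ω (2 ^ j)
      ≤ volume.real (Metric.closedBall (0 : EuclideanSpace ℝ (Fin n)) (2 ^ j)) :=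
        ENNReal.toReal_mono measure_closedBall_lt_top.ne (Measure.restrict_apply_le _ _)
    _ = _ := by
        rw [measureReal_def, Measure.addHaar_closedBall' _ _ (by positivity), ENNReal.toReal_mul,
          ENNReal.toReal_ofReal (by positivity), finrank_euclideanSpace_fin, ← pow_mul, ← pow_mul,
          mul_comm j n, mul_comm, measureReal_def]

variable {Ω}

theorem tendsto_ballVolume (hΩ : volume (Ω : Set (EuclideanSpace ℝ (Fin n))) = ⊤) :
    Tendsto (fun j : ℕ => ballVolume Ω (2 ^ j)) atTop atTop := by
  have hmono : Monotone fun j : ℕ => Metric.closedBall (0 : EuclideanSpace ℝ (Fin n)) (2 ^ j) :=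
    fun i j hij => Metric.closedBall_subset_closedBall (pow_le_pow_right₀ one_le_two hij)
  have hlim := tendsto_measure_iUnion_atTop
    (μ := volume.restrict (Ω : Set (EuclideanSpace ℝ (Fin n)))) hmono
  have hcover : (⋃ j : ℕ, Metric.closedBall (0 : EuclideanSpace ℝ (Fin n)) (2 ^ j)) = Set.univ := by
    refine Set.eq_univ_of_forall fun x => Set.mem_iUnion.2 ?_
    obtain ⟨j, hj⟩ := pow_unbounded_of_one_lt ‖x‖ (one_lt_two : (1 : ℝ) < 2)
    exact ⟨j, by simpa using hj.le⟩
  rw [hcover, Measure.restrict_apply_univ, hΩ] at hlim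
  refine tendsto_atTop.2 fun C => ?_
  filter_upwards [hlim.eventually (lt_mem_nhds (ENNReal.ofReal_lt_top (r := C)))] with j hj
  exact (ENNReal.ofReal_le_iff_le_toReal (restrict_closedBall_ne_top Ω _)).1 hj.le

end BallVolume

section CutWaveLp

variable {n m l : ℕ} {B : Coeffs n m l} {Ω : Opens (EuclideanSpace ℝ (Fin n))}

/-- A smooth function equal to `1` on the unit ball and supported in the ball of radius `2`. -/
def cutoff (n : ℕ) (x : EuclideanSpace ℝ (Fin n)) : ℂ :=
  ((⟨1, 2, one_pos, one_lt_two⟩ : ContDiffBump (0 : EuclideanSpace ℝ (Fin n))) x : ℝ)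

theorem isTest_cutoff (n : ℕ) : IsTest (cutoff n) where
  contDiff := Complex.ofRealCLM.contDiff.comp (ContDiffBump.contDiff _)
  hasCompactSupport := (ContDiffBump.hasCompactSupport _).comp_left (g := Complex.ofReal) rfl

theorem norm_cutoff_le_one (x : EuclideanSpace ℝ (Fin n)) : ‖cutoff n x‖ ≤ 1 := by
  rw [cutoff, Complex.norm_real, Real.norm_of_nonneg (ContDiffBump.nonneg _)]
  exact ContDiffBump.le_one _

theorem cutoff_eq_one {x : EuclideanSpace ℝ (Fin n)} (hx : ‖x‖ ≤ 1) : cutoff n x = 1 := by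
  rw [cutoff, ContDiffBump.one_of_mem_closedBall _ (by simpa using hx), Complex.ofReal_one]

theorem tsupport_cutoff_subset (n : ℕ) :
    tsupport (cutoff n) ⊆ Metric.closedBall 0 2 := by
  refine closure_minimal (fun x hx => by_contra fun hxb => hx ?_) Metric.isClosed_closedBall
  rw [mem_closedBall_zero_iff, not_le] at hxb
  rw [cutoff, ContDiffBump.zero_of_le_dist _ (by simpa using hxb.le), Complex.ofReal_zero]

/-- The plane wave `exp (2πi⟨x, ξ⟩) c`, truncated between the radii `2 ^ j` and `2 ^ (j + 1)`. -/
def dyadicWave (j : ℕ) (ξ : EuclideanSpace ℝ (Fin n)) (c : EuclideanSpace ℂ (Fin m)) :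
    EuclideanSpace ℝ (Fin n) → EuclideanSpace ℂ (Fin m) :=
  cutWave (cutoff n) (2 ^ j)⁻¹ ξ c

theorem isTest_dyadicWave (j : ℕ) (ξ : EuclideanSpace ℝ (Fin n)) (c : EuclideanSpace ℂ (Fin m)) :
    IsTest (dyadicWave j ξ c) :=
  isTest_cutWave (isTest_cutoff n) (by positivity) ξ c

theorem norm_dyadicWave_le (j : ℕ) (ξ : EuclideanSpace ℝ (Fin n)) (c : EuclideanSpace ℂ (Fin m))
    (x : EuclideanSpace ℝ (Fin n)) : ‖dyadicWave j ξ c x‖ ≤ ‖c‖ := by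
  rw [dyadicWave, norm_cutWave]
  exact mul_le_of_le_one_left (norm_nonneg c) (norm_cutoff_le_one _)

theorem norm_inv_two_pow_smul (j : ℕ) (x : EuclideanSpace ℝ (Fin n)) :
    ‖((2 : ℝ) ^ j)⁻¹ • x‖ = ‖x‖ / 2 ^ j := by
  rw [norm_smul, norm_inv, norm_pow, Real.norm_two, inv_mul_eq_div]

theorem norm_dyadicWave {j : ℕ} {x : EuclideanSpace ℝ (Fin n)}
    (hx : x ∈ Metric.closedBall 0 (2 ^ j)) (ξ : EuclideanSpace ℝ (Fin n))
    (c : EuclideanSpace ℂ (Fin m)) : ‖dyadicWave j ξ c x‖ = ‖c‖ := by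
  rw [mem_closedBall_zero_iff] at hx
  have hunit : ‖((2 : ℝ) ^ j)⁻¹ • x‖ ≤ 1 := by
    rwa [norm_inv_two_pow_smul, div_le_one (by positivity)]
  rw [dyadicWave, norm_cutWave, cutoff_eq_one hunit, norm_one, one_mul]

theorem tsupport_dyadicWave_subset (j : ℕ) (ξ : EuclideanSpace ℝ (Fin n))
    (c : EuclideanSpace ℂ (Fin m)) :
    tsupport (dyadicWave j ξ c) ⊆ Metric.closedBall 0 (2 ^ (j + 1)) := by
  refine closure_minimal (fun x hx => ?_) Metric.isClosed_closedBall
  have hcutoff : cutoff n (((2 : ℝ) ^ j)⁻¹ • x) ≠ 0 := left_ne_zero_of_smul hx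
  have hball := tsupport_cutoff_subset n (subset_tsupport _ hcutoff)
  rwa [mem_closedBall_zero_iff, norm_inv_two_pow_smul, div_le_iff₀ (by positivity), ← pow_succ',
    ← mem_closedBall_zero_iff] at hball

theorem norm_sq_applyOp_dyadicWave_le {b : ℝ} (hb0 : 0 ≤ b) {ξ : EuclideanSpace ℝ (Fin n)}
    {c : EuclideanSpace ℂ (Fin m)} (hc : ‖symbol B ξ c‖ ^ 2 ≤ b * ‖c‖ ^ 2) :
    ∃ C, 0 ≤ C ∧ ∀ (j : ℕ) x, ‖applyOp B (dyadicWave j ξ c) x‖ ^ 2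
      ≤ (1 + (2 ^ j)⁻¹) * b * ‖dyadicWave j ξ c x‖ ^ 2
        + C * (2 ^ j)⁻¹ * (Metric.closedBall 0 (2 ^ (j + 1))).indicator 1 x := by
  obtain ⟨C, hC0, hC⟩ := norm_sq_applyOp_cutWave_le (isTest_cutoff n) hc
  refine ⟨C, hC0, fun j x => ?_⟩
  by_cases hx : x ∈ Metric.closedBall 0 (2 ^ (j + 1))
  · rw [Set.indicator_of_mem hx, Pi.one_apply, mul_one]
    exact hC _ (by positivity) (inv_le_one_of_one_le₀ (one_le_pow₀ one_le_two)) x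
  · rw [Set.indicator_of_notMem hx, image_eq_zero_of_notMem_tsupport fun h =>
      hx (tsupport_dyadicWave_subset j ξ c (tsupport_applyOp_subset B _ h)), norm_zero,
      zero_pow two_ne_zero]
    positivity

variable (Ω) in
/-- The restriction of `dyadicWave` to `Ω` as an element of `L₂(Ω, ℂ^m)`. -/
def dyadicWaveLp (j : ℕ) (ξ : EuclideanSpace ℝ (Fin n)) (c : EuclideanSpace ℂ (Fin m)) : L2 Ω m :=
  ((isTest_dyadicWave j ξ c).memLp.restrict Ω).toLp _

theorem norm_sq_toLp {E F : Type*} [MeasurableSpace E] {μ : Measure E} [NormedAddCommGroup F]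
    [InnerProductSpace ℂ F] {f : E → F} (hf : MemLp f 2 μ) :
    ‖hf.toLp f‖ ^ 2 = ∫ x, ‖f x‖ ^ 2 ∂μ := by
  rw [Lp_norm_sq_eq_integral]
  refine integral_congr_ae ?_
  filter_upwards [hf.coeFn_toLp] with x hx
  rw [hx]

theorem ballVolume_le_norm_sq_dyadicWaveLp (j : ℕ) (ξ : EuclideanSpace ℝ (Fin n))
    {c : EuclideanSpace ℂ (Fin m)} (hc : ‖c‖ = 1) :
    ballVolume Ω (2 ^ j) ≤ ‖dyadicWaveLp Ω j ξ c‖ ^ 2 := by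
  have hf := (isTest_dyadicWave j ξ c).memLp.restrict Ω
  rw [dyadicWaveLp, norm_sq_toLp, ballVolume, ← integral_indicator_one measurableSet_closedBall]
  refine integral_mono (integrable_indicator_closedBall Ω _)
    ((memLp_two_iff_integrable_sq_norm hf.1).1 hf) fun x => ?_
  by_cases hx : x ∈ Metric.closedBall 0 (2 ^ j)
  · simp [hx, norm_dyadicWave hx, hc]
  · rw [Set.indicator_of_notMem hx]
    positivity

theorem exists_dyadicWaveLp_mem_graph (B : Coeffs n m l) (Ω : Opens (EuclideanSpace ℝ (Fin n)))
    {b : ℝ} (hb0 : 0 ≤ b) {ξ : EuclideanSpace ℝ (Fin n)} {c : EuclideanSpace ℂ (Fin m)}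
    (hc : ‖symbol B ξ c‖ ^ 2 ≤ b * ‖c‖ ^ 2) :
    ∃ C, 0 ≤ C ∧ ∃ w : ℕ → L2 Ω l, ∀ j, (dyadicWaveLp Ω j ξ c, w j) ∈ (neumannClosure B Ω).graph ∧
      ‖w j‖ ^ 2 ≤ (1 + (2 ^ j)⁻¹) * b * ‖dyadicWaveLp Ω j ξ c‖ ^ 2
        + C * (2 ^ j)⁻¹ * ballVolume Ω (2 ^ (j + 1)) := by
  obtain ⟨C, hC0, hC⟩ := norm_sq_applyOp_dyadicWave_le hb0 hc
  have hf : ∀ j, MemLp (dyadicWave j ξ c) 2 (volume.restrict Ω) :=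
    fun j => (isTest_dyadicWave j ξ c).memLp.restrict Ω
  have hLf : ∀ j, MemLp (applyOp B (dyadicWave j ξ c)) 2 (volume.restrict Ω) :=
    fun j => ((isTest_dyadicWave j ξ c).applyOp B).memLp.restrict Ω
  refine ⟨C, hC0, fun j => (hLf j).toLp _, fun j => ⟨LinearPMap.le_graph_of_le
    (LinearPMap.le_closure _) (toLp_mem_graph_smoothOp (isTest_dyadicWave j ξ c).contDiff _ _), ?_⟩⟩
  have hfint := ((memLp_two_iff_integrable_sq_norm (hf j).1).1 (hf j)).const_mul
    ((1 + (2 ^ j)⁻¹) * b)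
  have hball := (integrable_indicator_closedBall Ω (2 ^ (j + 1))).const_mul (C * (2 ^ j)⁻¹)
  rw [dyadicWaveLp, norm_sq_toLp, norm_sq_toLp, ballVolume,
    ← integral_indicator_one measurableSet_closedBall, ← integral_const_mul, ← integral_const_mul,
    ← integral_add hfint hball]
  exact integral_mono ((memLp_two_iff_integrable_sq_norm (hLf j).1).1 (hLf j)) (hfint.add hball)
    fun x => hC j x

theorem norm_inner_dyadicWaveLp_le {g : L2 Ω m}
    (hg : Integrable g (volume.restrict (Ω : Set (EuclideanSpace ℝ (Fin n))))) (j : ℕ)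
    (ξ : EuclideanSpace ℝ (Fin n)) (c : EuclideanSpace ℂ (Fin m)) :
    ‖inner ℂ g (dyadicWaveLp Ω j ξ c)‖ ≤ ∫ x in Ω, ‖g x‖ * ‖c‖ := by
  rw [L2.inner_def]
  refine norm_integral_le_of_norm_le (hg.norm.mul_const _) ?_
  filter_upwards [((isTest_dyadicWave j ξ c).memLp.restrict Ω).coeFn_toLp] with x hx
  refine (norm_inner_le_norm _ _).trans (mul_le_mul_of_nonneg_left ?_ (norm_nonneg _))
  rw [dyadicWaveLp, hx]
  exact norm_dyadicWave_le j ξ c x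

end CutWaveLp

/-! ### Domains of infinite volume -/

section Doubling

theorem frequently_le_two_mul_of_le_mul_pow {a : ℕ → ℝ} {κ q : ℝ} (hq : 0 < q)
    (ha : ∀ j, a j ≤ κ * q ^ j) (hpos : ∀ᶠ j in atTop, 0 < a j) :
    ∃ᶠ j in atTop, a (j + 1) ≤ 2 * q * a j := by
  intro hnot
  obtain ⟨N, hN⟩ := eventually_atTop.1 (hnot.and hpos)
  have hgrow : ∀ i, (2 * q) ^ i * a N ≤ a (N + i) := by
    intro i
    induction i with
    | zero => simp
    | succ i ih =>
      calc (2 * q) ^ (i + 1) * a N = 2 * q * ((2 * q) ^ i * a N) := by ring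
        _ ≤ 2 * q * a (N + i) := by gcongr
        _ ≤ a (N + (i + 1)) := (not_le.1 (hN (N + i) (Nat.le_add_right N i)).1).le
  have hbounded : ∀ i, (2 : ℝ) ^ i ≤ κ * q ^ N / a N := by
    intro i
    rw [le_div_iff₀ (hN N le_rfl).2]
    refine le_of_mul_le_mul_right ?_ (pow_pos hq i)
    calc 2 ^ i * a N * q ^ i = (2 * q) ^ i * a N := by ring
      _ ≤ κ * q ^ (N + i) := (hgrow i).trans (ha (N + i))
      _ = κ * q ^ N * q ^ i := by ring
  obtain ⟨i, hi⟩ := pow_unbounded_of_one_lt (κ * q ^ N / a N) (one_lt_two : (1 : ℝ) < 2)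
  exact (hbounded i).not_gt hi

theorem frequently_le_add_mul_of_le_mul_pow {a x y s : ℕ → ℝ} {b C κ q : ℝ} (hq : 0 < q)
    (ha : ∀ j, a j ≤ κ * q ^ j) (hpos : ∀ᶠ j in atTop, 0 < a j) (hax : ∀ j, a j ≤ x j)
    (hs0 : ∀ j, 0 ≤ s j) (hs : Tendsto s atTop (𝓝 0)) (hC : 0 ≤ C)
    (hy : ∀ j, y j ≤ (1 + s j) * b * x j + C * s j * a (j + 1)) {ε : ℝ} (hε : 0 < ε) :
    ∃ᶠ j in atTop, y j ≤ (b + ε) * x j := by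
  have hsmall : ∀ᶠ j in atTop, s j * (b + C * (2 * q)) < ε := by
    have hlim := hs.mul_const (b + C * (2 * q))
    rw [zero_mul] at hlim
    exact hlim.eventually (gt_mem_nhds hε)
  refine ((frequently_le_two_mul_of_le_mul_pow hq ha hpos).and_eventually
    (hsmall.and hpos)).mono ?_
  rintro j ⟨hdouble, hεj, haj⟩
  have hx : 0 ≤ x j := haj.le.trans (hax j)
  have hsj : 0 ≤ C * s j := mul_nonneg hC (hs0 j)
  calc y j ≤ (1 + s j) * b * x j + C * s j * a (j + 1) := hy j
    _ ≤ (1 + s j) * b * x j + C * s j * (2 * q * x j) := by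
        gcongr
        exact hdouble.trans (mul_le_mul_of_nonneg_left (hax j) (by positivity))
    _ = (b + s j * (b + C * (2 * q))) * x j := by ring
    _ ≤ (b + ε) * x j := by gcongr

end Doubling

section Weyl

variable {H K : Type*} [NormedAddCommGroup H] [InnerProductSpace ℂ H] [NormedAddCommGroup K]
  [InnerProductSpace ℂ K]

theorem tendsto_inner_of_dense {S : Set H} (hS : Dense S) {u : ℕ → H} (hu : ∀ j, ‖u j‖ ≤ 1)
    (h : ∀ g ∈ S, Tendsto (fun j => inner ℂ g (u j)) atTop (𝓝 0)) (g : H) :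
    Tendsto (fun j => inner ℂ g (u j)) atTop (𝓝 0) := by
  rw [Metric.tendsto_atTop]
  intro ε hε
  obtain ⟨g', hg', hdist⟩ := hS.exists_dist_lt g (half_pos hε)
  obtain ⟨N, hN⟩ := Metric.tendsto_atTop.1 (h g' hg') (ε / 2) (half_pos hε)
  refine ⟨N, fun j hj => ?_⟩
  have hnear : ‖inner ℂ (g - g') (u j)‖ ≤ dist g g' := by
    rw [dist_eq_norm]
    exact (norm_inner_le_norm _ _).trans (mul_le_of_le_one_right (norm_nonneg _) (hu j))
  have hsmall := hN j hj
  rw [dist_zero_right] at hsmall ⊢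
  have hsplit : inner ℂ g (u j) = inner ℂ (g - g') (u j) + inner ℂ g' (u j) := by
    rw [inner_sub_left, sub_add_cancel]
  rw [hsplit]
  linarith [norm_add_le (inner ℂ (g - g') (u j)) (inner ℂ g' (u j))]

theorem not_tendsto_norm_atTop_of_lt_essBottom [CompleteSpace H] [CompleteSpace K]
    {T : H →ₗ.[ℂ] K} (hTc : T.IsClosed) (hT : Dense (T.domain : Set H)) {b : ℝ} (hb0 : 0 ≤ b)
    (hb : (b : EReal) < essBottom (formOperator T)) {v : ℕ → H} {w : ℕ → K}
    (hvw : ∀ j, (v j, w j) ∈ T.graph) {S : Set H} (hS : Dense S)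
    (hbd : ∀ g ∈ S, ∃ M, ∀ j, ‖inner ℂ g (v j)‖ ≤ M)
    (hle : ∀ ε > 0, ∃ᶠ j in atTop, ‖w j‖ ^ 2 ≤ (b + ε) * ‖v j‖ ^ 2) :
    ¬ Tendsto (fun j => ‖v j‖) atTop atTop := by
  intro hlim
  obtain ⟨N, hN⟩ := eventually_atTop.1 (hlim.eventually (eventually_gt_atTop 0))
  have hpos : ∀ j, 0 < ‖v (j + N)‖ := fun j => hN _ (Nat.le_add_left N j)
  have hnorm : ∀ j, ‖((‖v (j + N)‖⁻¹ : ℝ) : ℂ) • v (j + N)‖ = 1 := fun j => by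
    rw [norm_smul, Complex.norm_real, norm_inv, norm_norm, inv_mul_cancel₀ (hpos j).ne']
  refine not_weaklyNull_of_lt_essBottom hTc hT hb0 hb
    (fun j => Submodule.smul_mem _ ((‖v (j + N)‖⁻¹ : ℝ) : ℂ) (hvw (j + N))) hnorm (fun ε hε => ?_)
    (tendsto_inner_of_dense hS (fun j => (hnorm j).le) fun g hg => ?_)
  · refine frequently_atTop.2 fun M => ?_
    obtain ⟨i, hi, hwi⟩ := frequently_atTop.1 (hle ε hε) (M + N)
    obtain ⟨j, rfl⟩ := Nat.exists_eq_add_of_le' ((Nat.le_add_left N M).trans hi)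
    refine ⟨j, Nat.le_of_add_le_add_right hi, ?_⟩
    rw [norm_smul, Complex.norm_real, norm_inv, norm_norm, mul_pow, inv_pow,
      inv_mul_le_iff₀ (pow_pos (hpos j) 2), mul_comm]
    exact hwi
  · obtain ⟨M, hM⟩ := hbd g hg
    have hbound : Tendsto (fun j => ‖v (j + N)‖⁻¹ * M) atTop (𝓝 0) := by
      have h := (tendsto_inv_atTop_zero.comp (hlim.comp (tendsto_add_atTop_nat N))).mul_const M
      rwa [zero_mul] at h
    refine squeeze_zero_norm (fun j => ?_) hbound
    rw [inner_smul_right, norm_mul, Complex.norm_real, norm_inv, norm_norm]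
    exact mul_le_mul_of_nonneg_left (hM _) (inv_nonneg.2 (norm_nonneg _))

end Weyl

section InfiniteVolume

variable {n m l : ℕ} {B : Coeffs n m l} {Ω : Opens (EuclideanSpace ℝ (Fin n))}

theorem lowSet_eq_empty_of_volume_eq_top (hB : FormClosable (smoothOp B Ω))
    (hΩ : volume (Ω : Set (EuclideanSpace ℝ (Fin n))) = ⊤) {b : ℝ} (hb0 : 0 ≤ b)
    (hb : (b : EReal) < essBottom (neumannOp B Ω)) : lowSet B b = ∅ := by
  refine Set.eq_empty_of_forall_notMem fun ξ hξ => ?_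
  obtain ⟨c, hc, hcb⟩ := mem_lowSet_iff_exists_norm_eq_one.1 hξ
  obtain ⟨C, hC, w, hw⟩ :=
    exists_dyadicWaveLp_mem_graph B Ω hb0 (ξ := ξ) (c := c) (by simp [hc, hcb])
  have hvol : ∀ j, ballVolume Ω (2 ^ j) ≤ ‖dyadicWaveLp Ω j ξ c‖ ^ 2 := fun j =>
    ballVolume_le_norm_sq_dyadicWaveLp j ξ hc
  have hlim : Tendsto (fun j => ‖dyadicWaveLp Ω j ξ c‖) atTop atTop :=
    (Real.tendsto_sqrt_atTop.comp (tendsto_atTop_mono hvol (tendsto_ballVolume hΩ))).congr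
      fun j => Real.sqrt_sq (norm_nonneg _)
  refine not_tendsto_norm_atTop_of_lt_essBottom hB.isClosable.closure_isClosed
    (dense_domain_neumannClosure hB) hb0 hb (fun j => (hw j).1) dense_testFunctions
    (fun g hg => ?_) (fun ε hε => ?_) hlim
  · obtain ⟨f, hf, -, rfl⟩ := mem_testFunctions_iff_exists_toLp.1 hg
    exact ⟨_, fun j => norm_inner_dyadicWaveLp_le
      ((integrable_congr (MemLp.coeFn_toLp _)).2 hf.integrable.restrict) j ξ c⟩
  -- The balls of radius `2 ^ j` fill volume at most like `2 ^ (n j)`, so infinitely often the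
  -- transition region of the truncation is not much larger than the region where it equals `1`.
  · exact frequently_le_add_mul_of_le_mul_pow (s := fun j => (2 ^ j)⁻¹) (by positivity)
      (ballVolume_two_pow_le Ω) ((tendsto_ballVolume hΩ).eventually_gt_atTop 0) hvol
      (fun j => by positivity)
      (tendsto_inv_atTop_zero.comp (tendsto_pow_atTop_atTop_of_one_lt one_lt_two))
      hC (fun j => (hw j).2) hε

end InfiniteVolume

/-! ### Comparison of the eigenvalues -/

section TrialSpaces

theorem exists_submodule_finrank_eq {K M : Type*} [DivisionRing K] [AddCommGroup M] [Module K M]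
    {V : Submodule K M} {k : ℕ} (hk : (k : Cardinal) ≤ Module.rank K V) :
    ∃ F ≤ V, FiniteDimensional K F ∧ Module.finrank K F = k := by
  obtain ⟨v, hv⟩ := exists_linearIndependent_of_le_rank hk
  have hv' : LinearIndependent K fun i => (v i : M) := hv.map' V.subtype V.ker_subtype
  refine ⟨Submodule.span K (Set.range fun i => (v i : M)), Submodule.span_le.2 ?_,
    FiniteDimensional.span_of_finite K (Set.finite_range _), ?_⟩
  · rintro _ ⟨i, rfl⟩
    exact (v i).2
  · rw [finrank_span_eq_card hv', Fintype.card_fin]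

theorem finrank_sup_span_singleton {K M : Type*} [DivisionRing K] [AddCommGroup M] [Module K M]
    {F : Submodule K M} [FiniteDimensional K F] {v : M} (hv : v ∉ F) :
    Module.finrank K ↥(F ⊔ K ∙ v) = Module.finrank K F + 1 := by
  have hv0 : v ≠ 0 := fun h => hv (h ▸ F.zero_mem)
  have hdisj : F ⊓ K ∙ v = ⊥ := ((Submodule.disjoint_span_singleton' hv0).2 hv).eq_bot
  have hdim := Submodule.finrank_sup_add_finrank_inf_eq F (K ∙ v)
  rwa [hdisj, finrank_bot, add_zero, finrank_span_singleton hv0] at hdim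

theorem norm_sq_add_smul_le {H K : Type*} [NormedAddCommGroup H] [InnerProductSpace ℂ H]
    [NormedAddCommGroup K] [InnerProductSpace ℂ K] {b : ℝ} {u v : H} {w z : K}
    (huw : ‖w‖ ^ 2 ≤ b * ‖u‖ ^ 2) (hvz : ‖z‖ ^ 2 = b * ‖v‖ ^ 2)
    (hinner : inner ℂ z w = (b : ℂ) * inner ℂ v u) (α : ℂ) :
    ‖w + α • z‖ ^ 2 ≤ b * ‖u + α • v‖ ^ 2 := by
  have hinner' : inner ℂ w z = (b : ℂ) * inner ℂ u v := by
    rw [← inner_conj_symm, hinner, map_mul, inner_conj_symm, Complex.conj_ofReal]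
  have hcross : RCLike.re (inner ℂ w (α • z)) = b * RCLike.re (inner ℂ u (α • v)) := by
    rw [inner_smul_right, inner_smul_right, hinner', mul_left_comm]
    exact Complex.re_ofReal_mul _ _
  rw [norm_add_sq (𝕜 := ℂ), norm_add_sq (𝕜 := ℂ), hcross, norm_smul, norm_smul, mul_pow, mul_pow,
    hvz]
  linarith

end TrialSpaces

theorem IsNthEigenvalue.eigenspace_ne_bot {H : Type*} [NormedAddCommGroup H]
    [InnerProductSpace ℂ H] {A : H →ₗ.[ℂ] H} {k : ℕ} {r : ℝ} (h : IsNthEigenvalue A k r) :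
    eigenspace A r ≠ ⊥ := by
  intro hbot
  have hcount : eigenvalueCount A (Set.Iio r) = eigenvalueCount A (Set.Iic r) :=
    eigenvalueCount_congr fun s hs =>
      ⟨fun hsr => Set.Iio_subset_Iic_self hsr,
        fun hsr => lt_of_le_of_ne hsr fun heq : s = r => hs (heq ▸ hbot)⟩
  exact (h.2.1.trans_le (h.2.2.trans hcount.ge)).false

section Comparison

variable {n m l : ℕ} {B : Coeffs n m l} {Ω : Opens (EuclideanSpace ℝ (Fin n))} {b : ℝ}

theorem exists_mem_graph_of_mem_eigenspan_dirichletOp {u : L2 Ω m}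
    (hu : u ∈ eigenspan (dirichletOp B Ω) (Set.Iic b)) :
    ∃ w, (u, w) ∈ (dirichletClosure B Ω).graph ∧ ‖w‖ ^ 2 ≤ b * ‖u‖ ^ 2 := by
  obtain ⟨f, -, hf, hle⟩ := exists_mem_formGraph_of_mem_eigenspan
    (dense_domain_dirichletClosure B Ω) (fun _ hr => hr) hu
  obtain ⟨w, hw, hform⟩ := mem_formGraph_iff.1 hf
  refine ⟨w, hw, ?_⟩
  rwa [hform u w hw, inner_self_eq_ofReal, Complex.ofReal_re] at hle

theorem volume_lowSet_ne_zero (hB : FormClosable (smoothOp B Ω)) {u : L2 Ω m}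
    (hu : u ∈ eigenspan (dirichletOp B Ω) (Set.Iic b)) (hu0 : u ≠ 0) :
    volume (lowSet B b) ≠ 0 := by
  intro hzero
  obtain ⟨w, hw, hle⟩ := exists_mem_graph_of_mem_eigenspan_dirichletOp hu
  refine hu0 (eq_zero_of_dirichlet_form_le hB ?_ hw hle)
  filter_upwards [measure_eq_zero_iff_ae_notMem.1 hzero] with ξ hξ c hc
  exact not_le.1 fun h => hξ ⟨c, hc, h⟩

theorem nonempty_of_L2_ne_zero {d : ℕ} {u : L2 Ω d} (hu : u ≠ 0) :
    (Ω : Set (EuclideanSpace ℝ (Fin n))).Nonempty := by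
  rw [Set.nonempty_iff_ne_empty]
  intro hempty
  refine hu (Lp.eq_zero_iff_ae_eq_zero.2 ?_)
  have hzero : volume.restrict (Ω : Set (EuclideanSpace ℝ (Fin n))) = 0 := by
    rw [hempty, Measure.restrict_empty]
  exact measure_mono_null (Set.subset_univ _) (by rw [hzero]; rfl)

theorem disjoint_eigenspan_dirichletOp_eigenspace_neumannOp (hB : FormClosable (smoothOp B Ω))
    [IsFiniteMeasure (volume.restrict (Ω : Set (EuclideanSpace ℝ (Fin n))))] (hn : n ≠ 0)
    (hbd : Bornology.IsBounded (lowSet B b)) :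
    Disjoint (eigenspan (dirichletOp B Ω) (Set.Iic b)) (eigenspace (neumannOp B Ω) b) := by
  refine Submodule.disjoint_def.2 fun u hu hu' => ?_
  obtain ⟨w, hw, -⟩ := exists_mem_graph_of_mem_eigenspan_dirichletOp hu
  exact eq_zero_of_dirichlet_of_neumann hB hn hbd hw hu'

theorem finiteDimensional_eigenspace_neumannOp (hB : FormClosable (smoothOp B Ω)) (hb0 : 0 ≤ b)
    (hb : (b : EReal) < essBottom (neumannOp B Ω)) :
    FiniteDimensional ℂ (eigenspace (neumannOp B Ω) b) := by
  have : FiniteDimensional ℂ (eigenspan (neumannOp B Ω) (Set.Iic b)) :=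
    finiteDimensional_eigenspan_Iic hB.isClosable.closure_isClosed
      (dense_domain_neumannClosure hB) hb0 hb
  exact Submodule.finiteDimensional_of_le (eigenspace_le_eigenspan Set.self_mem_Iic)

theorem exists_mem_graph_neumannClosure_notMem
    [IsFiniteMeasure (volume.restrict (Ω : Set (EuclideanSpace ℝ (Fin n))))]
    (hB : FormClosable (smoothOp B Ω)) (hΩ : (Ω : Set (EuclideanSpace ℝ (Fin n))).Nonempty)
    (hS : (lowSet B b \ strictLowSet B b).Infinite) (X : Submodule ℂ (L2 Ω m))
    [FiniteDimensional ℂ X] :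
    ∃ v ∉ X, ∃ z, (v, z) ∈ (neumannClosure B Ω).graph ∧ ‖z‖ ^ 2 = b * ‖v‖ ^ 2 ∧
      ∀ u w, (u, w) ∈ (dirichletClosure B Ω).graph → inner ℂ z w = (b : ℂ) * inner ℂ v u := by
  choose c hc0 hc using fun ξ : ↥(lowSet B b \ strictLowSet B b) =>
    exists_adjoint_symbol_eq_smul ξ.2
  obtain ⟨ξ, hξ⟩ := exists_waveLp_notMem hΩ hS hc0 X
  refine ⟨_, hξ, _, waveLp_mem_graph (B := B) _ _, ?_, fun u w huw => ?_⟩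
  · rw [norm_waveLp_sq, norm_waveLp_sq, norm_sq_eq_of_adjoint_apply_eq_smul (hc ξ)]
    ring
  · rw [inner_waveLp_of_mem_graph_dirichletClosure hB huw,
      ← ContinuousLinearMap.adjoint_inner_left, hc, inner_smul_left, Complex.conj_ofReal,
      inner_waveLp]

theorem finrank_succ_le_eigenvalueCount
    [IsFiniteMeasure (volume.restrict (Ω : Set (EuclideanSpace ℝ (Fin n))))] (hn : n ≠ 0)
    (hB : FormClosable (smoothOp B Ω)) (hΩ : (Ω : Set (EuclideanSpace ℝ (Fin n))).Nonempty)
    (hb0 : 0 ≤ b) (hb : (b : EReal) < essBottom (neumannOp B Ω))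
    (hS : (lowSet B b \ strictLowSet B b).Infinite) {F : Submodule ℂ (L2 Ω m)}
    [FiniteDimensional ℂ F] (hF : F ≤ eigenspan (dirichletOp B Ω) (Set.Iic b)) :
    ((Module.finrank ℂ F + 1 : ℕ) : ℕ∞) ≤ eigenvalueCount (neumannOp B Ω) (Set.Iio b) := by
  set E := eigenspace (neumannOp B Ω) b
  have : FiniteDimensional ℂ E := finiteDimensional_eigenspace_neumannOp hB hb0 hb
  obtain ⟨v, hv, z, hvz, hnorm, hinner⟩ :=
    exists_mem_graph_neumannClosure_notMem hB hΩ hS (F ⊔ E)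
  have hFE : Disjoint F E := (disjoint_eigenspan_dirichletOp_eigenspace_neumannOp hB hn
    (isBounded_lowSet hB hΩ hb0 hb)).mono_left hF
  have hv0 : v ≠ 0 := fun h => hv (h ▸ Submodule.zero_mem _)
  have hdisj : Disjoint (F ⊔ ℂ ∙ v) E := by
    rw [sup_comm]
    exact hFE.disjoint_sup_left_of_disjoint_sup_right
      ((Submodule.disjoint_span_singleton' hv0).2 hv).symm
  rw [← finrank_sup_span_singleton fun h => hv (Submodule.mem_sup_left h)]
  refine finrank_le_of_form_le hB.isClosable.closure_isClosed (dense_domain_neumannClosure hB)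
    hb0 hb (fun x hx => ?_) hdisj
  obtain ⟨u, hu, _, hy, rfl⟩ := Submodule.mem_sup.1 hx
  obtain ⟨α, rfl⟩ := Submodule.mem_span_singleton.1 hy
  obtain ⟨w, huw, hle⟩ := exists_mem_graph_of_mem_eigenspan_dirichletOp (hF hu)
  exact ⟨w + α • z, Submodule.add_mem _
    (LinearPMap.le_graph_of_le (dirichletClosure_le_neumannClosure hB) huw)
    (Submodule.smul_mem _ α hvz), norm_sq_add_smul_le hle hnorm (hinner u w huw) α⟩

theorem succ_le_eigenvalueCount_neumannOp (hn : 2 ≤ n) (hB : FormClosable (smoothOp B Ω))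
    (hb0 : 0 ≤ b) (hb : (b : EReal) < essBottom (neumannOp B Ω)) {k : ℕ} (hk0 : k ≠ 0)
    (hk : (k : ℕ∞) ≤ eigenvalueCount (dirichletOp B Ω) (Set.Iic b)) :
    ((k + 1 : ℕ) : ℕ∞) ≤ eigenvalueCount (neumannOp B Ω) (Set.Iio b) := by
  obtain ⟨F, hF, _, rfl⟩ := exists_submodule_finrank_eq (Cardinal.natCast_le_toENat.1 hk)
  obtain ⟨u, huF, hu0⟩ : ∃ u ∈ F, u ≠ 0 := Submodule.exists_mem_ne_zero_of_ne_bot fun h =>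
    hk0 (by rw [h, finrank_bot])
  have hvol : volume (lowSet B b) ≠ 0 := volume_lowSet_ne_zero hB (hF huF) hu0
  have hΩ := nonempty_of_L2_ne_zero hu0
  have : IsFiniteMeasure (volume.restrict (Ω : Set (EuclideanSpace ℝ (Fin n)))) :=
    isFiniteMeasure_restrict.2 fun htop =>
      hvol (by rw [lowSet_eq_empty_of_volume_eq_top hB htop hb0 hb, measure_empty])
  exact finrank_succ_le_eigenvalueCount (by lia) hB hΩ hb0 hb
    (infinite_lowSet_diff_of_volume_ne_zero hn (isBounded_lowSet hB hΩ hb0 hb) hvol) hF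

end Comparison

end Payne

end

open Payne in
theorem mainTheorem3_general {n m l : ℕ} (hn : 2 ≤ n)
    (Ω : Opens (EuclideanSpace ℝ (Fin n)))
    (B : Coeffs n m l)
    (hB : FormClosable (smoothOp B Ω))
    (k : ℕ) (lamD : ℝ)
    (hk : IsNthEigenvalue (dirichletOp B Ω) k lamD)
    (hlt : (lamD : EReal) < essBottom (neumannOp B Ω)) :
    ∃ lamN : ℝ, IsNthEigenvalue (neumannOp B Ω) (k + 1) lamN ∧ lamN < lamD := by
  have hlamD : 0 ≤ lamD :=
    nonneg_of_eigenspace_ne_bot (dense_domain_dirichletClosure B Ω) hk.eigenspace_ne_bot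
  have hk0 : k ≠ 0 := by
    rintro rfl
    exact not_lt_bot hk.2.1
  have hcount : ((k + 1 : ℕ) : ℕ∞) ≤ eigenvalueCount (neumannOp B Ω) (Set.Iio lamD) :=
    succ_le_eigenvalueCount_neumannOp hn hB hlamD hlt hk0 hk.2.2
  have hfin : {r : ℝ | r < lamD ∧ eigenspace (neumannOp B Ω) r ≠ ⊥}.Finite :=
    (finite_eigenvalues_le hB.isClosable.closure_isClosed (dense_domain_neumannClosure hB)
      hlamD hlt).subset fun r hr => ⟨hr.1.le, hr.2⟩
  obtain ⟨lamN, hlt', hlamN⟩ := exists_isNthEigenvalue_lt hlt hfin k.succ_ne_zero hcount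
  exact ⟨lamN, hlamN, hlt'⟩

theorem mainTheorem3 {n m l : ℕ} (hn : 2 ≤ n)
    (Ω : TopologicalSpace.Opens (EuclideanSpace ℝ (Fin n)))
    (B : Payne.Coeffs n m l)
    (hB : Payne.FormClosable (Payne.smoothOp B Ω))
    (k : ℕ) (lamD : ℝ)
    (hk : Payne.IsNthEigenvalue (Payne.dirichletOp B Ω) k lamD)
    (hpos : 0 < lamD)
    (hlt : (lamD : EReal) < Payne.essBottom (Payne.neumannOp B Ω)) :
    ∃ lamN : ℝ, Payne.IsNthEigenvalue (Payne.neumannOp B Ω) (k + 1) lamN ∧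
      lamN ≤ lamD ∧
      ((∃ u ∈ Payne.eigenspace (Payne.dirichletOp B Ω) lamD,
          u ∉ (Payne.neumannOp B Ω).domain) → lamN < lamD) := by
  obtain ⟨lamN, hlamN, hlt'⟩ := mainTheorem3_general hn Ω B hB k lamD hk hlt
  exact ⟨lamN, hlamN, hlt'.le, fun _ => hlt'⟩
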